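/- Let $\tilde A$ be an abelian group, $A\subseteq\tilde A$ a subgroup, and let $V$ be a Möbius or conformal vertex algebra over $\mathbb C$ that is strongly graded with respect to $A$. Let $W_1,W_2$ be strongly $\tilde A$-graded generalized $V$-modules (graded by generalized $L(0)$-eigenspaces) and let $z\in\mathbb C^\times$. *Notation.* For $v\in V$ of weight $h$ put $v^o=(-1)^h\sum_{k\ge0}\frac1{k!}L(1)^kv\otimes t^{2h-2-k}$, extended linearly to $V$, and for a rational function $f$ put $o(v\otimes f(t))=v^of(t^{-1})$. Let $T_z$ be the substitution $f(t)\mapsto f(t+z)$, let $\iota_+$ be the expansion of rational functions into $\mathbb C((t))$, and let $\tau_{W}(v\otimes\sum a_nt^n)=\sum a_nv_n$ on a generalized module $W$. The space $V\otimes\mathbb C[t,t^{-1},(z^{-1}-t)^{-1}]$ acts on $(W_1\otimes W_2)^*$ by $$(\tau_{P(z)}(\xi)\lambda)(w_{1}\otimes w_{2})=\lambda(\tau_{W_1}(\iota_+T_z\,o(\xi))w_{1}\otimes w_{2})+\lambda(w_{1}\otimes\tau_{W_2}(\iota_+\,o(\xi))w_{2}),$$ and $Y'_{P(z)}(v,x)=\sum_{n\in\mathbb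 Z}\tau_{P(z)}(v\otimes t^n)x^{-n-1}$. For $j=-1,0,1$ the operators $L'_{P(z)}(j)$ are the coefficients of $x^{-j-2}$ in $Y'_{P(z)}(\omega,x)$ if $V$ is conformal with conformal vector $\omega$, and if $V$ is Möbius they are defined by $$(L'_{P(z)}(j)\lambda)(w_1\otimes w_2)=\lambda\Big(w_1\otimes L(-j)w_2+\sum_{i=0}^{1-j}\tbinom{1-j}{i}z^iL(-j-i)w_1\otimes w_2\Big).$$ For $\beta\in\tilde A$, $((W_1\otimes W_2)^*)^{(\beta)}$ is the space of functionals vanishing on $(W_1\otimes W_2)^{(\gamma)}$ for all $\gamma\neq-\beta$; for $n\in\mathbb C$, the subscript $[n]$ (respectively $(n)$) denotes the intersection with the generalized (respectively ordinary) eigenspace of $L'_{P(z)}(0)$ with eigenvalue $n$. Write $((W_1\otimes W_2)^*)^{(\tilde A)}_{[\mathbb C]}$ and $((W_1\otimes W_2)^*)^{(\tilde A)}_{(\mathbb C)}$ for the sums over all $n,\beta$ of the spaces $((W_1\otimes W_2)^*)^{(\beta)}_{[n]}$ and $((W_1\otimes W_2)^*)^{(\beta)}_{(n)}$. * $\lambda\in\mathrm{COMP}_{P(z)}$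 means: for every $v\in V$, $Y'_{P(z)}(v,x)\lambda$ has only finitely many negative powers of $x$, and $$\tau_{P(z)}\Big(x_0^{-1}\delta\Big(\frac{x_1^{-1}-z}{x_0}\Big)Y_t(v,x_1)\Big)\lambda=x_0^{-1}\delta\Big(\frac{x_1^{-1}-z}{x_0}\Big)Y'_{P(z)}(v,x_1)\lambda,\qquad Y_t(v,x)=\sum_{n}(v\otimes t^n)x^{-n-1}.$$ * For $\lambda\in((W_1\otimes W_2)^*)^{(\tilde A)}_{[\mathbb C]}$, $W_\lambda$ is the smallest doubly graded (by $\mathbb C$ and $\tilde A$) subspace of $((W_1\otimes W_2)^*)^{(\tilde A)}_{[\mathbb C]}$ that contains $\lambda$ and is stable under all $\tau_{P(z)}(v\otimes t^m)$ ($v\in V$, $m\in\mathbb Z$) and under $L'_{P(z)}(-1),L'_{P(z)}(0),L'_{P(z)}(1)$. * $\lambda\in\mathrm{LGR}_{[\mathbb C];P(z)}$ means: $\lambda\in((W_1\otimes W_2)^*)^{(\tilde A)}_{[\mathbb C]}$ and, for all $n\in\mathbb C$, $\beta\in\tilde A$, $\dim(W_\lambda)^{(\beta)}_{[n]}<\infty$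 and $(W_\lambda)^{(\beta)}_{[n+k]}=0$ for all sufficiently negative $k\in\mathbb Z$. $\mathrm{LGR}_{(\mathbb C);P(z)}$ is defined in the same way, with $[\;\cdot\;]$ replaced by $(\;\cdot\;)$ throughout these conditions. **Theorem.** (1) If $\lambda\in\mathrm{COMP}_{P(z)}\cap\mathrm{LGR}_{[\mathbb C];P(z)}$, then $W_\lambda$ (which exists), equipped with the vertex operator map $Y'_{P(z)}$, with the operators $L'_{P(z)}(-1),L'_{P(z)}(0),L'_{P(z)}(1)$ and with its gradings, is a strongly $\tilde A$-graded generalized $V$-module. (2) If $\lambda\in\mathrm{COMP}_{P(z)}\cap\mathrm{LGR}_{(\mathbb C);P(z)}$, then $W_\lambda\subseteq((W_1\otimes W_2)^*)^{(\tilde A)}_{(\mathbb C)}$, and $W_\lambda$ with the same structure is a strongly $\tilde A$-graded (ordinary) $V$-module, that is, it is the direct sum of its $L'_{P(z)}(0)$-eigenspaces. -/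

import Mathlib

open scoped TensorProduct

noncomputable section

namespace LogTensor

/-! ### Gradings and vertex operator maps -/

/-- `E` is a direct sum decomposition (grading) of the vector space `W`. -/
def IsGrading {ι W : Type*} [AddCommGroup W] [Module ℂ W] (E : ι → Submodule ℂ W) : Prop :=
  iSupIndep E ∧ ⨆ i, E i = ⊤

/-- A linear map `V → (End W)[[x, x⁻¹]]`, `v ↦ Y(v, x) = ∑ vₙ x ^ (-n-1)`, given by its
components: `Y v n` is `vₙ`. -/
abbrev VOMap (V W : Type*) [AddCommGroup V] [Module ℂ V] [AddCommGroup W] [Module ℂ W] :=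
  V →ₗ[ℂ] (ℤ → Module.End ℂ W)

/-- The three operators `L(-1)`, `L(0)`, `L(1)`. -/
structure Sl2Ops (W : Type*) [AddCommGroup W] [Module ℂ W] where
  /-- `L(-1)` -/
  Lneg : Module.End ℂ W
  /-- `L(0)` -/
  Lzero : Module.End ℂ W
  /-- `L(1)` -/
  Lpos : Module.End ℂ W

section Axioms

variable {V W : Type*} [AddCommGroup V] [Module ℂ V] [AddCommGroup W] [Module ℂ W]

/-- `vₙ w = 0` for `n` sufficiently large. -/
def LowerTruncated (Y : VOMap V W) : Prop :=
  ∀ (v : V) (w : W), ∃ N : ℤ, ∀ n : ℤ, N ≤ n → Y v n w = 0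

/-- `Y(𝟏, x) = 1`. -/
def VacuumProperty (vac : V) (Y : VOMap V W) : Prop :=
  ∀ n : ℤ, Y vac n = if n = -1 then 1 else 0

/-- The Jacobi identity
`x₀⁻¹ δ((x₁-x₂)/x₀) Y(u,x₁) Y(v,x₂) w - x₀⁻¹ δ((x₂-x₁)/(-x₀)) Y(v,x₂) Y(u,x₁) w
  = x₂⁻¹ δ((x₁-x₀)/x₂) Y(Y(u,x₀)v,x₂) w`,
as the equality of the coefficients of `x₀ ^ (-l-1) x₁ ^ (-m-1) x₂ ^ (-n-1)` for all `l, m, n`.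
The sums are finite when `YV` and `Y` are lower truncated. -/
def JacobiIdentity (YV : VOMap V V) (Y : VOMap V W) : Prop :=
  ∀ (u v : V) (w : W) (l m n : ℤ),
    (∑ᶠ i : ℕ, ((-1 : ℂ) ^ i * ((Ring.choose l i : ℤ) : ℂ)) • Y u (m + l - i) (Y v (n + i) w))
      - (∑ᶠ i : ℕ, ((-1 : ℂ) ^ l * (-1 : ℂ) ^ i * ((Ring.choose l i : ℤ) : ℂ)) •
          Y v (n + l - i) (Y u (m + i) w))
      = ∑ᶠ i : ℕ, ((Ring.choose m i : ℤ) : ℂ) • Y (YV u (l + i) v) (m + n - i) w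

/-- `d/dx Y(v, x) = Y(L(-1)v, x)`, where `Lneg` is the operator `L(-1)` on `V`. -/
def DerivativeProperty (Lneg : Module.End ℂ V) (Y : VOMap V W) : Prop :=
  ∀ (v : V) (n : ℤ), Y (Lneg v) n = (-n : ℂ) • Y v (n - 1)

/-- The bracket relations `[L(m), L(n)] = (m - n) L(m + n)` of `𝔰𝔩(2)`. -/
def IsSl2Rep (L : Sl2Ops W) : Prop :=
  ⁅L.Lzero, L.Lneg⁆ = L.Lneg ∧ ⁅L.Lzero, L.Lpos⁆ = -L.Lpos ∧
    ⁅L.Lneg, L.Lpos⁆ = (-2 : ℂ) • L.Lzero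

/-- `[L(-1), Y(v,x)] = Y(L(-1)v,x)`, `[L(0), Y(v,x)] = Y(L(0)v,x) + x Y(L(-1)v,x)` and
`[L(1), Y(v,x)] = Y(L(1)v,x) + 2x Y(L(0)v,x) + x² Y(L(-1)v,x)`, in components. -/
def Sl2Commutators (LV : Sl2Ops V) (Y : VOMap V W) (L : Sl2Ops W) : Prop :=
  ∀ (v : V) (n : ℤ),
    ⁅L.Lneg, Y v n⁆ = Y (LV.Lneg v) n ∧
    ⁅L.Lzero, Y v n⁆ = Y (LV.Lzero v) n + Y (LV.Lneg v) (n + 1) ∧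
    ⁅L.Lpos, Y v n⁆ =
      Y (LV.Lpos v) n + (2 : ℂ) • Y (LV.Lzero v) (n + 1) + Y (LV.Lneg v) (n + 2)

/-- The Virasoro relations with central charge `c`. -/
def VirasoroRelations (c : ℂ) (L : ℤ → Module.End ℂ W) : Prop :=
  ∀ m n : ℤ, ⁅L m, L n⁆ =
    ((m : ℂ) - n) • L (m + n) +
      (if m + n = 0 then (((m : ℂ) ^ 3 - m) / 12 * c) • (1 : Module.End ℂ W) else 0)

/-- The components `L(j) = ω_{j+1}` of `Y(ω, x)` for `j = -1, 0, 1`. -/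
def conformalOps (ω : V) (Y : VOMap V W) : Sl2Ops W where
  Lneg := Y ω 0
  Lzero := Y ω 1
  Lpos := Y ω 2

end Axioms

/-! ### Möbius and conformal vertex algebras -/

/-- The part of the data and axioms that Möbius and conformal vertex algebras share. -/
structure GradedVertexAlgebra (V : Type*) [AddCommGroup V] [Module ℂ V] where
  /-- `wt n` is the space `V_(n)` of vectors of weight `n`. -/
  wt : ℤ → Submodule ℂ V
  Y : VOMap V V
  vac : V
  wt_grading : IsGrading wt
  vac_mem : vac ∈ wt 0
  lowerTruncated : LowerTruncated Y
  vacuum : VacuumProperty vac Y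
  creation : ∀ v : V, (∀ n : ℤ, 0 ≤ n → Y v n vac = 0) ∧ Y v (-1) vac = v
  jacobi : JacobiIdentity Y Y

structure MobiusVertexAlgebra (V : Type*) [AddCommGroup V] [Module ℂ V] extends
    GradedVertexAlgebra V where
  L : Sl2Ops V
  sl2 : IsSl2Rep L
  sl2_comm : Sl2Commutators L Y L
  deriv : DerivativeProperty L.Lneg Y
  Lzero_wt : ∀ (n : ℤ), ∀ v ∈ wt n, L.Lzero v = (n : ℂ) • v

structure ConformalVertexAlgebra (V : Type*) [AddCommGroup V] [Module ℂ V] extends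
    GradedVertexAlgebra V where
  /-- the conformal vector -/
  ω : V
  /-- the central charge -/
  c : ℂ
  ω_mem : ω ∈ wt 2
  virasoro : VirasoroRelations c (fun n => Y ω (n + 1))
  deriv : DerivativeProperty (Y ω 0) Y
  Lzero_wt : ∀ (n : ℤ), ∀ v ∈ wt n, Y ω 1 v = (n : ℂ) • v

/-- A Möbius or conformal vertex algebra. -/
inductive MobiusOrConformal (V : Type*) [AddCommGroup V] [Module ℂ V] where
  | mobius (M : MobiusVertexAlgebra V)
  | conformal (C : ConformalVertexAlgebra V)

namespace MobiusOrConformal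

variable {V : Type*} [AddCommGroup V] [Module ℂ V]

def base : MobiusOrConformal V → GradedVertexAlgebra V
  | mobius M => M.toGradedVertexAlgebra
  | conformal C => C.toGradedVertexAlgebra

/-- The operators `L(-1)`, `L(0)`, `L(1)` on `V`. -/
def L : MobiusOrConformal V → Sl2Ops V
  | mobius M => M.L
  | conformal C => conformalOps C.ω C.Y

/-- The axioms on the operators `L(j)` of a module that differ in the two cases: for Möbius `V`,
a representation of `𝔰𝔩(2)` with the commutator formulas; for conformal `V`, the `L(j)` are the
components of `Y(ω, x)`, which satisfy the Virasoro relations. -/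
def ModuleSymmetry {W : Type*} [AddCommGroup W] [Module ℂ W] :
    MobiusOrConformal V → VOMap V W → Sl2Ops W → Prop
  | mobius M, Y, L => IsSl2Rep L ∧ Sl2Commutators M.L Y L
  | conformal C, Y, L =>
      L = conformalOps C.ω Y ∧ VirasoroRelations C.c (fun n => Y C.ω (n + 1))

theorem Lzero_wt (U : MobiusOrConformal V) (n : ℤ) (v : V) (hv : v ∈ U.base.wt n) :
    U.L.Lzero v = (n : ℂ) • v := by
  cases U with
  | mobius M => exact M.Lzero_wt n v hv
  | conformal C => exact C.Lzero_wt n v hv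

theorem Lzero_Lpos (U : MobiusOrConformal V) : ⁅U.L.Lzero, U.L.Lpos⁆ = -U.L.Lpos := by
  cases U with
  | mobius M => exact M.sl2.2.1
  | conformal C =>
    have h := C.virasoro 0 1
    norm_num at h
    exact h

end MobiusOrConformal

/-- A Möbius or conformal vertex algebra `V` strongly graded with respect to the abelian group `A`
(a subgroup of the abelian group `B`). -/
structure StronglyGradedVertexAlgebra {B : Type*} [AddCommGroup B] (A : AddSubgroup B)
    (V : Type*) [AddCommGroup V] [Module ℂ V] where
  va : MobiusOrConformal V
  /-- `gr α` is `V^(α)`. -/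
  gr : A → Submodule ℂ V
  gr_grading : IsGrading gr
  gr_compat : ∀ α, gr α = ⨆ n, va.base.wt n ⊓ gr α
  gr_trunc : ∀ α, ∃ K : ℤ, ∀ n : ℤ, n ≤ K → va.base.wt n ⊓ gr α = ⊥
  gr_finite : ∀ (α : A) (n : ℤ), FiniteDimensional ℂ ↥(va.base.wt n ⊓ gr α)
  vac_mem_gr : va.base.vac ∈ gr 0
  Y_gr : ∀ (α β : A) (l : ℤ), ∀ v ∈ gr α, ∀ u ∈ gr β, va.base.Y v l u ∈ gr (α + β)
  L_gr : ∀ α, ∀ v ∈ gr α, va.L.Lneg v ∈ gr α ∧ va.L.Lzero v ∈ gr α ∧ va.L.Lpos v ∈ gr α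
  ω_mem_gr : ∀ C, va = .conformal C → C.ω ∈ gr 0

/-! ### Strongly graded (generalized) modules -/

/-- The data of a module: the vertex operator map, the operators `L(-1)`, `L(0)`, `L(1)`, and the
second grading, by `B`.  (The grading by `ℂ` is the one by (generalized) eigenspaces of `L(0)`; for
conformal `V`, the axioms below require the `L(j)` to be components of `Y(ω, x)`.) -/
structure ModuleData (B V W : Type*) [AddCommGroup V] [Module ℂ V]
    [AddCommGroup W] [Module ℂ W] where
  Y : VOMap V W
  L : Sl2Ops W
  /-- `gr β` is `W^(β)`. -/
  gr : B → Submodule ℂ W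

section Modules

variable {B : Type*} [AddCommGroup B] {A : AddSubgroup B}
  {V : Type*} [AddCommGroup V] [Module ℂ V] {W : Type*} [AddCommGroup W] [Module ℂ W]

/-- All the axioms for a strongly `B`-graded module whose weight spaces are the `E n`, `n ∈ ℂ`. -/
structure IsStronglyGradedWith (𝒱 : StronglyGradedVertexAlgebra A V) (D : ModuleData B V W)
    (E : ℂ → Submodule ℂ W) : Prop where
  lowerTruncated : LowerTruncated D.Y
  vacuum : VacuumProperty 𝒱.va.base.vac D.Y
  jacobi : JacobiIdentity 𝒱.va.base.Y D.Y
  symmetry : 𝒱.va.ModuleSymmetry D.Y D.L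
  deriv : DerivativeProperty 𝒱.va.L.Lneg D.Y
  wt_grading : IsGrading E
  gr_grading : IsGrading D.gr
  gr_compat : ∀ β, D.gr β = ⨆ n, E n ⊓ D.gr β
  gr_trunc : ∀ (n : ℂ) (β : B), ∃ K : ℤ, ∀ k : ℤ, k ≤ K → E (n + k) ⊓ D.gr β = ⊥
  gr_finite : ∀ (n : ℂ) (β : B), FiniteDimensional ℂ ↥(E n ⊓ D.gr β)
  Y_gr : ∀ (α : A) (β : B) (l : ℤ), ∀ v ∈ 𝒱.gr α, ∀ w ∈ D.gr β, D.Y v l w ∈ D.gr (α + β)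
  L_gr : ∀ β, ∀ w ∈ D.gr β, D.L.Lneg w ∈ D.gr β ∧ D.L.Lzero w ∈ D.gr β ∧ D.L.Lpos w ∈ D.gr β

/-- A strongly graded generalized `V`-module: `W` is the direct sum of the generalized eigenspaces
`W_[n]` of `L(0)`. -/
def IsStronglyGradedGeneralizedModule (𝒱 : StronglyGradedVertexAlgebra A V)
    (D : ModuleData B V W) : Prop :=
  IsStronglyGradedWith 𝒱 D (fun n => D.L.Lzero.maxGenEigenspace n)

/-- A strongly graded (ordinary) `V`-module: `W` is the direct sum of the eigenspaces `W_(n)`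
of `L(0)`. -/
def IsStronglyGradedModule (𝒱 : StronglyGradedVertexAlgebra A V)
    (D : ModuleData B V W) : Prop :=
  IsStronglyGradedWith 𝒱 D (fun n => D.L.Lzero.eigenspace n)

end Modules

/-- A strongly graded generalized `V`-module structure on `W`. -/
structure GeneralizedModule {B : Type*} [AddCommGroup B] {A : AddSubgroup B}
    {V : Type*} [AddCommGroup V] [Module ℂ V] (𝒱 : StronglyGradedVertexAlgebra A V)
    (W : Type*) [AddCommGroup W] [Module ℂ W] extends ModuleData B V W where
  isModule : IsStronglyGradedGeneralizedModule 𝒱 toModuleData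

/-! ### The action `τ_W` of `V ⊗ ℂ((t))` on a module -/

section TauW

variable {V W : Type*} [AddCommGroup V] [Module ℂ V] [AddCommGroup W] [Module ℂ W]

theorem tauW_support (Y : VOMap V W) (hY : LowerTruncated Y) (v : V) (g : LaurentSeries ℂ)
    (w : W) : (Function.support fun n : ℤ => g.coeff n • Y v n w).Finite := by
  obtain ⟨N, hN⟩ := hY v w
  refine (Set.finite_Ico g.order N).subset fun n hn => ?_
  rw [Function.mem_support] at hn
  refine ⟨?_, ?_⟩
  · by_contra h
    exact hn (by rw [HahnSeries.coeff_eq_zero_of_lt_order (not_le.mp h), zero_smul])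
  · by_contra h
    exact hn (by rw [hN n (not_lt.mp h), smul_zero])

/-- `τ_W : V ⊗ ℂ((t)) → End W`, `v ⊗ ∑ aₙ tⁿ ↦ ∑ aₙ vₙ`. -/
def tauW (Y : VOMap V W) (hY : LowerTruncated Y) :
    V ⊗[ℂ] LaurentSeries ℂ →ₗ[ℂ] Module.End ℂ W :=
  TensorProduct.lift (LinearMap.mk₂ ℂ
    (fun v g =>
      { toFun := fun w => ∑ᶠ n : ℤ, g.coeff n • Y v n w
        map_add' := fun w w' => by
          rw [← finsum_add_distrib (tauW_support Y hY v g w) (tauW_support Y hY v g w')]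
          simp only [map_add, smul_add]
        map_smul' := fun c w => by
          rw [RingHom.id_apply, smul_finsum' c (tauW_support Y hY v g w)]
          simp only [map_smul, smul_comm c] })
    (fun v v' g => by
      ext w
      simp only [LinearMap.coe_mk, AddHom.coe_mk, LinearMap.add_apply]
      rw [← finsum_add_distrib (tauW_support Y hY v g w) (tauW_support Y hY v' g w)]
      simp only [map_add, Pi.add_apply, LinearMap.add_apply, smul_add])
    (fun c v g => by
      ext w
      simp only [LinearMap.coe_mk, AddHom.coe_mk, LinearMap.smul_apply]
      rw [smul_finsum' c (tauW_support Y hY v g w)]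
      simp only [map_smul, Pi.smul_apply, LinearMap.smul_apply, smul_comm c])
    (fun v g g' => by
      ext w
      simp only [LinearMap.coe_mk, AddHom.coe_mk, LinearMap.add_apply]
      rw [← finsum_add_distrib (tauW_support Y hY v g w) (tauW_support Y hY v g' w)]
      simp only [HahnSeries.coeff_add, add_smul])
    (fun c v g => by
      ext w
      simp only [LinearMap.coe_mk, AddHom.coe_mk, LinearMap.smul_apply]
      rw [smul_finsum' c (tauW_support Y hY v g w)]
      simp only [HahnSeries.coeff_smul, smul_assoc]))

theorem tauW_tmul (Y : VOMap V W) (hY : LowerTruncated Y) (v : V) (g : LaurentSeries ℂ) (w : W) :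
    tauW Y hY (v ⊗ₜ g) w = ∑ᶠ n : ℤ, g.coeff n • Y v n w := rfl

end TauW

/-! ### Rational functions of the formal variable `t`

The formal variable is `RatFunc.X`; the expansion map `ι₊ : ℂ(t) → ℂ((t))` identifies
`ι₊ ℂ(t)` with `ℂ(t)`, so that `V ⊗ ι₊ ℂ[t, t⁻¹, (z⁻¹ - t)⁻¹]` is a subspace of `V ⊗ ℂ(t)`. -/

/-- The homomorphism `ℂ(t) → ℂ(t)` that substitutes the nonconstant rational function `r` for
`t`. -/
def substRat (r : RatFunc ℂ) (hr : Transcendental ℂ r) : RatFunc ℂ →ₐ[ℂ] RatFunc ℂ :=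
  RatFunc.liftAlgHom (Polynomial.aeval r)
    (nonZeroDivisors_le_comap_nonZeroDivisors_of_injective _
      (transcendental_iff_injective.mp hr))

theorem transcendental_X_inv : Transcendental ℂ (RatFunc.X⁻¹ : RatFunc ℂ) := by
  intro h
  have h' := h.inv
  rw [inv_inv] at h'
  exact RatFunc.transcendental_X h'

theorem transcendental_X_add (a : ℂ) :
    Transcendental ℂ (RatFunc.X + RatFunc.C a : RatFunc ℂ) := by
  intro h
  have h' := h.sub (isAlgebraic_algebraMap (R := ℂ) (A := RatFunc ℂ) a)
  rw [RatFunc.algebraMap_eq_C, add_sub_cancel_right] at h'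
  exact RatFunc.transcendental_X h'

/-- `f(t) ↦ f(t⁻¹)`. -/
def invSubst : RatFunc ℂ →ₐ[ℂ] RatFunc ℂ := substRat RatFunc.X⁻¹ transcendental_X_inv

/-- The translation `T_a : f(t) ↦ f(t + a)`. -/
def translate (a : ℂ) : RatFunc ℂ →ₐ[ℂ] RatFunc ℂ :=
  substRat (RatFunc.X + RatFunc.C a) (transcendental_X_add a)

theorem substRat_X (r : RatFunc ℂ) (hr : Transcendental ℂ r) :
    substRat r hr RatFunc.X = r := by
  simp [substRat, RatFunc.liftAlgHom_apply]

theorem substRat_C (r : RatFunc ℂ) (hr : Transcendental ℂ r) (a : ℂ) :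
    substRat r hr (RatFunc.C a) = RatFunc.C a := by
  simp [substRat, RatFunc.liftAlgHom_apply]

theorem invSubst_X : invSubst RatFunc.X = (RatFunc.X⁻¹ : RatFunc ℂ) := substRat_X _ _

theorem translate_X (a : ℂ) :
    translate a RatFunc.X = (RatFunc.X + RatFunc.C a : RatFunc ℂ) := substRat_X _ _

/-- The expansion of rational functions as Laurent series with finitely many negative powers of
`t`, as a ring homomorphism. -/
def iotaPlusHom : RatFunc ℂ →+* LaurentSeries ℂ :=
  RatFunc.liftRingHom (algebraMap (Polynomial ℂ) (LaurentSeries ℂ))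
    (nonZeroDivisors_le_comap_nonZeroDivisors_of_injective _
      (FaithfulSMul.algebraMap_injective (Polynomial ℂ) (LaurentSeries ℂ)))

theorem iotaPlusHom_X : iotaPlusHom RatFunc.X = HahnSeries.single 1 1 := by
  simp [iotaPlusHom, RatFunc.liftRingHom_apply]

theorem iotaPlusHom_C (a : ℂ) : iotaPlusHom (RatFunc.C a) = HahnSeries.C a := by
  simp [iotaPlusHom, RatFunc.liftRingHom_apply]

/-- `ι₊ : ℂ(t) → ℂ((t))`. -/
def iotaPlus : RatFunc ℂ →ₗ[ℂ] LaurentSeries ℂ where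
  toFun := iotaPlusHom
  map_add' := map_add iotaPlusHom
  map_smul' a f := by
    rw [RatFunc.smul_eq_C_mul, map_mul, iotaPlusHom_C, HahnSeries.C_mul_eq_smul, RingHom.id_apply]

/-! ### The opposite-operator map -/

section Opposite

variable {B : Type*} [AddCommGroup B] {A : AddSubgroup B}
  {V : Type*} [AddCommGroup V] [Module ℂ V]

theorem eq_of_le_of_iSup_eq_top {ι W : Type*} [AddCommGroup W] [Module ℂ W]
    {E F : ι → Submodule ℂ W} (hE : ⨆ i, E i = ⊤) (hle : ∀ i, E i ≤ F i) (hF : iSupIndep F)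
    (i : ι) : F i = E i := by
  refine le_antisymm ?_ (hle i)
  have h1 : E i ⊔ ⨆ (j) (_ : j ≠ i), E j = ⊤ := by
    rw [eq_top_iff, ← hE]
    refine iSup_le fun j => ?_
    by_cases hj : j = i
    · subst hj; exact le_sup_left
    · exact le_sup_of_le_right (le_iSup₂_of_le j hj le_rfl)
  calc F i = (E i ⊔ ⨆ (j) (_ : j ≠ i), E j) ⊓ F i := by rw [h1, top_inf_eq]
    _ = E i ⊔ (⨆ (j) (_ : j ≠ i), E j) ⊓ F i := sup_inf_assoc_of_le _ (hle i)
    _ ≤ E i ⊔ (⨆ (j) (_ : j ≠ i), F j) ⊓ F i := by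
        gcongr with j hj
        exact hle j
    _ = E i := by rw [(hF i).symm.eq_bot, sup_bot_eq]

namespace StronglyGradedVertexAlgebra

theorem wt_eq_eigenspace (𝒱 : StronglyGradedVertexAlgebra A V) (n : ℤ) :
    𝒱.va.L.Lzero.eigenspace (n : ℂ) = 𝒱.va.base.wt n := by
  refine eq_of_le_of_iSup_eq_top (F := fun n : ℤ => 𝒱.va.L.Lzero.eigenspace (n : ℂ))
    𝒱.va.base.wt_grading.2 (fun i v hv => ?_) ?_ n
  · exact Module.End.mem_eigenspace_iff.mpr (𝒱.va.Lzero_wt i v hv)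
  · exact (Module.End.eigenspaces_iSupIndep _).comp Int.cast_injective

/-- `L(1)` is locally nilpotent on `V`. -/
theorem Lpos_locally_nilpotent (𝒱 : StronglyGradedVertexAlgebra A V) (v : V) :
    ∃ K : ℕ, ∀ k : ℕ, K ≤ k → (𝒱.va.L.Lpos ^ k) v = 0 := by
  let S : Submodule ℂ V :=
    { carrier := {v | ∃ K : ℕ, ∀ k : ℕ, K ≤ k → (𝒱.va.L.Lpos ^ k) v = 0}
      zero_mem' := ⟨0, fun k _ => map_zero _⟩
      add_mem' := by
        rintro a b ⟨K, hK⟩ ⟨K', hK'⟩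
        refine ⟨max K K', fun k hk => ?_⟩
        rw [map_add, hK k (le_trans (le_max_left _ _) hk),
          hK' k (le_trans (le_max_right _ _) hk), add_zero]
      smul_mem' := by
        rintro c a ⟨K, hK⟩
        exact ⟨K, fun k hk => by rw [map_smul, hK k hk, smul_zero]⟩ }
  suffices h : (⊤ : Submodule ℂ V) ≤ S from h trivial
  rw [← 𝒱.gr_grading.2]
  refine iSup_le fun α => ?_
  rw [𝒱.gr_compat α]
  refine iSup_le fun n v hv => ?_
  have step : ∀ k : ℕ, (𝒱.va.L.Lpos ^ k) v ∈ 𝒱.va.base.wt (n - k) ⊓ 𝒱.gr α := by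
    intro k
    induction k with
    | zero => simpa using hv
    | succ k ih =>
      rw [pow_succ', Module.End.mul_apply]
      refine ⟨?_, (𝒱.L_gr α _ ih.2).2.2⟩
      have h0 := 𝒱.va.Lzero_wt _ _ ih.1
      have hbr := LinearMap.congr_fun 𝒱.va.Lzero_Lpos ((𝒱.va.L.Lpos ^ k) v)
      rw [Ring.lie_def, LinearMap.sub_apply, Module.End.mul_apply, Module.End.mul_apply, h0,
        map_smul, LinearMap.neg_apply, sub_eq_iff_eq_add] at hbr
      rw [← wt_eq_eigenspace]
      refine Module.End.mem_eigenspace_iff.mpr ?_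
      rw [hbr]
      push_cast
      module
  obtain ⟨K, hK⟩ := 𝒱.gr_trunc α
  refine ⟨(n - K).toNat, fun k hk => ?_⟩
  have h1 := step k
  rw [hK (n - k) (by omega)] at h1
  exact (Submodule.mem_bot ℂ).mp h1

theorem opp_support (𝒱 : StronglyGradedVertexAlgebra A V) (h : ℤ) (v : V) :
    (Function.support fun k : ℕ => ((-1 : ℂ) ^ h / (k.factorial : ℂ)) •
      ((𝒱.va.L.Lpos ^ k) v ⊗ₜ[ℂ] ((RatFunc.X : RatFunc ℂ) ^ (2 * h - 2 - (k : ℤ))))).Finite := by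
  obtain ⟨K, hK⟩ := 𝒱.Lpos_locally_nilpotent v
  refine (Set.finite_Iio K).subset fun k hk => ?_
  rw [Function.mem_support] at hk
  by_contra hlt
  exact hk (by rw [hK k (not_lt.mp hlt), TensorProduct.zero_tmul, smul_zero])

/-- `v ↦ (-1)^h ∑ₖ (1/k!) L(1)ᵏ v ⊗ t ^ (2h-2-k)`, which is `v ↦ vᵒ` on `V_(h)`. -/
def oppHomogeneous (𝒱 : StronglyGradedVertexAlgebra A V) (h : ℤ) :
    V →ₗ[ℂ] V ⊗[ℂ] RatFunc ℂ where
  toFun v := ∑ᶠ k : ℕ, ((-1 : ℂ) ^ h / (k.factorial : ℂ)) •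
    ((𝒱.va.L.Lpos ^ k) v ⊗ₜ[ℂ] ((RatFunc.X : RatFunc ℂ) ^ (2 * h - 2 - (k : ℤ))))
  map_add' v v' := by
    rw [← finsum_add_distrib (𝒱.opp_support h v) (𝒱.opp_support h v')]
    simp only [map_add, TensorProduct.add_tmul, smul_add]
  map_smul' c v := by
    rw [RingHom.id_apply, smul_finsum' c (𝒱.opp_support h v)]
    simp only [map_smul, ← TensorProduct.smul_tmul', smul_comm c]

/-- The decomposition of vectors of `V` into homogeneous components, `V ≃ ⨁ₙ V_(n)`. -/
def wtDecompose (𝒱 : StronglyGradedVertexAlgebra A V) :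
    V ≃ₗ[ℂ] DirectSum ℤ (fun n => 𝒱.va.base.wt n) :=
  (LinearEquiv.ofBijective (DirectSum.coeLinearMap 𝒱.va.base.wt)
    (DirectSum.isInternal_submodule_of_iSupIndep_of_iSup_eq_top
      𝒱.va.base.wt_grading.1 𝒱.va.base.wt_grading.2)).symm

/-- `v ↦ vᵒ = e^{t⁻¹L(1)} (-t²)^{L(0)} v t⁻²`. -/
def opp (𝒱 : StronglyGradedVertexAlgebra A V) : V →ₗ[ℂ] V ⊗[ℂ] RatFunc ℂ :=
  DirectSum.toModule ℂ ℤ (V ⊗[ℂ] RatFunc ℂ)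
    (fun h => 𝒱.oppHomogeneous h ∘ₗ (𝒱.va.base.wt h).subtype) ∘ₗ 𝒱.wtDecompose.toLinearMap

theorem opp_of_mem (𝒱 : StronglyGradedVertexAlgebra A V) (h : ℤ) (v : V)
    (hv : v ∈ 𝒱.va.base.wt h) : 𝒱.opp v = 𝒱.oppHomogeneous h v := by
  have h1 : 𝒱.wtDecompose v =
      DirectSum.lof ℂ ℤ (fun n => 𝒱.va.base.wt n) h ⟨v, hv⟩ := by
    rw [wtDecompose, LinearEquiv.symm_apply_eq]
    exact (DirectSum.coeLinearMap_lof 𝒱.va.base.wt h ⟨v, hv⟩).symm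
  rw [opp, LinearMap.comp_apply, LinearEquiv.coe_coe, h1, DirectSum.toModule_lof]
  rfl

/-- The map `ι₋⁻¹ ∘ o` on `V ⊗ ℂ(t)`: `v ⊗ f(t) ↦ vᵒ f(t⁻¹)`. -/
def oppMap (𝒱 : StronglyGradedVertexAlgebra A V) :
    V ⊗[ℂ] RatFunc ℂ →ₗ[ℂ] V ⊗[ℂ] RatFunc ℂ :=
  TensorProduct.lift (LinearMap.mk₂ ℂ
    (fun v f => LinearMap.lTensor V (LinearMap.mulLeft ℂ (invSubst f)) (𝒱.opp v))
    (fun v v' f => by rw [map_add, map_add])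
    (fun c v f => by rw [map_smul, map_smul])
    (fun v f f' => by
      rw [map_add, ← LinearMap.add_apply, ← LinearMap.lTensor_add]
      congr 2
      ext x
      simp [add_mul])
    (fun c v f => by
      have h : invSubst (c • f) = c • invSubst f := by
        rw [RatFunc.smul_eq_C_mul, RatFunc.smul_eq_C_mul, map_mul, invSubst, substRat_C]
      rw [h, ← LinearMap.smul_apply, ← LinearMap.lTensor_smul]
      congr 2
      ext x
      simp))

theorem oppMap_tmul (𝒱 : StronglyGradedVertexAlgebra A V) (v : V) (f : RatFunc ℂ) :
    𝒱.oppMap (v ⊗ₜ f) = LinearMap.lTensor V (LinearMap.mulLeft ℂ (invSubst f)) (𝒱.opp v) := rfl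

end StronglyGradedVertexAlgebra

end Opposite

/-! ### The action `τ_{P(z)}` on `(W₁ ⊗ W₂)*` -/

section PzAction

variable {B : Type*} [AddCommGroup B] {A : AddSubgroup B}
  {V : Type*} [AddCommGroup V] [Module ℂ V] {𝒱 : StronglyGradedVertexAlgebra A V}
  {W₁ : Type*} [AddCommGroup W₁] [Module ℂ W₁] {W₂ : Type*} [AddCommGroup W₂] [Module ℂ W₂]

/-- The action `τ_W` of `V ⊗ ℂ((t))` on the generalized module `W`. -/
def GeneralizedModule.tau {W : Type*} [AddCommGroup W] [Module ℂ W]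
    (M : GeneralizedModule 𝒱 W) : V ⊗[ℂ] LaurentSeries ℂ →ₗ[ℂ] Module.End ℂ W :=
  tauW M.Y M.isModule.lowerTruncated

/-- For `ξ ∈ V ⊗ ℂ(t)`, the operator
`w₁ ⊗ w₂ ↦ τ_{W₁}((ι₊ ∘ T_z ∘ ι₋⁻¹ ∘ o) ξ) w₁ ⊗ w₂ + w₁ ⊗ τ_{W₂}((ι₊ ∘ ι₋⁻¹ ∘ o) ξ) w₂`. -/
def sigmaPz (M₁ : GeneralizedModule 𝒱 W₁) (M₂ : GeneralizedModule 𝒱 W₂) (z : ℂ) :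
    V ⊗[ℂ] RatFunc ℂ →ₗ[ℂ] Module.End ℂ (W₁ ⊗[ℂ] W₂) :=
  LinearMap.rTensorHom W₂ ∘ₗ M₁.tau ∘ₗ LinearMap.lTensor V iotaPlus ∘ₗ
      LinearMap.lTensor V (translate z).toLinearMap ∘ₗ 𝒱.oppMap
    + LinearMap.lTensorHom W₁ ∘ₗ M₂.tau ∘ₗ LinearMap.lTensor V iotaPlus ∘ₗ 𝒱.oppMap

/-- The action `τ_{P(z)}` on `(W₁ ⊗ W₂)*`: `τ_{P(z)}(ξ) λ` is the composite of `λ` with the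
operator above.  It is used only for `ξ` in `V ⊗ ℂ[t, t⁻¹, (z⁻¹ - t)⁻¹]`. -/
def tauPz (M₁ : GeneralizedModule 𝒱 W₁) (M₂ : GeneralizedModule 𝒱 W₂) (z : ℂ) :
    V ⊗[ℂ] RatFunc ℂ →ₗ[ℂ] Module.End ℂ (Module.Dual ℂ (W₁ ⊗[ℂ] W₂)) :=
  Module.Dual.transpose ∘ₗ sigmaPz M₁ M₂ z

/-- The action `Y'_{P(z)}(v, x) = τ_{P(z)}(Y_t(v, x))`, with components `τ_{P(z)}(v ⊗ tⁿ)`. -/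
def YPz (M₁ : GeneralizedModule 𝒱 W₁) (M₂ : GeneralizedModule 𝒱 W₂) (z : ℂ) :
    VOMap V (Module.Dual ℂ (W₁ ⊗[ℂ] W₂)) :=
  LinearMap.pi fun n : ℤ =>
    tauPz M₁ M₂ z ∘ₗ (TensorProduct.mk ℂ V (RatFunc ℂ)).flip (RatFunc.X ^ n)

/-- The operators `L'_{P(z)}(j)`, `j = -1, 0, 1`.  If `V` is conformal they are the components of
`Y'_{P(z)}(ω, x)`; if `V` is Möbius they are given by
`(L'_{P(z)}(j)λ)(w₁ ⊗ w₂) = λ(w₁ ⊗ L(-j)w₂ + (∑_{i=0}^{1-j} binom(1-j, i) zⁱ L(-j-i)) w₁ ⊗ w₂)`. -/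
def LPz (M₁ : GeneralizedModule 𝒱 W₁) (M₂ : GeneralizedModule 𝒱 W₂) (z : ℂ) :
    Sl2Ops (Module.Dual ℂ (W₁ ⊗[ℂ] W₂)) :=
  match 𝒱.va with
  | .conformal C => conformalOps C.ω (YPz M₁ M₂ z)
  | .mobius _ =>
    { Lneg := Module.Dual.transpose (LinearMap.lTensor W₁ M₂.L.Lpos +
        LinearMap.rTensor W₂ (M₁.L.Lpos + (2 * z) • M₁.L.Lzero + z ^ 2 • M₁.L.Lneg))
      Lzero := Module.Dual.transpose (LinearMap.lTensor W₁ M₂.L.Lzero +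
        LinearMap.rTensor W₂ (M₁.L.Lzero + z • M₁.L.Lneg))
      Lpos := Module.Dual.transpose (LinearMap.lTensor W₁ M₂.L.Lneg +
        LinearMap.rTensor W₂ M₁.L.Lneg) }

/-! ### Gradings on `(W₁ ⊗ W₂)*`, compatibility and local grading restriction -/

/-- `(W₁ ⊗ W₂)^(γ)` for the tensor product grading. -/
def tensorGr (M₁ : GeneralizedModule 𝒱 W₁) (M₂ : GeneralizedModule 𝒱 W₂) (γ : B) :
    Submodule ℂ (W₁ ⊗[ℂ] W₂) :=
  ⨆ (β₁ : B) (β₂ : B) (_ : β₁ + β₂ = γ),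
    Submodule.map₂ (TensorProduct.mk ℂ W₁ W₂) (M₁.gr β₁) (M₂.gr β₂)

/-- `((W₁ ⊗ W₂)*)^(β)`: the functionals that vanish on `(W₁ ⊗ W₂)^(γ)` for all `γ ≠ -β`. -/
def dualGr (M₁ : GeneralizedModule 𝒱 W₁) (M₂ : GeneralizedModule 𝒱 W₂) (β : B) :
    Submodule ℂ (Module.Dual ℂ (W₁ ⊗[ℂ] W₂)) :=
  ⨅ (γ : B) (_ : γ ≠ -β), (tensorGr M₁ M₂ γ).dualAnnihilator

/-- `((W₁ ⊗ W₂)*)_[n]^(β)` -/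
def dualGen (M₁ : GeneralizedModule 𝒱 W₁) (M₂ : GeneralizedModule 𝒱 W₂) (z : ℂ) (n : ℂ) (β : B) :
    Submodule ℂ (Module.Dual ℂ (W₁ ⊗[ℂ] W₂)) :=
  (LPz M₁ M₂ z).Lzero.maxGenEigenspace n ⊓ dualGr M₁ M₂ β

/-- `((W₁ ⊗ W₂)*)_(n)^(β)` -/
def dualOrd (M₁ : GeneralizedModule 𝒱 W₁) (M₂ : GeneralizedModule 𝒱 W₂) (z : ℂ) (n : ℂ) (β : B) :
    Submodule ℂ (Module.Dual ℂ (W₁ ⊗[ℂ] W₂)) :=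
  (LPz M₁ M₂ z).Lzero.eigenspace n ⊓ dualGr M₁ M₂ β

/-- The `P(z)`-compatibility condition on `λ`:
(a) `Y'_{P(z)}(v, x) λ` involves only finitely many negative powers of `x`;
(b) `τ_{P(z)}(x₀⁻¹ δ((x₁⁻¹-z)/x₀) Y_t(v,x₁)) λ = x₀⁻¹ δ((x₁⁻¹-z)/x₀) Y'_{P(z)}(v,x₁) λ`, as the
equality of the coefficients of `x₀ ^ (-n-1) x₁ ^ (-m-1)` for all `n, m`; on the left-hand side
this coefficient is `τ_{P(z)}(v ⊗ (t⁻¹-z)ⁿ tᵐ) λ`, and on the right-hand side `(x₁⁻¹-z)ⁿ` is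
expanded in nonnegative powers of `z`. -/
def IsPzCompatible (M₁ : GeneralizedModule 𝒱 W₁) (M₂ : GeneralizedModule 𝒱 W₂) (z : ℂ)
    (lam : Module.Dual ℂ (W₁ ⊗[ℂ] W₂)) : Prop :=
  (∀ v : V, ∃ N : ℤ, ∀ n : ℤ, N ≤ n → YPz M₁ M₂ z v n lam = 0) ∧
  ∀ (v : V) (n m : ℤ),
    tauPz M₁ M₂ z (v ⊗ₜ ((RatFunc.X⁻¹ - RatFunc.C z) ^ n * RatFunc.X ^ m)) lam =
      ∑ᶠ i : ℕ, (((Ring.choose n i : ℤ) : ℂ) * (-z) ^ i) • YPz M₁ M₂ z v (m - n + i) lam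

/-- `COMP_{P(z)}((W₁ ⊗ W₂)*)` -/
def COMP (M₁ : GeneralizedModule 𝒱 W₁) (M₂ : GeneralizedModule 𝒱 W₂) (z : ℂ) :
    Set (Module.Dual ℂ (W₁ ⊗[ℂ] W₂)) :=
  {lam | IsPzCompatible M₁ M₂ z lam}

/-- The subspace `U` is stable under the components of `Y'_{P(z)}` and under `L'_{P(z)}(-1)`,
`L'_{P(z)}(0)`, `L'_{P(z)}(1)`. -/
def IsPzStable (M₁ : GeneralizedModule 𝒱 W₁) (M₂ : GeneralizedModule 𝒱 W₂) (z : ℂ)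
    (U : Submodule ℂ (Module.Dual ℂ (W₁ ⊗[ℂ] W₂))) : Prop :=
  ∀ u ∈ U, (∀ (v : V) (n : ℤ), YPz M₁ M₂ z v n u ∈ U) ∧ (LPz M₁ M₂ z).Lneg u ∈ U ∧
    (LPz M₁ M₂ z).Lzero u ∈ U ∧ (LPz M₁ M₂ z).Lpos u ∈ U

/-- The doubly graded subspaces of `((W₁ ⊗ W₂)*)_[ℂ]^(B)` that contain `λ` and are stable. -/
def gradedStable (M₁ : GeneralizedModule 𝒱 W₁) (M₂ : GeneralizedModule 𝒱 W₂) (z : ℂ)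
    (lam : Module.Dual ℂ (W₁ ⊗[ℂ] W₂)) : Set (Submodule ℂ (Module.Dual ℂ (W₁ ⊗[ℂ] W₂))) :=
  {U | U = ⨆ (n : ℂ) (β : B), U ⊓ dualGen M₁ M₂ z n β ∧ lam ∈ U ∧ IsPzStable M₁ M₂ z U}

/-- `W_λ`, the smallest doubly graded stable subspace containing `λ`. -/
def Wgen (M₁ : GeneralizedModule 𝒱 W₁) (M₂ : GeneralizedModule 𝒱 W₂) (z : ℂ)
    (lam : Module.Dual ℂ (W₁ ⊗[ℂ] W₂)) : Submodule ℂ (Module.Dual ℂ (W₁ ⊗[ℂ] W₂)) :=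
  sInf (gradedStable M₁ M₂ z lam)

/-- `LGR_{[ℂ];P(z)}((W₁ ⊗ W₂)*)`: the `P(z)`-local grading restriction condition. -/
def LGRgen (M₁ : GeneralizedModule 𝒱 W₁) (M₂ : GeneralizedModule 𝒱 W₂) (z : ℂ) :
    Set (Module.Dual ℂ (W₁ ⊗[ℂ] W₂)) :=
  {lam | lam ∈ ⨆ (n : ℂ) (β : B), dualGen M₁ M₂ z n β ∧
    ∀ (n : ℂ) (β : B),
      FiniteDimensional ℂ ↥(Wgen M₁ M₂ z lam ⊓ dualGen M₁ M₂ z n β) ∧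
      ∃ K : ℤ, ∀ k : ℤ, k ≤ K → Wgen M₁ M₂ z lam ⊓ dualGen M₁ M₂ z (n + k) β = ⊥}

/-- `LGR_{(ℂ);P(z)}((W₁ ⊗ W₂)*)`: the `L(0)`-semisimple `P(z)`-local grading restriction
condition. -/
def LGRord (M₁ : GeneralizedModule 𝒱 W₁) (M₂ : GeneralizedModule 𝒱 W₂) (z : ℂ) :
    Set (Module.Dual ℂ (W₁ ⊗[ℂ] W₂)) :=
  {lam | lam ∈ ⨆ (n : ℂ) (β : B), dualOrd M₁ M₂ z n β ∧
    ∀ (n : ℂ) (β : B),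
      FiniteDimensional ℂ ↥(Wgen M₁ M₂ z lam ⊓ dualOrd M₁ M₂ z n β) ∧
      ∃ K : ℤ, ∀ k : ℤ, k ≤ K → Wgen M₁ M₂ z lam ⊓ dualOrd M₁ M₂ z (n + k) β = ⊥}

theorem Wgen_stable (M₁ : GeneralizedModule 𝒱 W₁) (M₂ : GeneralizedModule 𝒱 W₂) (z : ℂ)
    (lam : Module.Dual ℂ (W₁ ⊗[ℂ] W₂)) : IsPzStable M₁ M₂ z (Wgen M₁ M₂ z lam) := by
  intro u hu
  have hu' := Submodule.mem_sInf.mp hu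
  exact ⟨fun v n => Submodule.mem_sInf.mpr fun U hU => (hU.2.2 u (hu' U hU)).1 v n,
    Submodule.mem_sInf.mpr fun U hU => (hU.2.2 u (hu' U hU)).2.1,
    Submodule.mem_sInf.mpr fun U hU => (hU.2.2 u (hu' U hU)).2.2.1,
    Submodule.mem_sInf.mpr fun U hU => (hU.2.2 u (hu' U hU)).2.2.2⟩

/-- `W_λ` equipped with the restrictions of `Y'_{P(z)}` and of `L'_{P(z)}(-1)`, `L'_{P(z)}(0)`,
`L'_{P(z)}(1)`, and with the grading `(W_λ)^(β) = W_λ ∩ ((W₁ ⊗ W₂)*)^(β)`. -/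
def WgenData (M₁ : GeneralizedModule 𝒱 W₁) (M₂ : GeneralizedModule 𝒱 W₂) (z : ℂ)
    (lam : Module.Dual ℂ (W₁ ⊗[ℂ] W₂)) : ModuleData B V ↥(Wgen M₁ M₂ z lam) where
  Y :=
    { toFun := fun v n => (YPz M₁ M₂ z v n).restrict
        (fun u hu => (Wgen_stable M₁ M₂ z lam u hu).1 v n)
      map_add' := fun v v' => by
        ext n u
        simp [LinearMap.restrict_apply]
      map_smul' := fun c v => by
        ext n u
        simp [LinearMap.restrict_apply] }
  L :=
    { Lneg := (LPz M₁ M₂ z).Lneg.restrict (fun u hu => (Wgen_stable M₁ M₂ z lam u hu).2.1)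
      Lzero := (LPz M₁ M₂ z).Lzero.restrict (fun u hu => (Wgen_stable M₁ M₂ z lam u hu).2.2.1)
      Lpos := (LPz M₁ M₂ z).Lpos.restrict (fun u hu => (Wgen_stable M₁ M₂ z lam u hu).2.2.2) }
  gr β := (dualGr M₁ M₂ β).comap (Wgen M₁ M₂ z lam).subtype

end PzAction

end LogTensor

end

open Finset.HasAntidiagonal (antidiagonal mem_antidiagonal)

noncomputable section

namespace LogTensor

/-! ### Binomial coefficients -/

/-! A rational function with poles at `0`, `z`, `∞` has three expansions. The operator `sg q k v` on
`W₁ ⊗ W₂` lets `v ⊗ t ^ q (t - z) ^ k` act on `W₁` through its expansion at `z` and on `W₂` through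
its expansion at `0`. For `v` of weight `h`, `Y'_{P(z)}(v, x)` is, up to sign, a finite sum of
transposes of such operators over the divided powers of `L(1)` applied to `v`. The compatibility
condition concerns the third point: on `λ`, the transpose of `sg q k v` may be computed by expanding
`(t - z) ^ k` in powers of `t⁻¹`, a finite sum because sufficiently negative powers of `t` act as
zero.

This is what makes the Jacobi identity hold. Evaluated at `w₁ ⊗ w₂`, a product of two actions has
four parts, according to the factors on which `u` and `v` act. If both act on the same factor, the
identity of `W₁` or `W₂` applies. If `v` acts on `W₁`, its variable `y` lies near `z`; the Taylor
coefficients at `y = z` of the kernel `(t - y) ^ l` are multiples of powers of `t - z`, expanded at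
infinity, and compatibility replaces that expansion by the true action of `u` (`sum_sgT_sgT`). The
mixed parts of the two products then cancel (`sgT_jacobi`). Conjugation by `e^{xL(1)}` (`Lpd_mode`)
carries the result over to `Y'_{P(z)}` (`YPz_jacobi`).

Compatible functionals form a stable subspace (`compatible_isPzStable`): commutators produce Hasse
derivatives of `t ^ q (t - z) ^ k`, and differentiation commutes with expansion at infinity
(`expandable_hasse`). The derivative property and the Virasoro relations follow formally from the
Jacobi identity and the vacuum property. The `𝔰𝔩(2)` relations are transposed from an action on `W₁
⊗ W₂` (`LPz_eq`).

Compatibility is moreover inherited by the components of a functional in the grading by `B`. The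
compatible functionals lying in the sum of the doubly homogeneous spaces therefore form a doubly
graded stable subspace containing `λ`, and minimality puts `W_λ` inside it (`Wgen_le`). All axioms
except finiteness and grading truncation thus hold on `W_λ`, and those two are the local grading
restriction. Generalized and ordinary eigenspaces are the cases `k = ⊤` and `k = 1` of a single
argument; for `k = 1` the same minimality yields semisimplicity. -/

/-- The binomial coefficient `binom(a, i)`, for `a ∈ ℤ`, as a complex number. -/
def bin (a : ℤ) (i : ℕ) : ℂ := ((Ring.choose a i : ℤ) : ℂ)

@[simp] theorem bin_zero_right (a : ℤ) : bin a 0 = 1 := by simp [bin]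

@[simp] theorem bin_one_right (a : ℤ) : bin a 1 = a := by simp [bin]

theorem bin_zero_succ (i : ℕ) : bin 0 (i + 1) = 0 := by simp [bin, Ring.choose_zero_succ]

theorem bin_succ_succ (a : ℤ) (i : ℕ) : bin (a + 1) (i + 1) = bin a i + bin a (i + 1) := by
  simp [bin, Ring.choose_succ_succ]

theorem bin_natCast (n i : ℕ) : bin n i = n.choose i := by
  rw [bin, ← Nat.cast_id n, Ring.choose_natCast]; simp

theorem bin_add (a b : ℤ) (k : ℕ) :
    bin (a + b) k = ∑ p ∈ antidiagonal k, bin a p.1 * bin b p.2 := by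
  simp only [bin]
  rw [Ring.add_choose_eq k (Commute.all a b)]
  push_cast
  rfl

theorem bin_mul (l : ℤ) (r q : ℕ) :
    bin l r * bin (l - r) q = bin l (r + q) * (r + q).choose r := by
  have h := Ring.choose_smul_choose l (Nat.le_add_right r q)
  rw [Nat.add_sub_cancel_left, nsmul_eq_mul] at h
  simp only [bin]
  rw [mul_comm (((Ring.choose l (r + q) : ℤ) : ℂ))]
  exact_mod_cast h.symm

theorem bin_mul_succ (a : ℤ) (k : ℕ) : bin a (k + 1) * (k + 1) = bin a k * (a - k) := by
  have h := bin_mul a k 1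
  rw [bin_one_right] at h
  push_cast at h
  rw [h, Nat.choose_succ_self_right]
  push_cast
  ring

theorem bin_neg (a : ℤ) (k : ℕ) : bin (-a) k = (-1) ^ k * bin (a + k - 1) k := by
  simp only [bin]
  rw [Ring.choose_neg]
  have : ((Int.negOnePow k : ℤˣ) : ℤ) = (-1) ^ k := by
    rw [Int.negOnePow_def]; simp
  rw [Units.smul_def, smul_eq_mul, this]
  push_cast
  rfl

/-- Reflect the upper index to `m - E + k - 1`, apply Vandermonde, and reflect the second factor
back. In `YPz_jacobi_of_mem_wt` this absorbs the signs coming from the weights of `u_{l+i} v`. -/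
theorem bin_sub_alternating (m E : ℤ) (k : ℕ) :
    bin (E - m) k = ∑ p ∈ antidiagonal k, (-1) ^ p.1 * bin m p.1 * bin (E - p.1) p.2 := by
  have h1 : E - m = -(m - E) := by ring
  rw [h1, bin_neg, show m - E + (k : ℤ) - 1 = m + (k - E - 1) by ring, bin_add, Finset.mul_sum]
  refine Finset.sum_congr rfl fun p hp => ?_
  have hp' : p.1 + p.2 = k := mem_antidiagonal.mp hp
  have h2 : E - (p.1 : ℤ) = -(p.1 - E) := by ring
  rw [h2, bin_neg, ← hp', pow_add]
  have h3 : ((p.1 : ℤ) - E + p.2 - 1) = ((p.1 + p.2 : ℕ) : ℤ) - E - 1 := by push_cast; ring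
  rw [h3]
  ring

/-- `∑ⱼ binom(q, j) binom(k, i - j) binom(q - j, p - j) = binom(k + p, i) binom(q, p)`. -/
theorem sum_bin_mul_bin_sub (q k : ℤ) (p i : ℕ) :
    ∑ r ∈ antidiagonal i, bin q r.1 * bin k r.2 *
      (if r.1 ≤ p then bin (q - r.1) (p - r.1) else 0) = bin (k + p) i * bin q p := by
  rw [add_comm k, bin_add, Finset.sum_mul]
  refine Finset.sum_congr rfl fun r _ => ?_
  split_ifs with h
  · have := bin_mul q r.1 (p - r.1)
    rw [Nat.add_sub_cancel' h] at this
    rw [bin_natCast, mul_right_comm, this]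
    ring
  · rw [bin_natCast, Nat.choose_eq_zero_of_lt (not_le.mp h)]
    simp

/-! ### The Laurent series `(t + c)^q t^k` -/

theorem finsum_eq_sum_range {M : Type*} [AddCommMonoid M] (f : ℕ → M) (I : ℕ)
    (h : ∀ i, I ≤ i → f i = 0) : ∑ᶠ i, f i = ∑ i ∈ Finset.range I, f i := by
  refine finsum_eq_sum_of_support_subset f fun i hi => ?_
  rw [Finset.coe_range, Set.mem_Iio]
  by_contra hlt
  exact hi (h i (not_lt.mp hlt))

/-- The expansion of `(t + c) ^ q * t ^ k` in nonnegative powers of `t`, for `c ≠ 0`. -/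
def pw (c : ℂ) (q k : ℤ) : LaurentSeries ℂ :=
  (HahnSeries.single 1 1 + HahnSeries.C c) ^ q * HahnSeries.single k 1

/-- The power series `∑ₚ binom(q, p) c ^ (q - p) tᵖ`. -/
def binomSeries (c : ℂ) (q : ℤ) : PowerSeries ℂ :=
  PowerSeries.mk fun p => bin q p * c ^ (q - p)

theorem binomSeries_succ {c : ℂ} (hc : c ≠ 0) (q : ℤ) :
    binomSeries c (q + 1) = binomSeries c q * (PowerSeries.X + PowerSeries.C c) := by
  ext p
  rw [mul_add, map_add, PowerSeries.coeff_mul_C]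
  cases p with
  | zero => simp [binomSeries, zpow_add_one₀ hc]
  | succ p =>
    rw [PowerSeries.coeff_succ_mul_X]
    simp only [binomSeries, PowerSeries.coeff_mk]
    have h1 : q + 1 - ((p + 1 : ℕ) : ℤ) = q - p := by push_cast; ring
    have h2 : q - p = q - ((p + 1 : ℕ) : ℤ) + 1 := by push_cast; ring
    rw [h1, bin_succ_succ, add_mul, mul_assoc _ _ c, ← zpow_add_one₀ hc, ← h2]

theorem single_add_C_ne_zero (c : ℂ) :
    (HahnSeries.single 1 1 + HahnSeries.C c : LaurentSeries ℂ) ≠ 0 := by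
  intro h
  have := congrArg (fun f => HahnSeries.coeff f 1) h
  simp [HahnSeries.C_apply] at this

/-- Both sides agree at `q = 0` and are multiplied by `t + c` when `q` grows by one. As `t + c` is
invertible, this determines them in both directions. -/
theorem coe_binomSeries {c : ℂ} (hc : c ≠ 0) (q : ℤ) :
    (binomSeries c q : LaurentSeries ℂ) =
      (HahnSeries.single 1 1 + HahnSeries.C c : LaurentSeries ℂ) ^ q := by
  have hs : ∀ q : ℤ, (binomSeries c (q + 1) : LaurentSeries ℂ) =
      (binomSeries c q : LaurentSeries ℂ) * (HahnSeries.single 1 1 + HahnSeries.C c) := by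
    intro q
    rw [binomSeries_succ hc]
    simp
  have hne := single_add_C_ne_zero c
  induction q using Int.induction_on with
  | zero =>
    have : binomSeries c 0 = 1 := by
      ext p
      cases p with
      | zero => simp [binomSeries]
      | succ p => simp [binomSeries, bin_zero_succ, PowerSeries.coeff_one]
    rw [this, zpow_zero]
    simp
  | succ i ih => rw [hs, ih, zpow_add_one₀ hne]
  | pred i ih =>
    have h := hs (-(i : ℤ) - 1)
    rw [sub_add_cancel, ih] at h
    rw [zpow_sub_one₀ hne, h, mul_assoc, mul_inv_cancel₀ hne, mul_one]

theorem pw_coeff_add {c : ℂ} (hc : c ≠ 0) (q k : ℤ) (p : ℕ) :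
    (pw c q k).coeff (k + p) = bin q p * c ^ (q - p) := by
  rw [pw, ← coe_binomSeries hc, HahnSeries.coeff_mul_single, mul_one, add_sub_cancel_left,
    LaurentSeries.coeff_coe_powerSeries, binomSeries, PowerSeries.coeff_mk]

theorem pw_coeff_of_lt {c : ℂ} (hc : c ≠ 0) (q k n : ℤ) (h : n < k) :
    (pw c q k).coeff n = 0 := by
  rw [pw, ← coe_binomSeries hc, HahnSeries.coeff_mul_single, mul_one, PowerSeries.coeff_coe,
    if_pos (by omega)]

theorem pw_mul_pw (c : ℂ) (q k q' k' : ℤ) : pw c q k * pw c q' k' = pw c (q + q') (k + k') := by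
  rw [pw, pw, pw, mul_mul_mul_comm, ← zpow_add₀ (single_add_C_ne_zero c),
    HahnSeries.single_mul_single, one_mul]

theorem pw_zero_left (c : ℂ) (k : ℤ) : pw c 0 k = HahnSeries.single k 1 := by
  rw [pw, zpow_zero, one_mul]

theorem single_mul_pw (c : ℂ) (q k j : ℤ) :
    HahnSeries.single j 1 * pw c q k = pw c q (j + k) := by
  rw [← pw_zero_left c, pw_mul_pw, zero_add]

/-- `(t + c) ^ (q + 1) t ^ k = (t + c) ^ q t ^ (k + 1) + c (t + c) ^ q t ^ k` -/
theorem pw_succ (c : ℂ) (q k : ℤ) : pw c (q + 1) k = pw c q (k + 1) + c • pw c q k := by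
  have h : (HahnSeries.single (k + 1) 1 : LaurentSeries ℂ) =
      HahnSeries.single 1 1 * HahnSeries.single k 1 := by
    rw [HahnSeries.single_mul_single, one_mul, add_comm]
  rw [← HahnSeries.C_mul_eq_smul, pw, pw, pw, zpow_add_one₀ (single_add_C_ne_zero c), h]
  ring

/-- Leibniz rule for divided derivatives. Comparing coefficients reduces it to
`sum_bin_mul_bin_sub`, whose value `0` for `r.1 > p` matches the coefficients of the series `pw`
below its order. -/
theorem hasseDeriv_pw {c : ℂ} (hc : c ≠ 0) (q k : ℤ) (i : ℕ) :
    LaurentSeries.hasseDeriv ℂ i (pw c q k) =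
      ∑ r ∈ antidiagonal i, (bin q r.1 * bin k r.2) • pw c (q - r.1) (k - r.2) := by
  have hsum : ∀ n : ℤ, (∑ r ∈ antidiagonal i,
      (bin q r.1 * bin k r.2) • pw c (q - r.1) (k - r.2)).coeff n =
      ∑ r ∈ antidiagonal i, (bin q r.1 * bin k r.2) * (pw c (q - r.1) (k - r.2)).coeff n := by
    intro n
    simp [HahnSeries.coeff_sum]
  ext n
  rw [LaurentSeries.hasseDeriv_coeff, hsum, zsmul_eq_mul, ← bin]
  rcases lt_or_ge (n + i) k with h | h
  · rw [pw_coeff_of_lt hc q k (n + i) h, mul_zero]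
    refine (Finset.sum_eq_zero fun r hr => ?_).symm
    have hr' : r.1 + r.2 = i := mem_antidiagonal.mp hr
    rw [pw_coeff_of_lt hc _ _ _ (by omega), mul_zero]
  · obtain ⟨p, hp⟩ := Int.le.dest h
    rw [← hp, pw_coeff_add hc, ← mul_assoc, ← sum_bin_mul_bin_sub, Finset.sum_mul]
    refine Finset.sum_congr rfl fun r hr => ?_
    have hr' : r.1 + r.2 = i := mem_antidiagonal.mp hr
    split_ifs with hrp
    · have h1 : n = k - r.2 + ((p - r.1 : ℕ) : ℤ) := by omega
      rw [h1, pw_coeff_add hc, mul_assoc]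
      congr 3
      omega
    · rw [pw_coeff_of_lt hc _ _ _ (by omega)]
      simp

/-! ### `τ_W` and the Jacobi identity for Laurent series -/

section Tau

variable {V W : Type*} [AddCommGroup V] [Module ℂ V] [AddCommGroup W] [Module ℂ W]
  {YV : VOMap V V} {Y : VOMap V W} (hY : LowerTruncated Y)

theorem tauW_single (v : V) (n : ℤ) (c : ℂ) :
    tauW Y hY (v ⊗ₜ HahnSeries.single n c) = c • Y v n := by
  ext w
  rw [tauW_tmul, finsum_eq_single _ n, HahnSeries.coeff_single_same]
  · rfl
  · intro m hm
    rw [HahnSeries.coeff_single_of_ne hm, zero_smul]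

theorem tauW_eq_zero {v : V} {w : W} {N : ℤ} (hN : ∀ n, N ≤ n → Y v n w = 0)
    {g : LaurentSeries ℂ} (hg : ∀ n < N, g.coeff n = 0) : tauW Y hY (v ⊗ₜ g) w = 0 := by
  rw [tauW_tmul]
  refine finsum_eq_zero_of_forall_eq_zero fun n => ?_
  rcases lt_or_ge n N with h | h
  · rw [hg n h, zero_smul]
  · rw [hN n h, smul_zero]

theorem tauW_eq_sum_range {v : V} {w : W} {k : ℤ} {P : ℕ}
    (hP : ∀ n, k + P ≤ n → Y v n w = 0) {g : LaurentSeries ℂ} (hg : ∀ n < k, g.coeff n = 0) :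
    tauW Y hY (v ⊗ₜ g) w = ∑ p ∈ Finset.range P, g.coeff (k + p) • Y v (k + p) w := by
  rw [tauW_tmul]
  have hinj : Set.InjOn (fun p : ℕ => k + (p : ℤ)) (Finset.range P : Set ℕ) :=
    fun a _ b _ h => by simpa using h
  rw [← Finset.sum_image (s := Finset.range P) (g := fun p : ℕ => k + (p : ℤ))
    (f := fun n : ℤ => g.coeff n • Y v n w) hinj]
  refine finsum_eq_sum_of_support_subset _ fun n hn => ?_
  rw [Finset.coe_image, Finset.coe_range]
  rcases lt_or_ge n k with h | h
  · exact absurd (by simp only [hg n h, zero_smul]) hn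
  · refine ⟨(n - k).toNat, ?_, by dsimp only; omega⟩
    rw [Set.mem_Iio]
    by_contra hlt
    exact hn (by simp only [hP n (by omega), smul_zero])

theorem tauW_pw {v : V} {w : W} {c : ℂ} (hc : c ≠ 0) (q k : ℤ) {P : ℕ}
    (hP : ∀ n, k + P ≤ n → Y v n w = 0) :
    tauW Y hY (v ⊗ₜ pw c q k) w =
      ∑ p ∈ Finset.range P, (bin q p * c ^ (q - p)) • Y v (k + p) w := by
  rw [tauW_eq_sum_range hY hP (pw_coeff_of_lt hc q k)]
  exact Finset.sum_congr rfl fun p _ => by rw [pw_coeff_add hc]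

/-- An additive and homogeneous function of Laurent series that vanishes on the powers of `t` and
on series of high order vanishes. -/
theorem eq_zero_of_monomials (P : LaurentSeries ℂ → W) (hadd : ∀ a b, P (a + b) = P a + P b)
    (hsmul : ∀ (c : ℂ) a, P (c • a) = c • P a) {K : ℤ} {g : LaurentSeries ℂ}
    (hg : ∀ n < K, g.coeff n = 0) (hmon : ∀ n, K ≤ n → P (HahnSeries.single n 1) = 0)
    (htail : ∀ᶠ N : ℤ in Filter.atTop, ∀ a : LaurentSeries ℂ, (∀ n < N, a.coeff n = 0) → P a = 0) :
    P g = 0 := by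
  obtain ⟨N, hN⟩ := htail.exists
  let P' : LaurentSeries ℂ →ₗ[ℂ] W := ⟨⟨P, hadd⟩, hsmul⟩
  -- The truncation of `g` below degree `N` is a combination of monomials; the remainder has order
  -- at least `N`, where the tail hypothesis applies.
  let g' : LaurentSeries ℂ := ∑ n ∈ Finset.Ico K N, g.coeff n • HahnSeries.single n (1 : ℂ)
  have h1 : P' g' = 0 := by
    rw [map_sum]
    refine Finset.sum_eq_zero fun n hn => ?_
    rw [map_smul]
    exact (congrArg _ (hmon n (Finset.mem_Ico.mp hn).1)).trans (smul_zero _)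
  have h2 : P' (g - g') = 0 := by
    refine hN _ fun n hn => ?_
    have hc : g'.coeff n = if K ≤ n then g.coeff n else 0 := by
      simp only [g', HahnSeries.coeff_sum, HahnSeries.coeff_smul, HahnSeries.coeff_single,
        smul_eq_mul, mul_ite, mul_one, mul_zero, Finset.sum_ite_eq, Finset.mem_Ico]
      simp [hn]
    rw [HahnSeries.coeff_sub, hc]
    split_ifs with h
    · exact sub_self _
    · rw [hg n (not_le.mp h), sub_zero]
  have h3 := map_add P' (g - g') g'
  rw [sub_add_cancel, h1, h2, add_zero] at h3
  exact h3

theorem tauW_eventually_zero (v : V) (w : W) (F : LaurentSeries ℂ → LaurentSeries ℂ) (d : ℤ)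
    (hF : ∀ (N : ℤ) (a : LaurentSeries ℂ), (∀ n < N, a.coeff n = 0) →
      ∀ n < N + d, (F a).coeff n = 0) :
    ∀ᶠ N : ℤ in Filter.atTop, ∀ a : LaurentSeries ℂ, (∀ n < N, a.coeff n = 0) →
      tauW Y hY (v ⊗ₜ F a) w = 0 := by
  obtain ⟨M, hM⟩ := hY v w
  filter_upwards [Filter.eventually_ge_atTop (M - d)] with N hN a ha
  exact tauW_eq_zero hY hM fun n hn => hF N a ha n (by omega)

theorem coeff_mul_eq_zero {a b : LaurentSeries ℂ} {K L : ℤ} (ha : ∀ n < K, a.coeff n = 0)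
    (hb : ∀ n < L, b.coeff n = 0) : ∀ n < K + L, (a * b).coeff n = 0 := by
  intro n hn
  rw [HahnSeries.coeff_mul]
  refine Finset.sum_eq_zero fun p hp => ?_
  have hp' := (Finset.mem_antidiagonal.mp hp).2.2
  rcases lt_or_ge p.1 K with h | h
  · rw [ha _ h, zero_mul]
  · rw [hb p.2 (by omega), mul_zero]

theorem coeff_single_mul_eq_zero {a : LaurentSeries ℂ} {K : ℤ} (ha : ∀ n < K, a.coeff n = 0)
    (j : ℤ) (c : ℂ) : ∀ n < K + j, (HahnSeries.single j c * a).coeff n = 0 := by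
  intro n hn
  rw [HahnSeries.coeff_single_mul, ha _ (by omega), mul_zero]

theorem coeff_hasseDeriv_eq_zero {a : LaurentSeries ℂ} {K : ℤ} (ha : ∀ n < K, a.coeff n = 0)
    (i : ℕ) : ∀ n < K - i, (LaurentSeries.hasseDeriv ℂ i a).coeff n = 0 := by
  intro n hn
  rw [LaurentSeries.hasseDeriv_coeff, ha _ (by omega), smul_zero]

end Tau

theorem laurent_mul_smul (a b : LaurentSeries ℂ) (c : ℂ) : a * (c • b) = c • (a * b) := by
  rw [← HahnSeries.C_mul_eq_smul, ← HahnSeries.C_mul_eq_smul]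
  ring

theorem laurent_smul_mul (a b : LaurentSeries ℂ) (c : ℂ) : (c • a) * b = c • (a * b) := by
  rw [← HahnSeries.C_mul_eq_smul, ← HahnSeries.C_mul_eq_smul]
  ring

section JacobiLaurent

variable {V W : Type*} [AddCommGroup V] [Module ℂ V] [AddCommGroup W] [Module ℂ W]
  {YV : VOMap V V} {Y : VOMap V W} (hY : LowerTruncated Y)

/-- The difference of the two sides of the Jacobi identity for `u ⊗ a` and `v ⊗ b`, with sums
restricted to `i < I`. -/
def jacobiDefect (YV : VOMap V V) (u v : V) (w : W) (l : ℤ) (I : ℕ) (a b : LaurentSeries ℂ) : W :=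
  ∑ i ∈ Finset.range I, ((-1 : ℂ) ^ i * bin l i) •
      tauW Y hY (u ⊗ₜ (HahnSeries.single (l - i) 1 * a))
        (tauW Y hY (v ⊗ₜ (HahnSeries.single (i : ℤ) 1 * b)) w)
    - ∑ i ∈ Finset.range I, ((-1 : ℂ) ^ l * (-1 : ℂ) ^ i * bin l i) •
      tauW Y hY (v ⊗ₜ (HahnSeries.single (l - i) 1 * b))
        (tauW Y hY (u ⊗ₜ (HahnSeries.single (i : ℤ) 1 * a)) w)
    - ∑ i ∈ Finset.range I,
      tauW Y hY (YV u (l + i) v ⊗ₜ (LaurentSeries.hasseDeriv ℂ i a * b)) w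

theorem jacobiDefect_add_left (u v : V) (w : W) (l : ℤ) (I : ℕ) (a a' b : LaurentSeries ℂ) :
    jacobiDefect hY YV u v w l I (a + a') b =
      jacobiDefect hY YV u v w l I a b + jacobiDefect hY YV u v w l I a' b := by
  simp only [jacobiDefect, mul_add, add_mul, map_add, TensorProduct.tmul_add, LinearMap.add_apply,
    smul_add, Finset.sum_add_distrib]
  abel

theorem jacobiDefect_add_right (u v : V) (w : W) (l : ℤ) (I : ℕ) (a b b' : LaurentSeries ℂ) :
    jacobiDefect hY YV u v w l I a (b + b') =
      jacobiDefect hY YV u v w l I a b + jacobiDefect hY YV u v w l I a b' := by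
  simp only [jacobiDefect, mul_add, map_add, TensorProduct.tmul_add, LinearMap.add_apply,
    smul_add, Finset.sum_add_distrib]
  abel

theorem jacobiDefect_smul_left (u v : V) (w : W) (l : ℤ) (I : ℕ) (c : ℂ)
    (a b : LaurentSeries ℂ) :
    jacobiDefect hY YV u v w l I (c • a) b = c • jacobiDefect hY YV u v w l I a b := by
  simp only [jacobiDefect, laurent_mul_smul, laurent_smul_mul, map_smul, TensorProduct.tmul_smul,
    LinearMap.smul_apply, smul_sub, Finset.smul_sum, smul_smul, mul_comm c]

theorem jacobiDefect_smul_right (u v : V) (w : W) (l : ℤ) (I : ℕ) (c : ℂ)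
    (a b : LaurentSeries ℂ) :
    jacobiDefect hY YV u v w l I a (c • b) = c • jacobiDefect hY YV u v w l I a b := by
  simp only [jacobiDefect, laurent_mul_smul, map_smul, TensorProduct.tmul_smul,
    LinearMap.smul_apply, smul_sub, Finset.smul_sum, smul_smul, mul_comm c]

theorem jacobiDefect_eventually {u v : V} {w : W} {l : ℤ} {I : ℕ}
    {F : LaurentSeries ℂ → LaurentSeries ℂ × LaurentSeries ℂ}
    (h1 : ∀ i ∈ Finset.range I, ∀ᶠ N : ℤ in Filter.atTop, ∀ a : LaurentSeries ℂ,
      (∀ n < N, a.coeff n = 0) →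
        tauW Y hY (u ⊗ₜ (HahnSeries.single (l - (i : ℕ)) 1 * (F a).1))
        (tauW Y hY (v ⊗ₜ (HahnSeries.single (i : ℤ) 1 * (F a).2)) w) = 0)
    (h2 : ∀ i ∈ Finset.range I, ∀ᶠ N : ℤ in Filter.atTop, ∀ a : LaurentSeries ℂ,
      (∀ n < N, a.coeff n = 0) →
        tauW Y hY (v ⊗ₜ (HahnSeries.single (l - (i : ℕ)) 1 * (F a).2))
        (tauW Y hY (u ⊗ₜ (HahnSeries.single (i : ℤ) 1 * (F a).1)) w) = 0)
    (h3 : ∀ i ∈ Finset.range I, ∀ᶠ N : ℤ in Filter.atTop, ∀ a : LaurentSeries ℂ,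
      (∀ n < N, a.coeff n = 0) →
        tauW Y hY (YV u (l + (i : ℕ)) v ⊗ₜ
          (LaurentSeries.hasseDeriv ℂ i (F a).1 * (F a).2)) w = 0) :
    ∀ᶠ N : ℤ in Filter.atTop, ∀ a : LaurentSeries ℂ, (∀ n < N, a.coeff n = 0) →
      jacobiDefect hY YV u v w l I (F a).1 (F a).2 = 0 := by
  filter_upwards [(Filter.eventually_all_finset _).mpr h1, (Filter.eventually_all_finset _).mpr h2,
    (Filter.eventually_all_finset _).mpr h3] with N h1 h2 h3 a ha
  rw [jacobiDefect, Finset.sum_eq_zero fun i hi => by rw [h1 i hi a ha, smul_zero],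
    Finset.sum_eq_zero fun i hi => by rw [h2 i hi a ha, smul_zero],
    Finset.sum_eq_zero fun i hi => h3 i hi a ha, sub_zero, sub_zero]

theorem jacobiDefect_single (jac : JacobiIdentity YV Y) {u v : V} {w : W} {l : ℤ} {I : ℕ}
    {m n : ℤ} (hu : ∀ j, m + I ≤ j → Y u j w = 0) (hv : ∀ j, n + I ≤ j → Y v j w = 0)
    (hI : ∀ i : ℕ, I ≤ i → YV u (l + i) v = 0) :
    jacobiDefect hY YV u v w l I (HahnSeries.single m 1) (HahnSeries.single n 1) = 0 := by
  have h := jac u v w l m n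
  rw [finsum_eq_sum_range _ I fun i hi => by rw [hv _ (by omega), map_zero, smul_zero],
    finsum_eq_sum_range _ I fun i hi => by rw [hu _ (by omega), map_zero, smul_zero],
    finsum_eq_sum_range _ I fun i hi => by
      rw [hI i hi, map_zero, Pi.zero_apply, LinearMap.zero_apply, smul_zero]] at h
  rw [jacobiDefect, sub_eq_zero]
  refine (congrArg₂ (· - ·) ?_ ?_).trans (h.trans ?_)
  · refine Finset.sum_congr rfl fun i _ => ?_
    rw [HahnSeries.single_mul_single, HahnSeries.single_mul_single, one_mul, tauW_single,
      tauW_single, one_smul, one_smul, show l - (i : ℤ) + m = m + l - i by ring, add_comm n]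
    rfl
  · refine Finset.sum_congr rfl fun i _ => ?_
    rw [HahnSeries.single_mul_single, HahnSeries.single_mul_single, one_mul, tauW_single,
      tauW_single, one_smul, one_smul, show l - (i : ℤ) + n = n + l - i by ring, add_comm m]
    rfl
  · refine Finset.sum_congr rfl fun i _ => ?_
    rw [LaurentSeries.hasseDeriv_single, HahnSeries.single_mul_single, tauW_single,
      show m - (i : ℤ) + n = m + n - i by ring]
    simp

/-- The Jacobi identity for `u ⊗ a` and `v ⊗ b`, where `a` and `b` are Laurent series. -/
theorem jacobiDefect_eq_zero (jac : JacobiIdentity YV Y) {u v : V} {w : W} {l K K' : ℤ} {I : ℕ}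
    {a b : LaurentSeries ℂ} (ha : ∀ n < K, a.coeff n = 0) (hb : ∀ n < K', b.coeff n = 0)
    (hu : ∀ j, K + I ≤ j → Y u j w = 0) (hv : ∀ j, K' + I ≤ j → Y v j w = 0)
    (hI : ∀ i : ℕ, I ≤ i → YV u (l + i) v = 0) :
    jacobiDefect hY YV u v w l I a b = 0 := by
  -- The defect is bilinear and vanishes when either series has high order. So `a`, then `b`, may be
  -- taken to be a monomial, and the same `I` serves all monomials of degree at least `K` and `K'`.
  refine eq_zero_of_monomials (fun a => jacobiDefect hY YV u v w l I a b)
    (fun a a' => jacobiDefect_add_left hY u v w l I a a' b)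
    (fun c a => jacobiDefect_smul_left hY u v w l I c a b) ha (fun m hm => ?_) ?_
  · refine eq_zero_of_monomials
      (fun b => jacobiDefect hY YV u v w l I (HahnSeries.single m 1) b)
      (fun b b' => jacobiDefect_add_right hY u v w l I _ b b')
      (fun c b => jacobiDefect_smul_right hY u v w l I c _ b) hb (fun n hn => ?_) ?_
    · exact jacobiDefect_single hY jac (fun j hj => hu j (by omega))
        (fun j hj => hv j (by omega)) hI
    · refine jacobiDefect_eventually hY (F := fun b => (HahnSeries.single m 1, b))
        (fun i _ => ?_) (fun i _ => ?_) (fun i _ => ?_)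
      · filter_upwards [tauW_eventually_zero hY v w _ i
          fun N b hb => coeff_single_mul_eq_zero hb i 1] with N hN b hb
        rw [hN b hb, map_zero]
      · dsimp only
        exact tauW_eventually_zero hY v _ _ (l - i)
          fun N b hb => coeff_single_mul_eq_zero hb (l - i) 1
      · refine tauW_eventually_zero hY _ w _ (m - i) fun N b hb => ?_
        dsimp only
        rw [LaurentSeries.hasseDeriv_single]
        exact coeff_single_mul_eq_zero hb _ _
  · refine jacobiDefect_eventually hY (F := fun a => (a, b))
        (fun i _ => ?_) (fun i _ => ?_) (fun i _ => ?_)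
    · dsimp only
      exact tauW_eventually_zero hY u _ _ (l - i)
          fun N b hb => coeff_single_mul_eq_zero hb (l - i) 1
    · filter_upwards [tauW_eventually_zero hY u w _ i
          fun N b hb => coeff_single_mul_eq_zero hb i 1] with N hN b hb
      rw [hN b hb, map_zero]
    · refine tauW_eventually_zero hY _ w (fun a => LaurentSeries.hasseDeriv ℂ i a * b) (K' - i)
        fun N a ha n hn => ?_
      exact coeff_mul_eq_zero (coeff_hasseDeriv_eq_zero ha i) hb n (by omega)

/-- The commutator formula for `u ⊗ (t + c)^q t^k` and `v ⊗ (t + c)^r t^l`. -/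
theorem tauW_pw_commutator (jac : JacobiIdentity YV Y) {c : ℂ} (hc : c ≠ 0) (u v : V)
    (q k q' k' : ℤ) {I : ℕ} (hI : ∀ i : ℕ, I ≤ i → YV u i v = 0) :
    ⁅tauW Y hY (u ⊗ₜ pw c q k), tauW Y hY (v ⊗ₜ pw c q' k')⁆ =
      ∑ i ∈ Finset.range I, ∑ r ∈ antidiagonal i, (bin q r.1 * bin k r.2) •
        tauW Y hY (YV u i v ⊗ₜ pw c (q + q' - r.1) (k + k' - r.2)) := by
  ext w
  obtain ⟨N, hN⟩ := hY u w
  obtain ⟨N', hN'⟩ := hY v w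
  obtain ⟨J, hJ1, hJ2, hJ3, hJ4⟩ : ∃ J : ℕ, N ≤ k + J ∧ N' ≤ k' + J ∧ I ≤ J ∧ 0 < J :=
    ⟨(N - k).toNat + (N' - k').toNat + I + 1, by omega, by omega, by omega, by omega⟩
  have h := jacobiDefect_eq_zero hY jac (l := 0) (u := u) (v := v) (w := w) (I := J)
    (pw_coeff_of_lt hc q k) (pw_coeff_of_lt hc q' k') (fun j hj => hN j (by omega))
    (fun j hj => hN' j (by omega)) (fun i hi => by rw [zero_add]; exact hI i (by omega))
  -- At `l = 0` only the index `i = 0` survives in each product; the bound was made positive so that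
  -- this term can be split off.
  obtain ⟨J, rfl⟩ : ∃ J', J = J' + 1 := ⟨J - 1, by omega⟩
  rw [jacobiDefect, sub_eq_zero, Finset.sum_range_succ', Finset.sum_range_succ',
    Finset.sum_eq_zero fun i _ => by rw [bin_zero_succ, mul_zero, zero_smul],
    Finset.sum_eq_zero fun i _ => by rw [bin_zero_succ, mul_zero, zero_smul]] at h
  simp only [bin_zero_right, Nat.cast_zero, sub_zero, pow_zero, zpow_zero, mul_one, one_smul,
    zero_add, HahnSeries.single_zero_one, one_mul] at h
  rw [Ring.lie_def, LinearMap.sub_apply, Module.End.mul_apply, Module.End.mul_apply, h]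
  rw [← Finset.sum_subset (Finset.range_subset_range.mpr hJ3) fun i _ hi => by
    rw [hI i (by simpa using hi), TensorProduct.zero_tmul, map_zero, LinearMap.zero_apply]]
  rw [LinearMap.sum_apply]
  refine Finset.sum_congr rfl fun i _ => ?_
  rw [hasseDeriv_pw hc, Finset.sum_mul, TensorProduct.tmul_sum, map_sum]
  refine congrArg (fun f : Module.End ℂ W => f w) (Finset.sum_congr rfl fun r _ => ?_)
  rw [laurent_smul_mul, TensorProduct.tmul_smul, map_smul, pw_mul_pw,
    show q - (r.1 : ℤ) + q' = q + q' - r.1 by ring, show k - (r.2 : ℤ) + k' = k + k' - r.2 by ring]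

end JacobiLaurent

/-! ### Consequences of the Jacobi identity -/

section Consequences

variable {V W : Type*} [AddCommGroup V] [Module ℂ V] [AddCommGroup W] [Module ℂ W]
  {YV : VOMap V V} {Y : VOMap V W}

theorem JacobiIdentity.commutator (jac : JacobiIdentity YV Y) (u v : V) (m n : ℤ) (w : W) :
    ⁅Y u m, Y v n⁆ w = ∑ᶠ i : ℕ, bin m i • Y (YV u i v) (m + n - i) w := by
  have h := jac u v w 0 m n
  have h0 : ∀ i : ℕ, i ≠ 0 → ((Ring.choose (0 : ℤ) i : ℤ) : ℂ) = 0 := fun i hi => by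
    obtain ⟨j, rfl⟩ := Nat.exists_eq_succ_of_ne_zero hi
    exact bin_zero_succ j
  rw [finsum_eq_single _ 0 fun i hi => by rw [h0 i hi, mul_zero, zero_smul],
    finsum_eq_single _ 0 fun i hi => by rw [h0 i hi, mul_zero, zero_smul]] at h
  simp only [pow_zero, Ring.choose_zero_right, Int.cast_one, mul_one, one_smul, add_zero,
    Nat.cast_zero, sub_zero, zpow_zero, zero_add] at h
  exact h

theorem JacobiIdentity.commutator_nat (jac : JacobiIdentity YV Y) (u v : V) (m : ℕ) (n : ℤ) :
    ⁅Y u m, Y v n⁆ =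
      ∑ i ∈ Finset.range (m + 1), (m.choose i : ℂ) • Y (YV u i v) (m + n - i) := by
  ext w
  rw [jac.commutator, finsum_eq_sum_range _ (m + 1) fun i hi => by
    rw [bin_natCast, Nat.choose_eq_zero_of_lt hi, Nat.cast_zero, zero_smul], LinearMap.sum_apply]
  exact Finset.sum_congr rfl fun i _ => by rw [bin_natCast, LinearMap.smul_apply]

/-- The commutator formulas for the components `ω₀`, `ω₁`, `ω₂` of `Y(ω, x)`. -/
theorem JacobiIdentity.sl2Commutators (jac : JacobiIdentity YV Y) (ω : V) :
    Sl2Commutators (conformalOps ω YV) Y (conformalOps ω Y) := by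
  intro v n
  have h0 := jac.commutator_nat ω v 0 n
  have h1 := jac.commutator_nat ω v 1 n
  have h2 := jac.commutator_nat ω v 2 n
  simp only [Finset.sum_range_succ, Finset.range_zero, Finset.sum_empty] at h0 h1 h2
  simp only [Nat.choose_zero_right, Nat.choose_self, Nat.choose_one_right, Nat.cast_zero,
    Nat.cast_one, Nat.cast_ofNat, one_smul, zero_add, sub_zero, add_sub_cancel_left] at h0 h1 h2
  refine ⟨h0, ?_, ?_⟩
  · change ⁅Y ω 1, Y v n⁆ = Y (YV ω 1 v) n + Y (YV ω 0 v) (n + 1)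
    rw [h1, add_comm, add_comm 1 n]
  · change ⁅Y ω 2, Y v n⁆ =
      Y (YV ω 2 v) n + (2 : ℂ) • Y (YV ω 1 v) (n + 1) + Y (YV ω 0 v) (n + 2)
    rw [h2, show 2 + n - 1 = n + 1 by ring, add_comm 2 n]
    abel

/-- Take `l = -2`, `m = 0` and the vacuum as second vector. Only the mode `-1` of the vacuum is
nonzero, so each product keeps at most one term: the first when `n ≤ -1`, the second when `n ≥ 1`,
and neither when `n = 0`, where the coefficient `-n` vanishes as well. -/
theorem JacobiIdentity.mode_neg_two (jac : JacobiIdentity YV Y) {vac : V}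
    (hvac : VacuumProperty vac Y) (v : V) (n : ℤ) :
    Y (YV v (-2) vac) n = (-n : ℂ) • Y v (n - 1) := by
  ext w
  have h := jac v vac w (-2) 0 n
  have hbin : ∀ i : ℕ, (-1 : ℂ) ^ i * ((Ring.choose (-2 : ℤ) i : ℤ) : ℂ) = i + 1 := by
    intro i
    have h1 := bin_neg 2 i
    have h2 : (2 : ℤ) + i - 1 = ((i + 1 : ℕ) : ℤ) := by push_cast; ring
    rw [h2, bin_natCast, Nat.choose_succ_self_right] at h1
    change (-1 : ℂ) ^ i * bin (-2) i = _
    rw [h1, ← mul_assoc, ← mul_pow]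
    simp
  have hR : ∑ᶠ i : ℕ, ((Ring.choose (0 : ℤ) i : ℤ) : ℂ) • Y (YV v (-2 + i) vac) (0 + n - i) w =
      Y (YV v (-2) vac) n w := by
    rw [finsum_eq_single _ 0 fun i hi => ?_]
    · simp
    · obtain ⟨j, rfl⟩ := Nat.exists_eq_succ_of_ne_zero hi
      have := bin_zero_succ j
      rw [bin] at this
      rw [Nat.succ_eq_add_one, this, zero_smul]
  have hF : ∑ᶠ i : ℕ, ((-1 : ℂ) ^ i * ((Ring.choose (-2 : ℤ) i : ℤ) : ℂ)) •
      Y v (0 + -2 - i) (Y vac (n + i) w) = if n ≤ -1 then (-n : ℂ) • Y v (n - 1) w else 0 := by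
    split_ifs with hn
    · rw [finsum_eq_single _ (-1 - n).toNat fun i hi => ?_]
      · have h1 : n + ((-1 - n).toNat : ℤ) = -1 := by omega
        have h2 : (0 + -2 - ((-1 - n).toNat : ℤ)) = n - 1 := by omega
        have h3 : (((-1 - n).toNat : ℕ) : ℂ) + 1 = -n := by
          have : (((-1 - n).toNat : ℕ) : ℤ) = -1 - n := by omega
          have h4 : (((-1 - n).toNat : ℕ) : ℂ) = (((-1 - n).toNat : ℤ) : ℂ) := by push_cast; rfl
          rw [h4, this]; push_cast; ring
        rw [hbin, h1, h2, h3, hvac, if_pos rfl, Module.End.one_apply]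
      · rw [hvac, if_neg (by omega), LinearMap.zero_apply, map_zero, smul_zero]
    · refine finsum_eq_zero_of_forall_eq_zero fun i => ?_
      rw [hvac, if_neg (by omega), LinearMap.zero_apply, map_zero, smul_zero]
  have hS : ∑ᶠ i : ℕ, ((-1 : ℂ) ^ (-2 : ℤ) * (-1 : ℂ) ^ i * ((Ring.choose (-2 : ℤ) i : ℤ) : ℂ)) •
      Y vac (n + -2 - i) (Y v (0 + i) w) = if 1 ≤ n then (n : ℂ) • Y v (n - 1) w else 0 := by
    split_ifs with hn
    · rw [finsum_eq_single _ (n - 1).toNat fun i hi => ?_]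
      · have h1 : n + -2 - ((n - 1).toNat : ℤ) = -1 := by omega
        have h2 : (0 + ((n - 1).toNat : ℤ)) = n - 1 := by omega
        have h3 : (((n - 1).toNat : ℕ) : ℂ) + 1 = n := by
          have : (((n - 1).toNat : ℕ) : ℤ) = n - 1 := by omega
          have h4 : (((n - 1).toNat : ℕ) : ℂ) = (((n - 1).toNat : ℤ) : ℂ) := by push_cast; rfl
          rw [h4, this]; push_cast; ring
        rw [mul_assoc, hbin, h1, h2, h3, hvac, if_pos rfl, Module.End.one_apply]
        norm_num
      · rw [hvac, if_neg (by omega), LinearMap.zero_apply, smul_zero]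
    · refine finsum_eq_zero_of_forall_eq_zero fun i => ?_
      rw [hvac, if_neg (by omega), LinearMap.zero_apply, smul_zero]
  rw [hF, hS, hR] at h
  rw [← h, LinearMap.smul_apply]
  rcases lt_trichotomy n 0 with hn | hn | hn
  · rw [if_pos (by omega), if_neg (by omega), sub_zero]
  · subst hn
    simp
  · rw [if_neg (by omega), if_pos (by omega), zero_sub, neg_smul]

end Consequences

/-! ### `L(-1)`, `L(0)`, `L(1)` on the vertex algebra -/

namespace MobiusOrConformal

variable {V : Type*} [AddCommGroup V] [Module ℂ V] (U : MobiusOrConformal V)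

theorem deriv : DerivativeProperty U.L.Lneg U.base.Y := by
  cases U with
  | mobius M => exact M.deriv
  | conformal C => exact C.deriv

theorem sl2Commutators : Sl2Commutators U.L U.base.Y U.L := by
  cases U with
  | mobius M => exact M.sl2_comm
  | conformal C => exact C.jacobi.sl2Commutators C.ω

theorem Lneg_eq (v : V) : U.L.Lneg v = U.base.Y v (-2) U.base.vac := by
  have h := LinearMap.congr_fun (U.deriv v (-1)) U.base.vac
  rw [(U.base.creation _).2] at h
  simpa using h

/-- Since `L(-1)v = v_{-2} 𝟏`, no separate computation is required for `Y'_{P(z)}`: its Jacobi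
identity and vacuum property suffice. -/
theorem derivative_of_jacobi {W : Type*} [AddCommGroup W] [Module ℂ W] {Y : VOMap V W}
    (jac : JacobiIdentity U.base.Y Y) (hvac : VacuumProperty U.base.vac Y) :
    DerivativeProperty U.L.Lneg Y := by
  intro v n
  rw [U.Lneg_eq]
  exact jac.mode_neg_two hvac v n

/-- The mode `-1` of the vacuum is the identity and commutes with `L(1)`. In the commutator formula
the `L(0)` and `L(-1)` terms vanish, which leaves the mode `-1` of `L(1)𝟏`; applied to the vacuum it
returns `L(1)𝟏`. -/
theorem Lpos_vac : U.L.Lpos U.base.vac = 0 := by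
  have h := (U.sl2Commutators U.base.vac (-1)).2.2
  have h0 : U.L.Lzero U.base.vac = 0 := by
    rw [U.Lzero_wt 0 _ U.base.vac_mem]; simp
  rw [h0, map_zero, Pi.zero_apply, smul_zero, add_zero, U.deriv, U.base.vacuum, U.base.vacuum] at h
  have h1 := LinearMap.congr_fun h U.base.vac
  rw [LinearMap.add_apply, (U.base.creation _).2] at h1
  simpa [Ring.lie_def] using h1.symm

/-- The weight spaces already span `V`, so the independent eigenspaces containing them cannot be
larger. -/
theorem mem_wt_iff (h : ℤ) (v : V) : v ∈ U.base.wt h ↔ U.L.Lzero v = (h : ℂ) • v := by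
  refine ⟨U.Lzero_wt h v, fun hv => ?_⟩
  have h1 := eq_of_le_of_iSup_eq_top (F := fun n : ℤ => U.L.Lzero.eigenspace (n : ℂ))
    U.base.wt_grading.2 (fun i v hv => Module.End.mem_eigenspace_iff.mpr (U.Lzero_wt i v hv))
    ((Module.End.eigenspaces_iSupIndep _).comp Int.cast_injective) h
  rw [← h1]
  exact Module.End.mem_eigenspace_iff.mpr hv

variable {U}

theorem Lpos_mem_wt {h : ℤ} {v : V} (hv : v ∈ U.base.wt h) : U.L.Lpos v ∈ U.base.wt (h - 1) := by
  rw [mem_wt_iff]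
  have h1 := LinearMap.congr_fun U.Lzero_Lpos v
  rw [Ring.lie_def, LinearMap.sub_apply, Module.End.mul_apply, Module.End.mul_apply,
    U.Lzero_wt h v hv, map_smul, LinearMap.neg_apply, sub_eq_iff_eq_add] at h1
  rw [h1]
  push_cast
  module

theorem Lpos_pow_mem_wt {h : ℤ} {v : V} (hv : v ∈ U.base.wt h) (k : ℕ) :
    (U.L.Lpos ^ k) v ∈ U.base.wt (h - k) := by
  induction k with
  | zero => simpa using hv
  | succ k ih =>
    rw [pow_succ', Module.End.mul_apply]
    have := Lpos_mem_wt ih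
    rwa [show h - ((k + 1 : ℕ) : ℤ) = h - k - 1 by push_cast; ring]

theorem mode_mem_wt {h h' : ℤ} {u v : V} (hu : u ∈ U.base.wt h) (hv : v ∈ U.base.wt h') (l : ℤ) :
    U.base.Y u l v ∈ U.base.wt (h + h' - l - 1) := by
  rw [mem_wt_iff]
  have h1 := LinearMap.congr_fun (U.sl2Commutators u l).2.1 v
  rw [U.deriv, U.Lzero_wt h u hu, Ring.lie_def, LinearMap.sub_apply, Module.End.mul_apply,
    Module.End.mul_apply, U.Lzero_wt h' v hv, map_smul, map_smul, sub_eq_iff_eq_add] at h1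
  rw [h1]
  simp only [Pi.smul_apply, LinearMap.add_apply, LinearMap.smul_apply, add_sub_cancel_right]
  push_cast
  module

theorem Lpos_mode {h : ℤ} {u : V} (hu : u ∈ U.base.wt h) (l : ℤ) (v : V) :
    U.L.Lpos (U.base.Y u l v) = U.base.Y u l (U.L.Lpos v) + U.base.Y (U.L.Lpos u) l v +
      (2 * h - 2 - l : ℂ) • U.base.Y u (l + 1) v := by
  have h1 := LinearMap.congr_fun (U.sl2Commutators u l).2.2 v
  rw [U.deriv, U.Lzero_wt h u hu, Ring.lie_def, LinearMap.sub_apply, Module.End.mul_apply,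
    Module.End.mul_apply, map_smul, sub_eq_iff_eq_add] at h1
  rw [h1, show l + 2 - 1 = l + 1 by ring]
  simp only [Pi.smul_apply, LinearMap.add_apply, LinearMap.smul_apply]
  push_cast
  module

variable (U)

/-- The divided power `L(1)ᵏ / k!`. -/
def Lpd (k : ℕ) : Module.End ℂ V := (k.factorial : ℂ)⁻¹ • U.L.Lpos ^ k

@[simp] theorem Lpd_zero : U.Lpd 0 = 1 := by simp [Lpd]

theorem Lpos_Lpd (k : ℕ) (v : V) : U.L.Lpos (U.Lpd k v) = (k + 1 : ℂ) • U.Lpd (k + 1) v := by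
  simp only [Lpd, LinearMap.smul_apply, map_smul, smul_smul]
  rw [pow_succ' _ k, Module.End.mul_apply, Nat.factorial_succ]
  congr 1
  have h1 : (k.factorial : ℂ) ≠ 0 := Nat.cast_ne_zero.mpr k.factorial_ne_zero
  have h2 : (k : ℂ) + 1 ≠ 0 := by exact_mod_cast Nat.succ_ne_zero k
  push_cast
  field_simp

theorem Lpd_Lpos (k : ℕ) (v : V) : U.Lpd k (U.L.Lpos v) = (k + 1 : ℂ) • U.Lpd (k + 1) v := by
  rw [← Lpos_Lpd, ← Module.End.mul_apply, ← Module.End.mul_apply]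
  congr 1
  rw [Lpd, smul_mul_assoc, mul_smul_comm, ← pow_succ, ← pow_succ']

variable {U}

theorem Lpd_mem_wt {h : ℤ} {v : V} (hv : v ∈ U.base.wt h) (k : ℕ) :
    U.Lpd k v ∈ U.base.wt (h - k) :=
  Submodule.smul_mem _ _ (Lpos_pow_mem_wt hv k)

variable (U)

/-- The coefficients of `x ^ j` in `e^{xL(1)} u_l e^{-xL(1)}` for `u` of weight `h`. -/
def conjMode (h l : ℤ) (u : V) (j : ℕ) : Module.End ℂ V :=
  ∑ r ∈ antidiagonal j, bin (2 * h - 2 - l - r.1) r.2 • U.base.Y (U.Lpd r.1 u) (l + r.2)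

variable {U}

/-- This is the differential equation in `x` satisfied by `e^{xL(1)} u_l e^{-xL(1)}`. Bracketing
with `L(1)` either raises the divided power of `L(1)` on `u` or raises the mode index, as
`Lpos_mode` shows. -/
theorem Lpos_conjMode {h : ℤ} {u : V} (hu : u ∈ U.base.wt h) (l : ℤ) (j : ℕ) (v : V) :
    U.L.Lpos (U.conjMode h l u j v) = U.conjMode h l u j (U.L.Lpos v) +
      (j + 1 : ℂ) • U.conjMode h l u (j + 1) v := by
  let y : ℕ → ℕ → V := fun a i => U.base.Y (U.Lpd a u) (l + i) v
  have key : ∀ a i : ℕ, U.L.Lpos (y a i) = U.base.Y (U.Lpd a u) (l + i) (U.L.Lpos v) +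
      (a + 1 : ℂ) • y (a + 1) i + (2 * h - 2 - l - 2 * a - i : ℂ) • y a (i + 1) := by
    intro a i
    have := Lpos_mode (Lpd_mem_wt hu a) (l + i) v
    rw [Lpos_Lpd, map_smul] at this
    simp only [y]
    rw [this]
    simp only [Pi.smul_apply, LinearMap.smul_apply]
    push_cast
    rw [add_assoc l]
    congr 2
    ring
  have e1 : ∑ r ∈ antidiagonal j, (bin (2 * h - 2 - l - r.1) r.2 * (r.1 + 1)) • y (r.1 + 1) r.2 =
      ∑ r ∈ antidiagonal (j + 1), (bin (2 * h - 2 - l - r.1 + 1) r.2 * r.1) • y r.1 r.2 := by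
    rw [Finset.Nat.sum_antidiagonal_succ]
    simp only [Nat.cast_zero, mul_zero, zero_smul, zero_add]
    refine Finset.sum_congr rfl fun r _ => ?_
    push_cast
    congr 3
    ring
  have e2 : ∑ r ∈ antidiagonal j, (bin (2 * h - 2 - l - r.1) r.2 *
        (2 * h - 2 - l - 2 * r.1 - r.2)) • y r.1 (r.2 + 1) =
      ∑ r ∈ antidiagonal (j + 1), (if r.2 = 0 then 0 else
        bin (2 * h - 2 - l - r.1) (r.2 - 1) * (2 * h - 2 - l - 2 * r.1 - r.2 + 1 : ℂ)) •
          y r.1 r.2 := by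
    rw [Finset.Nat.sum_antidiagonal_succ']
    simp only [if_true, zero_smul, zero_add, Nat.add_one_ne_zero, if_false, Nat.add_sub_cancel]
    refine Finset.sum_congr rfl fun r _ => ?_
    push_cast
    congr 2
    ring
  -- With `j + 1 = r.1 + r.2`, the two summands are the contributions of raising the divided power
  -- and of raising the mode; they add up by Pascal's rule and `bin_mul_succ`.
  have e3 : ∀ r ∈ antidiagonal (j + 1), (j + 1 : ℂ) * bin (2 * h - 2 - l - r.1) r.2 =
      bin (2 * h - 2 - l - r.1 + 1) r.2 * r.1 + (if r.2 = 0 then 0 else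
        bin (2 * h - 2 - l - r.1) (r.2 - 1) * (2 * h - 2 - l - 2 * r.1 - r.2 + 1 : ℂ)) := by
    rintro ⟨a, i⟩ hr
    have hr' : a + i = j + 1 := mem_antidiagonal.mp hr
    have hj : (j + 1 : ℂ) = a + i := by exact_mod_cast hr'.symm
    rw [hj]
    cases i with
    | zero => simp
    | succ i =>
      have := bin_mul_succ (2 * h - 2 - l - a) i
      push_cast at this
      rw [bin_succ_succ]
      simp only [Nat.add_one_ne_zero, if_false, Nat.add_sub_cancel]
      push_cast
      linear_combination this
  have hc : (j + 1 : ℂ) • U.conjMode h l u (j + 1) v =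
      ∑ r ∈ antidiagonal (j + 1), ((j + 1 : ℂ) * bin (2 * h - 2 - l - r.1) r.2) • y r.1 r.2 := by
    simp only [conjMode, LinearMap.sum_apply, LinearMap.smul_apply, Finset.smul_sum, smul_smul, y]
  rw [hc, Finset.sum_congr rfl fun r hr => by rw [e3 r hr, add_smul], Finset.sum_add_distrib,
    ← e1, ← e2]
  simp only [conjMode, LinearMap.sum_apply, LinearMap.smul_apply, map_sum, map_smul]
  rw [← Finset.sum_add_distrib, ← Finset.sum_add_distrib]
  refine Finset.sum_congr rfl fun r _ => ?_
  have := key r.1 r.2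
  simp only [y] at this ⊢
  rw [this, smul_add, smul_add, smul_smul, smul_smul, add_assoc]

/-- `e^{xL(1)} Y(u, x₀) v = (e^{xL(1)} Y(u, x₀) e^{-xL(1)}) e^{xL(1)} v`, in components. -/
theorem Lpd_mode {h : ℤ} {u : V} (hu : u ∈ U.base.wt h) (l : ℤ) (k : ℕ) (v : V) :
    U.Lpd k (U.base.Y u l v) =
      ∑ p ∈ antidiagonal k, U.conjMode h l u p.1 (U.Lpd p.2 v) := by
  induction k with
  | zero => simp [conjMode]
  | succ k ih =>
    have hk : ((k : ℂ) + 1) ≠ 0 := by exact_mod_cast Nat.succ_ne_zero k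
    refine smul_right_injective V hk ?_
    dsimp only
    rw [← Lpos_Lpd, ih, map_sum]
    -- Leibniz rule: writing `k + 1 = p.1 + p.2` separates the derivative of the conjugated mode
    -- from that of `e^{xL(1)} v`.
    have e1 : ((k : ℂ) + 1) • ∑ p ∈ antidiagonal (k + 1), U.conjMode h l u p.1 (U.Lpd p.2 v) =
        ∑ p ∈ antidiagonal (k + 1), ((p.1 : ℂ) • U.conjMode h l u p.1 (U.Lpd p.2 v)) +
        ∑ p ∈ antidiagonal (k + 1), ((p.2 : ℂ) • U.conjMode h l u p.1 (U.Lpd p.2 v)) := by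
      rw [← Finset.sum_add_distrib, Finset.smul_sum]
      refine Finset.sum_congr rfl fun p hp => ?_
      have hp' : p.1 + p.2 = k + 1 := mem_antidiagonal.mp hp
      have hj : (k + 1 : ℂ) = p.1 + p.2 := by exact_mod_cast hp'.symm
      rw [hj, add_smul]
    rw [e1, Finset.Nat.sum_antidiagonal_succ, Finset.Nat.sum_antidiagonal_succ', Nat.cast_zero,
      zero_smul, zero_smul, zero_add, zero_add, ← Finset.sum_add_distrib]
    refine Finset.sum_congr rfl fun p _ => ?_
    rw [Lpos_conjMode hu, Lpos_Lpd, map_smul, add_comm]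
    push_cast
    rfl

end MobiusOrConformal

section Action

variable {B : Type*} [AddCommGroup B] {A : AddSubgroup B}
  {V : Type*} [AddCommGroup V] [Module ℂ V] {𝒱 : StronglyGradedVertexAlgebra A V}
  {W₁ : Type*} [AddCommGroup W₁] [Module ℂ W₁] {W₂ : Type*} [AddCommGroup W₂] [Module ℂ W₂]
  (M₁ : GeneralizedModule 𝒱 W₁) (M₂ : GeneralizedModule 𝒱 W₂) (z : ℂ)

/-! ### The operators of `v ⊗ t ^ q (t - z) ^ k` on `W₁ ⊗ W₂` -/

theorem single_one_zpow (k : ℤ) :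
    (HahnSeries.single 1 1 : LaurentSeries ℂ) ^ k = HahnSeries.single k 1 := by
  rw [← RatFunc.single_zpow]

theorem iotaPlus_rat (z : ℂ) (q k : ℤ) :
    iotaPlus (RatFunc.X ^ q * (RatFunc.X - RatFunc.C z) ^ k) = pw (-z) k q := by
  change iotaPlusHom _ = _
  rw [map_mul, map_zpow₀, map_zpow₀, map_sub, iotaPlusHom_X, iotaPlusHom_C, pw, map_neg,
    ← sub_eq_add_neg, single_one_zpow, mul_comm]

/-- After `t ↦ t + z` the local variable is the old `t - z`, and `t ^ q` becomes the invertible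
factor. Hence the exponents enter `pw` in the opposite order from `iotaPlus_rat`. -/
theorem iotaPlus_translate_rat (z : ℂ) (q k : ℤ) :
    iotaPlus (translate z (RatFunc.X ^ q * (RatFunc.X - RatFunc.C z) ^ k)) = pw z q k := by
  change iotaPlusHom _ = _
  have hC : translate z (RatFunc.C z) = RatFunc.C z := substRat_C _ _ _
  rw [map_mul, map_zpow₀, map_zpow₀, map_sub, translate_X, hC, add_sub_cancel_right,
    map_mul, map_zpow₀, map_zpow₀, map_add, iotaPlusHom_X, iotaPlusHom_C, pw, single_one_zpow]

/-- The operator on `W₁ ⊗ W₂` given by the action of `v ⊗ t ^ q (t - z) ^ k`, expanded at `t = z`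
on `W₁` and at `t = 0` on `W₂`. -/
def sg (q k : ℤ) : V →ₗ[ℂ] Module.End ℂ (W₁ ⊗[ℂ] W₂) :=
  LinearMap.rTensorHom W₂ ∘ₗ M₁.tau ∘ₗ (TensorProduct.mk ℂ V _).flip (pw z q k) +
    LinearMap.lTensorHom W₁ ∘ₗ M₂.tau ∘ₗ (TensorProduct.mk ℂ V _).flip (pw (-z) k q)

theorem sg_apply (q k : ℤ) (v : V) : sg M₁ M₂ z q k v =
    LinearMap.rTensor W₂ (M₁.tau (v ⊗ₜ pw z q k)) +
      LinearMap.lTensor W₁ (M₂.tau (v ⊗ₜ pw (-z) k q)) := rfl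

theorem sg_tmul (q k : ℤ) (v : V) (w₁ : W₁) (w₂ : W₂) : sg M₁ M₂ z q k v (w₁ ⊗ₜ w₂) =
    M₁.tau (v ⊗ₜ pw z q k) w₁ ⊗ₜ w₂ + w₁ ⊗ₜ M₂.tau (v ⊗ₜ pw (-z) k q) w₂ := by
  rw [sg_apply, LinearMap.add_apply, LinearMap.rTensor_tmul, LinearMap.lTensor_tmul]

theorem tau_single {W : Type*} [AddCommGroup W] [Module ℂ W] (M : GeneralizedModule 𝒱 W) (v : V)
    (k : ℤ) : M.tau (v ⊗ₜ HahnSeries.single k 1) = M.Y v k :=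
  (tauW_single _ v k 1).trans (one_smul _ _)

theorem sg_zero_tmul (q : ℤ) (v : V) (w₁ : W₁) (w₂ : W₂) : sg M₁ M₂ z q 0 v (w₁ ⊗ₜ w₂) =
    M₁.tau (v ⊗ₜ pw z q 0) w₁ ⊗ₜ w₂ + w₁ ⊗ₜ M₂.Y v q w₂ := by
  rw [sg_tmul, pw_zero_left, tau_single]

/-- The action of `v ⊗ t ^ q (t - z) ^ k` on `(W₁ ⊗ W₂)*`. -/
def sgT (q k : ℤ) : V →ₗ[ℂ] Module.End ℂ (Module.Dual ℂ (W₁ ⊗[ℂ] W₂)) :=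
  Module.Dual.transpose ∘ₗ sg M₁ M₂ z q k

theorem sgT_apply (q k : ℤ) (v : V) (lam : Module.Dual ℂ (W₁ ⊗[ℂ] W₂)) (w : W₁ ⊗[ℂ] W₂) :
    sgT M₁ M₂ z q k v lam w = lam (sg M₁ M₂ z q k v w) := rfl

theorem exists_Lpd_eq_zero (𝒱 : StronglyGradedVertexAlgebra A V) (v : V) :
    ∃ K : ℕ, ∀ k : ℕ, K ≤ k → 𝒱.va.Lpd k v = 0 := by
  obtain ⟨K, hK⟩ := 𝒱.Lpos_locally_nilpotent v
  exact ⟨K, fun k hk => by rw [MobiusOrConformal.Lpd, LinearMap.smul_apply, hK k hk, smul_zero]⟩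

theorem opp_eq_sum {h : ℤ} {v : V} (hv : v ∈ 𝒱.va.base.wt h) {K : ℕ}
    (hK : ∀ k : ℕ, K ≤ k → 𝒱.va.Lpd k v = 0) :
    𝒱.opp v = ∑ k ∈ Finset.range K, (-1 : ℂ) ^ h •
      (𝒱.va.Lpd k v ⊗ₜ[ℂ] ((RatFunc.X : RatFunc ℂ) ^ (2 * h - 2 - (k : ℤ)))) := by
  have e : ∀ k : ℕ, ((-1 : ℂ) ^ h / (k.factorial : ℂ)) •
      ((𝒱.va.L.Lpos ^ k) v ⊗ₜ[ℂ] ((RatFunc.X : RatFunc ℂ) ^ (2 * h - 2 - (k : ℤ)))) =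
      (-1 : ℂ) ^ h •
      (𝒱.va.Lpd k v ⊗ₜ[ℂ] ((RatFunc.X : RatFunc ℂ) ^ (2 * h - 2 - (k : ℤ)))) := by
    intro k
    rw [MobiusOrConformal.Lpd, LinearMap.smul_apply, ← TensorProduct.smul_tmul', smul_smul,
      div_eq_mul_inv]
  rw [𝒱.opp_of_mem h v hv]
  change ∑ᶠ k : ℕ, _ = _
  rw [finsum_congr e]
  exact finsum_eq_sum_range _ K fun k hk => by rw [hK k hk, TensorProduct.zero_tmul, smul_zero]

theorem invSubst_rat (z : ℂ) (n m e : ℤ) :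
    invSubst ((RatFunc.X⁻¹ - RatFunc.C z) ^ n * RatFunc.X ^ m) * RatFunc.X ^ e =
      RatFunc.X ^ (e - m) * (RatFunc.X - RatFunc.C z) ^ n := by
  have hC : invSubst (RatFunc.C z) = RatFunc.C z := substRat_C _ _ _
  rw [map_mul, map_zpow₀, map_zpow₀, map_sub, map_inv₀, invSubst_X, hC, inv_inv, inv_zpow',
    mul_assoc, ← zpow_add₀ RatFunc.X_ne_zero, mul_comm, show -m + e = e - m by ring]

/-- The inversion `t ↦ t⁻¹` turns `(t⁻¹ - z) ^ n t ^ m` into `(t - z) ^ n t ^ (-m)`. From here on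
the opposite map is replaced by explicit sums over divided powers of `L(1)`. -/
theorem tauPz_eq_sum {h : ℤ} {v : V} (hv : v ∈ 𝒱.va.base.wt h) {K : ℕ}
    (hK : ∀ k : ℕ, K ≤ k → 𝒱.va.Lpd k v = 0) (n m : ℤ) :
    tauPz M₁ M₂ z (v ⊗ₜ ((RatFunc.X⁻¹ - RatFunc.C z) ^ n * RatFunc.X ^ m)) =
      ∑ k ∈ Finset.range K, (-1 : ℂ) ^ h •
        sgT M₁ M₂ z (2 * h - 2 - k - m) n (𝒱.va.Lpd k v) := by
  have e : 𝒱.oppMap (v ⊗ₜ ((RatFunc.X⁻¹ - RatFunc.C z) ^ n * RatFunc.X ^ m)) =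
      ∑ k ∈ Finset.range K, (-1 : ℂ) ^ h • (𝒱.va.Lpd k v ⊗ₜ[ℂ]
        (RatFunc.X ^ (2 * h - 2 - k - m) * (RatFunc.X - RatFunc.C z) ^ n)) := by
    rw [𝒱.oppMap_tmul, opp_eq_sum hv hK, map_sum]
    refine Finset.sum_congr rfl fun k _ => ?_
    rw [map_smul, LinearMap.lTensor_tmul, LinearMap.mulLeft_apply, invSubst_rat]
  rw [tauPz, LinearMap.comp_apply, sigmaPz]
  simp only [LinearMap.add_apply, LinearMap.comp_apply, e, map_sum, map_smul,
    LinearMap.lTensor_tmul, AlgHom.toLinearMap_apply, iotaPlus_rat, iotaPlus_translate_rat]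
  rw [← Finset.sum_add_distrib, map_sum]
  refine Finset.sum_congr rfl fun k _ => ?_
  rw [← smul_add, map_smul]
  rfl

theorem YPz_eq_sum {h : ℤ} {v : V} (hv : v ∈ 𝒱.va.base.wt h) {K : ℕ}
    (hK : ∀ k : ℕ, K ≤ k → 𝒱.va.Lpd k v = 0) (m : ℤ) :
    YPz M₁ M₂ z v m =
      ∑ k ∈ Finset.range K, (-1 : ℂ) ^ h •
        sgT M₁ M₂ z (2 * h - 2 - k - m) 0 (𝒱.va.Lpd k v) := by
  rw [← tauPz_eq_sum M₁ M₂ z hv hK, zpow_zero, one_mul]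
  rfl

/-- `[v ⊗ f, v' ⊗ g] = ∑ᵢ (vᵢ v') ⊗ (f⁽ⁱ⁾ / i!) g` on `W₁ ⊗ W₂`. -/
theorem sg_commutator (hz : z ≠ 0) (u v : V) (q k q' k' : ℤ) {I : ℕ}
    (hI : ∀ i : ℕ, I ≤ i → 𝒱.va.base.Y u i v = 0) :
    ⁅sg M₁ M₂ z q k u, sg M₁ M₂ z q' k' v⁆ =
      ∑ i ∈ Finset.range I, ∑ r ∈ antidiagonal i, (bin q r.1 * bin k r.2) •
        sg M₁ M₂ z (q + q' - r.1) (k + k' - r.2) (𝒱.va.base.Y u i v) := by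
  have h1 := tauW_pw_commutator M₁.isModule.lowerTruncated M₁.isModule.jacobi hz u v q k q' k' hI
  have h2 := tauW_pw_commutator M₂.isModule.lowerTruncated M₂.isModule.jacobi (neg_ne_zero.mpr hz)
    u v k q k' q' hI
  have e : ⁅sg M₁ M₂ z q k u, sg M₁ M₂ z q' k' v⁆ =
      LinearMap.rTensor W₂ ⁅M₁.tau (u ⊗ₜ pw z q k), M₁.tau (v ⊗ₜ pw z q' k')⁆ +
      LinearMap.lTensor W₁ ⁅M₂.tau (u ⊗ₜ pw (-z) k q), M₂.tau (v ⊗ₜ pw (-z) k' q')⁆ := by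
    refine TensorProduct.ext' fun w₁ w₂ => ?_
    simp only [Ring.lie_def, LinearMap.sub_apply, Module.End.mul_apply, LinearMap.add_apply,
      sg_tmul, map_add, LinearMap.rTensor_tmul, LinearMap.lTensor_tmul, TensorProduct.sub_tmul,
      TensorProduct.tmul_sub]
    abel
  rw [e]
  change LinearMap.rTensorHom W₂ ⁅tauW _ _ _, tauW _ _ _⁆ +
    LinearMap.lTensorHom W₁ ⁅tauW _ _ _, tauW _ _ _⁆ = _
  rw [h1, h2, map_sum, map_sum, ← Finset.sum_add_distrib]
  refine Finset.sum_congr rfl fun i _ => ?_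
  -- On `W₂` the exponents `q` and `k` exchange roles in `pw`, so the Leibniz sum must be reflected
  -- before it is added to that of `W₁`.
  rw [← Finset.Nat.sum_antidiagonal_swap (n := i) (f := fun r => (bin k r.1 * bin q r.2) •
        tauW M₂.Y _ (_ ⊗ₜ pw (-z) (k + k' - r.1) (q + q' - r.2))), map_sum, map_sum,
    ← Finset.sum_add_distrib]
  refine Finset.sum_congr rfl fun r _ => ?_
  rw [map_smul, map_smul, sg_apply, smul_add, Prod.fst_swap, Prod.snd_swap, mul_comm (bin k r.2)]
  rfl

end Action

/-! ### Families determined by their expansion at infinity -/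

section Expandable

variable {M N : Type*} [AddCommGroup M] [Module ℂ M] [AddCommGroup N] [Module ℂ N]

/-- The families `F q k`, thought of as values of a functional on `t ^ q (t - z) ^ k`, that are
determined by the expansion of `(t - z) ^ k` in nonnegative powers of `z`, and that vanish on
`t ^ q` for `q` sufficiently negative. -/
def expandable (z : ℂ) (M : Type*) [AddCommGroup M] [Module ℂ M] : Submodule ℂ (ℤ → ℤ → M) where
  carrier := {F | ∃ N : ℤ, (∀ q ≤ N, F q 0 = 0) ∧ ∀ (q k : ℤ) (I : ℕ), q + k - I ≤ N →
    F q k = ∑ i ∈ Finset.range I, (bin k i * (-z) ^ i) • F (q + k - i) 0}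
  zero_mem' := ⟨0, by simp, by simp⟩
  add_mem' := by
    rintro F G ⟨N, hN, hF⟩ ⟨N', hN', hG⟩
    refine ⟨min N N', fun q hq => ?_, fun q k I hI => ?_⟩
    · simp [hN q (by omega), hN' q (by omega)]
    · simp only [Pi.add_apply, hF q k I (by omega), hG q k I (by omega), smul_add,
        Finset.sum_add_distrib]
  smul_mem' := by
    rintro c F ⟨N, hN, hF⟩
    refine ⟨N, fun q hq => ?_, fun q k I hI => ?_⟩
    · simp [hN q hq]
    · simp only [Pi.smul_apply, hF q k I hI, Finset.smul_sum, smul_comm c]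

variable {z : ℂ} {F : ℤ → ℤ → M}

theorem expandable_shift (hF : F ∈ expandable z M) (d : ℤ) :
    (fun q k => F (q + d) k) ∈ expandable z M := by
  obtain ⟨N, hN, hF⟩ := hF
  refine ⟨N - d, fun q hq => hN _ (by omega), fun q k I hI => ?_⟩
  dsimp only
  rw [hF _ k I (by omega)]
  exact Finset.sum_congr rfl fun i _ => by rw [show q + d + k - i = q + k - i + d by ring]

theorem expandable_map (hF : F ∈ expandable z M) (f : M →ₗ[ℂ] N) :
    (fun q k => f (F q k)) ∈ expandable z N := by
  obtain ⟨N, hN, hF⟩ := hF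
  refine ⟨N, fun q hq => by simp only [hN q hq, map_zero], fun q k I hI => ?_⟩
  simp only [hF q k I hI, map_sum, map_smul]

theorem bin_mul_bin_comm (k : ℤ) (r j : ℕ) :
    bin k r * bin (k - r) j = bin k j * bin (k - j) r := by
  rw [bin_mul, bin_mul, add_comm r j, ← Nat.choose_symm_add]

theorem sum_bin_mul_bin_mul_bin (q k : ℤ) (i j : ℕ) :
    ∑ r ∈ antidiagonal i, bin q r.1 * bin k r.2 * bin (k - r.2) j =
      bin k j * bin (q + k - j) i := by
  rw [add_sub_assoc, bin_add, Finset.mul_sum]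
  refine Finset.sum_congr rfl fun r _ => ?_
  rw [mul_assoc, bin_mul_bin_comm]
  ring

/-- The inner sum evaluates `F` on `t ^ n` times the `i`-th Hasse derivative of `t ^ q (t - z) ^ k`.
Differentiation commutes with expansion at infinity; on coefficients this is
`sum_bin_mul_bin_mul_bin`. Such sums appear in the commutator formula. -/
theorem expandable_hasse (hF : F ∈ expandable z M) (n : ℤ) (i : ℕ) :
    (fun q k => ∑ r ∈ antidiagonal i, (bin q r.1 * bin k r.2) • F (q + n - r.1) (k - r.2)) ∈
      expandable z M := by
  obtain ⟨N, hN, hF⟩ := hF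
  have h0 : ∀ q : ℤ, ∑ r ∈ antidiagonal i,
      (bin q r.1 * bin 0 r.2) • F (q + n - r.1) (0 - r.2) = bin q i • F (q + n - i) 0 := by
    intro q
    rw [Finset.sum_eq_single_of_mem (i, 0) (mem_antidiagonal.mpr (add_zero i))]
    · simp
    · rintro ⟨a, b⟩ hr hne
      obtain ⟨b, rfl⟩ : ∃ b', b = b' + 1 := by
        refine Nat.exists_eq_succ_of_ne_zero fun hb => hne ?_
        have : a + b = i := mem_antidiagonal.mp hr
        simp [hb] at this
        simp [this, hb]
      rw [bin_zero_succ, mul_zero, zero_smul]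
  refine ⟨N - n, fun q hq => ?_, fun q k I hI => ?_⟩
  · dsimp only
    rw [h0, hN _ (by omega), smul_zero]
  · simp only [h0]
    have e : ∀ r ∈ antidiagonal i, F (q + n - r.1) (k - r.2) = ∑ j ∈ Finset.range I,
        (bin (k - r.2) j * (-z) ^ j) • F (q + k - j + n - i) 0 := by
      intro r hr
      have hr' : r.1 + r.2 = i := mem_antidiagonal.mp hr
      rw [hF _ _ I (by omega)]
      refine Finset.sum_congr rfl fun j _ => ?_
      rw [show q + n - (r.1 : ℤ) + (k - r.2) - j = q + k - j + n - i by omega]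
    rw [Finset.sum_congr rfl fun r hr => by rw [e r hr, Finset.smul_sum], Finset.sum_comm]
    refine Finset.sum_congr rfl fun j _ => ?_
    simp only [smul_smul]
    rw [← Finset.sum_smul]
    congr 1
    rw [mul_right_comm, ← sum_bin_mul_bin_mul_bin, Finset.sum_mul]
    exact Finset.sum_congr rfl fun r _ => by ring

end Expandable

/-! ### Compatible functionals and their stability under modes -/

section Compatible

variable {B : Type*} [AddCommGroup B] {A : AddSubgroup B}
  {V : Type*} [AddCommGroup V] [Module ℂ V] {𝒱 : StronglyGradedVertexAlgebra A V}
  {W₁ : Type*} [AddCommGroup W₁] [Module ℂ W₁] {W₂ : Type*} [AddCommGroup W₂] [Module ℂ W₂]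
  (M₁ : GeneralizedModule 𝒱 W₁) (M₂ : GeneralizedModule 𝒱 W₂) (z : ℂ)

/-- The functional `λ` on the family `v ⊗ t ^ q (t - z) ^ k`. -/
def sgFamily : V →ₗ[ℂ] Module.Dual ℂ (W₁ ⊗[ℂ] W₂) →ₗ[ℂ]
    (ℤ → ℤ → Module.Dual ℂ (W₁ ⊗[ℂ] W₂)) :=
  LinearMap.mk₂ ℂ (fun v lam q k => sgT M₁ M₂ z q k v lam)
    (fun v v' lam => by ext; simp)
    (fun c v lam => by ext; simp)
    (fun v lam lam' => by ext; simp)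
    (fun c v lam => by ext; simp)

theorem sgFamily_apply (v : V) (lam : Module.Dual ℂ (W₁ ⊗[ℂ] W₂)) (q k : ℤ) :
    sgFamily M₁ M₂ z v lam q k = sgT M₁ M₂ z q k v lam := rfl

/-- The functionals that satisfy the compatibility condition, expressed in terms of the
operators of `v ⊗ t ^ q (t - z) ^ k`. -/
def compatible : Submodule ℂ (Module.Dual ℂ (W₁ ⊗[ℂ] W₂)) :=
  ⨅ v : V, (expandable z _).comap (sgFamily M₁ M₂ z v)

variable {M₁ M₂ z}

theorem mem_compatible {lam : Module.Dual ℂ (W₁ ⊗[ℂ] W₂)} : lam ∈ compatible M₁ M₂ z ↔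
    ∀ v : V, sgFamily M₁ M₂ z v lam ∈ expandable z (Module.Dual ℂ (W₁ ⊗[ℂ] W₂)) := by
  simp only [compatible, Submodule.mem_iInf, Submodule.mem_comap]

theorem sgFamily_mem_expandable_of_iSup_eq_top {ι : Type*} {E : ι → Submodule ℂ V}
    (hE : ⨆ i, E i = ⊤)
    {lam : Module.Dual ℂ (W₁ ⊗[ℂ] W₂)} (h : ∀ i, ∀ v ∈ E i,
      sgFamily M₁ M₂ z v lam ∈ expandable z (Module.Dual ℂ (W₁ ⊗[ℂ] W₂))) :
    lam ∈ compatible M₁ M₂ z := by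
  refine mem_compatible.mpr fun v => ?_
  have hle : ⨆ i, E i ≤ (expandable z _).comap ((sgFamily M₁ M₂ z).flip lam) :=
    iSup_le fun i v hv => h i v hv
  rw [hE] at hle
  exact hle (Submodule.mem_top (x := v))

/-- The hypothesis concerns `vᵒ`, the goal `v` itself. Up to sign and a shift, the leading term of
`vᵒ` is `v`, and the others involve divided powers of `L(1)` of smaller nilpotency order, so
induction on that order isolates `v`. -/
theorem COMP_subset_compatible : COMP M₁ M₂ z ⊆ compatible M₁ M₂ z := by
  rintro lam ⟨htr, hexp⟩
  refine sgFamily_mem_expandable_of_iSup_eq_top 𝒱.va.base.wt_grading.2 fun h v hv => ?_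
  -- With `q = -m`, conditions (a) and (b) together say that the family attached to the whole of
  -- `vᵒ` is expandable.
  have hG : ∀ v : V, (fun q n : ℤ => tauPz M₁ M₂ z
      (v ⊗ₜ ((RatFunc.X⁻¹ - RatFunc.C z) ^ n * RatFunc.X ^ (-q))) lam) ∈
      expandable z (Module.Dual ℂ (W₁ ⊗[ℂ] W₂)) := by
    intro v
    obtain ⟨N, hN⟩ := htr v
    have h0 : ∀ q : ℤ, tauPz M₁ M₂ z
        (v ⊗ₜ ((RatFunc.X⁻¹ - RatFunc.C z) ^ (0 : ℤ) * RatFunc.X ^ (-q))) lam =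
        YPz M₁ M₂ z v (-q) lam := by
      intro q
      rw [zpow_zero, one_mul]
      rfl
    refine ⟨-N, fun q hq => ?_, fun q k I hI => ?_⟩
    · dsimp only
      rw [h0, hN _ (by omega)]
    · simp only [h0]
      rw [hexp, finsum_eq_sum_range _ I fun i hi => by rw [hN _ (by omega), smul_zero]]
      refine Finset.sum_congr rfl fun i _ => ?_
      rw [show -(q + k - i) = -q - k + i by ring, bin]
  obtain ⟨K, hK⟩ := 𝒱.Lpos_locally_nilpotent v
  induction K using Nat.strong_induction_on generalizing h v with
  | _ K ih =>
  rcases K with _ | K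
  · have : v = 0 := by simpa using hK 0 le_rfl
    rw [this, map_zero]
    exact Submodule.zero_mem _
  have hrest : ∀ j ∈ Finset.range K, sgFamily M₁ M₂ z (𝒱.va.Lpd (j + 1) v) lam ∈
      expandable z (Module.Dual ℂ (W₁ ⊗[ℂ] W₂)) := by
    intro j hj
    refine ih K (Nat.lt_succ_self K) (h - ((j + 1 : ℕ) : ℤ)) _
      (MobiusOrConformal.Lpd_mem_wt hv (j + 1)) fun k hk => ?_
    rw [MobiusOrConformal.Lpd, LinearMap.smul_apply, map_smul, ← Module.End.mul_apply, ← pow_add,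
      hK _ (by omega), smul_zero]
  have hsum := Submodule.sum_mem _ fun j hj =>
    expandable_shift (hrest j hj) (2 * h - 2 - ((j + 1 : ℕ) : ℤ))
  -- The sign `(-1) ^ h` is its own inverse. What remains is the family of `v` shifted by `2h - 2`,
  -- and the next line undoes that shift.
  have htot := Submodule.sub_mem _ (Submodule.smul_mem _ ((-1 : ℂ) ^ h) (hG v)) hsum
  have := expandable_shift htot (-(2 * h - 2))
  convert this using 1
  funext q k
  have hKd : ∀ k : ℕ, K + 1 ≤ k → 𝒱.va.Lpd k v = 0 := fun k hk => by
    rw [MobiusOrConformal.Lpd, LinearMap.smul_apply, hK k hk, smul_zero]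
  simp only [Pi.sub_apply, Pi.smul_apply, Finset.sum_apply, sgFamily_apply]
  rw [tauPz_eq_sum M₁ M₂ z hv hKd, Finset.sum_range_succ', LinearMap.add_apply,
    LinearMap.sum_apply, smul_add, Finset.smul_sum]
  simp only [LinearMap.smul_apply, smul_smul, ← mul_zpow, neg_mul_neg, one_mul, one_zpow, one_smul,
    MobiusOrConformal.Lpd_zero, Module.End.one_apply]
  rw [add_sub_right_comm, ← Finset.sum_sub_distrib, Finset.sum_eq_zero, zero_add]
  · congr 4
    push_cast
    ring
  · intro j _
    rw [sub_eq_zero]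
    congr 4
    ring

theorem sgT_sgT (hz : z ≠ 0) (u v : V) (q k q' k' : ℤ) {I : ℕ}
    (hI : ∀ i : ℕ, I ≤ i → 𝒱.va.base.Y u i v = 0) (lam : Module.Dual ℂ (W₁ ⊗[ℂ] W₂)) :
    sgT M₁ M₂ z q k u (sgT M₁ M₂ z q' k' v lam) =
      sgT M₁ M₂ z q' k' v (sgT M₁ M₂ z q k u lam) -
      ∑ i ∈ Finset.range I, ∑ r ∈ antidiagonal i, (bin q r.1 * bin k r.2) •
        sgT M₁ M₂ z (q + q' - r.1) (k + k' - r.2) (𝒱.va.base.Y u i v) lam := by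
  refine LinearMap.ext fun w => ?_
  have h := LinearMap.congr_fun (sg_commutator M₁ M₂ z hz u v q k q' k' hI) w
  rw [Ring.lie_def, LinearMap.sub_apply, Module.End.mul_apply, Module.End.mul_apply,
    sub_eq_iff_eq_add] at h
  simp only [LinearMap.sub_apply, LinearMap.sum_apply, LinearMap.smul_apply, sgT_apply]
  rw [h, map_add]
  simp only [LinearMap.sum_apply, LinearMap.smul_apply, map_sum, map_smul]
  abel

/-- Moving the action of `u` past that of `v ⊗ t ^ n` gives a linear image of the family of `u`,
minus Hasse derivatives of the families of the `u_i v`. All of these are expandable. -/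
theorem sgT_mem_compatible (hz : z ≠ 0) {lam : Module.Dual ℂ (W₁ ⊗[ℂ] W₂)}
    (hlam : lam ∈ compatible M₁ M₂ z) (v : V) (n : ℤ) :
    sgT M₁ M₂ z n 0 v lam ∈ compatible M₁ M₂ z := by
  rw [mem_compatible] at hlam ⊢
  intro u
  obtain ⟨N, hN⟩ := 𝒱.va.base.lowerTruncated u v
  have hI : ∀ i : ℕ, N.toNat ≤ i → 𝒱.va.base.Y u i v = 0 := fun i hi => hN i (by omega)
  have h := Submodule.sub_mem _ (expandable_map (hlam u) (sgT M₁ M₂ z n 0 v))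
    (Submodule.sum_mem _ fun i (_ : i ∈ Finset.range N.toNat) =>
      expandable_hasse (hlam (𝒱.va.base.Y u i v)) n i)
  convert h using 1
  funext q k
  simp only [sgFamily_apply, Pi.sub_apply, Finset.sum_apply]
  rw [sgT_sgT hz u v q k n 0 hI]
  simp only [add_zero]

theorem YPz_mem_of_sgT_mem {lam : Module.Dual ℂ (W₁ ⊗[ℂ] W₂)}
    {U : Submodule ℂ (Module.Dual ℂ (W₁ ⊗[ℂ] W₂))}
    (h : ∀ (v : V) (n : ℤ), sgT M₁ M₂ z n 0 v lam ∈ U) (v : V) (n : ℤ) :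
    YPz M₁ M₂ z v n lam ∈ U := by
  have hle : ⨆ i, 𝒱.va.base.wt i ≤
      U.comap (LinearMap.applyₗ lam ∘ₗ LinearMap.proj n ∘ₗ YPz M₁ M₂ z) := by
    refine iSup_le fun i v hv => ?_
    obtain ⟨K, hK⟩ := exists_Lpd_eq_zero 𝒱 v
    change YPz M₁ M₂ z v n lam ∈ U
    rw [YPz_eq_sum M₁ M₂ z hv hK, LinearMap.sum_apply]
    exact Submodule.sum_mem _ fun k _ => Submodule.smul_mem _ _ (h _ _)
  rw [𝒱.va.base.wt_grading.2] at hle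
  exact hle (Submodule.mem_top (x := v))

theorem YPz_mem_compatible (hz : z ≠ 0) {lam : Module.Dual ℂ (W₁ ⊗[ℂ] W₂)}
    (hlam : lam ∈ compatible M₁ M₂ z) (v : V) (n : ℤ) :
    YPz M₁ M₂ z v n lam ∈ compatible M₁ M₂ z :=
  YPz_mem_of_sgT_mem (fun v n => sgT_mem_compatible hz hlam v n) v n

theorem sgT_truncated {lam : Module.Dual ℂ (W₁ ⊗[ℂ] W₂)} (hlam : lam ∈ compatible M₁ M₂ z)
    (v : V) : ∃ N : ℤ, ∀ q ≤ N, sgT M₁ M₂ z q 0 v lam = 0 := by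
  obtain ⟨N, hN, _⟩ := mem_compatible.mp hlam v
  exact ⟨N, hN⟩

theorem YPz_truncated {lam : Module.Dual ℂ (W₁ ⊗[ℂ] W₂)} (hlam : lam ∈ compatible M₁ M₂ z)
    (v : V) : ∃ N : ℤ, ∀ n, N ≤ n → YPz M₁ M₂ z v n lam = 0 := by
  have hv : v ∈ ⨆ i, 𝒱.va.base.wt i := by
    rw [𝒱.va.base.wt_grading.2]; trivial
  induction hv using Submodule.iSup_induction' with
  | zero => exact ⟨0, fun n _ => by simp⟩
  | add v v' _ _ hv hv' =>
    obtain ⟨N, hN⟩ := hv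
    obtain ⟨N', hN'⟩ := hv'
    refine ⟨max N N', fun n hn => ?_⟩
    rw [map_add, Pi.add_apply, LinearMap.add_apply, hN n (by omega), hN' n (by omega), add_zero]
  | mem h v hv =>
    obtain ⟨K, hK⟩ := exists_Lpd_eq_zero 𝒱 v
    choose N hN using fun k : ℕ => sgT_truncated hlam (𝒱.va.Lpd k v)
    have hev : ∀ᶠ n : ℤ in Filter.atTop, ∀ k ∈ Finset.range K, 2 * h - 2 - (k : ℤ) - n ≤ N k := by
      refine (Filter.eventually_all_finset _).mpr fun k _ => ?_
      filter_upwards [Filter.eventually_ge_atTop (2 * h - 2 - (k : ℤ) - N k)] with n hn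
      omega
    obtain ⟨N₀, hN₀⟩ := Filter.eventually_atTop.mp hev
    refine ⟨N₀, fun n hn => ?_⟩
    rw [YPz_eq_sum M₁ M₂ z hv hK, LinearMap.sum_apply]
    refine Finset.sum_eq_zero fun k hk => ?_
    rw [LinearMap.smul_apply, hN k _ (hN₀ n hn k hk), smul_zero]

end Compatible

/-! ### Expansions of the kernel `(t - y) ^ l` near `y = z` -/

theorem sum_range_sum_range_eq_sum_antidiagonal {M : Type*} [AddCommMonoid M] (g : ℕ → ℕ → M)
    (I : ℕ) (hg : ∀ p i, I ≤ p + i → g p i = 0) :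
    ∑ i ∈ Finset.range I, ∑ p ∈ Finset.range I, g p i =
      ∑ j ∈ Finset.range I, ∑ r ∈ antidiagonal j, g r.1 r.2 := by
  rw [Finset.sum_comm, ← Finset.sum_product']
  rw [← Finset.sum_filter_of_ne (p := fun x : ℕ × ℕ => x.1 + x.2 < I) fun x _ hx => by
    by_contra h
    exact hx (hg _ _ (not_lt.mp h))]
  rw [← Finset.sum_fiberwise_of_maps_to (s := {x ∈ Finset.range I ×ˢ Finset.range I | x.1 + x.2 < I})
    (t := Finset.range I) (g := fun x : ℕ × ℕ => x.1 + x.2) fun x hx => by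
      simpa using (Finset.mem_filter.mp hx).2]
  refine Finset.sum_congr rfl fun j hj => Finset.sum_congr ?_ fun _ _ => rfl
  ext x
  simp only [Finset.mem_filter, Finset.mem_product, Finset.mem_range, mem_antidiagonal] at hj ⊢
  omega

theorem neg_zpow_eq (z : ℂ) (k : ℤ) : (-z) ^ k = (-1) ^ k * z ^ k := by
  rw [← mul_zpow, neg_one_mul]

/-- Both sides are the coefficient of `t ^ i` in the `j`-th Hasse derivative at `y = z` of `y ^ n (t
- y) ^ l`, expanded at `t = 0`: on the left one differentiates first, on the right one expands
first. -/
theorem sum_bin_expansion_zero {z : ℂ} (hz : z ≠ 0) (l n : ℤ) (i j : ℕ) :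
    ∑ r ∈ antidiagonal j, bin n r.1 * z ^ (n - r.1) * ((-1) ^ r.2 * bin l r.2) *
        (bin (l - r.2) i * (-z) ^ (l - r.2 - i)) =
      (-1) ^ l * (-1) ^ i * bin l i * (bin (n + l - i) j * z ^ (n + l - i - j)) := by
  rw [add_sub_assoc, bin_add, Finset.sum_mul, Finset.mul_sum]
  refine Finset.sum_congr rfl fun r hr => ?_
  have hr' : r.1 + r.2 = j := mem_antidiagonal.mp hr
  have h1 : (-1 : ℂ) ^ r.2 * (-1) ^ (l - r.2 - i) = (-1) ^ l * (-1) ^ i := by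
    have hne : (-1 : ℂ) ≠ 0 := by norm_num
    rw [zpow_sub₀ hne, zpow_sub₀ hne, zpow_natCast, zpow_natCast]
    have h2 : (-1 : ℂ) ^ i * (-1) ^ i = 1 := by rw [← mul_pow]; simp
    have h3 : (-1 : ℂ) ^ i ≠ 0 := pow_ne_zero _ hne
    have h4 : (-1 : ℂ) ^ r.2 ≠ 0 := pow_ne_zero _ hne
    field_simp
    rw [pow_two, h2]
  have h2 : z ^ (n + (l - i) - j) = z ^ (n - r.1) * z ^ (l - r.2 - i) := by
    rw [← zpow_add₀ hz]
    congr 1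
    omega
  have h3 := bin_mul_bin_comm l r.2 i
  rw [neg_zpow_eq, h2]
  linear_combination (bin n r.1 * z ^ (n - r.1) * z ^ (l - r.2 - i)) *
    ((bin l r.2 * bin (l - r.2) i) * h1 + (-1) ^ l * (-1) ^ i * h3)

/-- The same comparison at `t = ∞`, for the coefficient of `t ^ (l - i)`. -/
theorem sum_bin_expansion_infty {z : ℂ} (hz : z ≠ 0) (l n : ℤ) (i j : ℕ) :
    ∑ r ∈ antidiagonal j, bin n r.1 * z ^ (n - r.1) * ((-1) ^ r.2 * bin l r.2) *
        (if r.2 ≤ i then bin (l - r.2) (i - r.2) * (-z) ^ (i - r.2) else 0) =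
      (-1) ^ i * bin l i * (bin (n + i) j * z ^ (n + i - j)) := by
  rw [bin_add, Finset.sum_mul, Finset.mul_sum]
  refine Finset.sum_congr rfl fun r hr => ?_
  have hr' : r.1 + r.2 = j := mem_antidiagonal.mp hr
  rw [bin_natCast]
  split_ifs with h
  · obtain ⟨d, rfl⟩ := Nat.exists_eq_add_of_le h
    have h3 := bin_mul l r.2 d
    have h2 : z ^ (n + (r.2 + d : ℕ) - j) = z ^ (n - r.1) * z ^ d := by
      rw [← zpow_natCast, ← zpow_add₀ hz]
      congr 1
      push_cast
      omega
    rw [Nat.add_sub_cancel_left, h2, neg_pow z d, pow_add]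
    linear_combination (bin n r.1 * z ^ (n - r.1) * z ^ d * (-1) ^ r.2 * (-1) ^ d) * h3
  · rw [Nat.choose_eq_zero_of_lt (not_le.mp h)]
    simp

/-! ### The Jacobi identity for the opposite action -/

section Jacobi

variable {B : Type*} [AddCommGroup B] {A : AddSubgroup B}
  {V : Type*} [AddCommGroup V] [Module ℂ V] {𝒱 : StronglyGradedVertexAlgebra A V}
  {W₁ : Type*} [AddCommGroup W₁] [Module ℂ W₁] {W₂ : Type*} [AddCommGroup W₂] [Module ℂ W₂]
  {M₁ : GeneralizedModule 𝒱 W₁} {M₂ : GeneralizedModule 𝒱 W₂} {z : ℂ}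

theorem tau_pw {W : Type*} [AddCommGroup W] [Module ℂ W] (M : GeneralizedModule 𝒱 W) {v : V}
    {w : W} {c : ℂ} (hc : c ≠ 0) (q k : ℤ) {P : ℕ} (hP : ∀ n, k + P ≤ n → M.Y v n w = 0) :
    M.tau (v ⊗ₜ pw c q k) w =
      ∑ p ∈ Finset.range P, (bin q p * c ^ (q - p)) • M.Y v (k + p) w :=
  tauW_pw M.isModule.lowerTruncated hc q k hP

/-- The expansion at infinity, in `t`, of the Hasse derivatives at `y = z` of
`y ^ n t ^ m (t - y) ^ l`. -/
theorem sum_sgT_expansion_infty (hz : z ≠ 0) {lam : Module.Dual ℂ (W₁ ⊗[ℂ] W₂)} {u : V}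
    {N : ℤ} (hN : ∀ (q k : ℤ) (I : ℕ), q + k - I ≤ N → sgT M₁ M₂ z q k u lam =
      ∑ i ∈ Finset.range I, (bin k i * (-z) ^ i) • sgT M₁ M₂ z (q + k - i) 0 u lam)
    (l m n : ℤ) {I : ℕ} (hI : m + l - I ≤ N) {j : ℕ} (hj : j < I) :
    ∑ i ∈ Finset.range I, ((-1) ^ i * bin l i * (bin (n + i) j * z ^ (n + i - j))) •
        sgT M₁ M₂ z (m + l - i) 0 u lam =
      ∑ r ∈ antidiagonal j, (bin n r.1 * z ^ (n - r.1) * ((-1) ^ r.2 * bin l r.2)) •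
        sgT M₁ M₂ z m (l - r.2) u lam := by
  have e : ∀ r ∈ antidiagonal j, sgT M₁ M₂ z m (l - r.2) u lam = ∑ i ∈ Finset.range I,
      (if r.2 ≤ i then bin (l - r.2) (i - r.2) * (-z) ^ (i - r.2) else 0) •
        sgT M₁ M₂ z (m + l - i) 0 u lam := by
    intro r hr
    have hr' : r.1 + r.2 = j := mem_antidiagonal.mp hr
    -- The exponent of `t - z` has dropped by `r.2`, so the cutoff drops equally and the lowest
    -- power of `t` is unchanged; the subtraction is exact since `r.2 ≤ j < I`.
    rw [hN m (l - r.2) (I - r.2) (by omega)]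
    simp only [ite_smul, zero_smul]
    rw [← Finset.sum_filter]
    have hf : {i ∈ Finset.range I | r.2 ≤ i} = Finset.Ico r.2 I := by
      ext i
      simp only [Finset.mem_filter, Finset.mem_range, Finset.mem_Ico]
      omega
    rw [hf, Finset.sum_Ico_eq_sum_range]
    refine Finset.sum_congr rfl fun i _ => ?_
    rw [Nat.add_sub_cancel_left]
    congr 4
    push_cast
    ring
  symm
  rw [Finset.sum_congr rfl fun r hr => by rw [e r hr, Finset.smul_sum], Finset.sum_comm]
  refine Finset.sum_congr rfl fun i _ => ?_
  simp only [smul_smul]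
  rw [← Finset.sum_smul, sum_bin_expansion_infty hz]

/-- The value at `w₁ ⊗ w₂` of the composition of the actions of `u` and `v`, split according to
the factors on which `u` and `v` act. -/
theorem sum_sgT_sgT (hz : z ≠ 0) {lam : Module.Dual ℂ (W₁ ⊗[ℂ] W₂)} {u v : V} {w₁ : W₁} {w₂ : W₂}
    {N : ℤ} (hN : ∀ (q k : ℤ) (I : ℕ), q + k - I ≤ N → sgT M₁ M₂ z q k u lam =
      ∑ i ∈ Finset.range I, (bin k i * (-z) ^ i) • sgT M₁ M₂ z (q + k - i) 0 u lam)
    {l m n : ℤ} {I : ℕ} (hI : m + l - I ≤ N) (hv : ∀ j : ℤ, I ≤ j → M₁.Y v j w₁ = 0)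
    (hu : ∀ j : ℤ, m + I ≤ j → M₂.Y u j w₂ = 0) :
    ∑ i ∈ Finset.range I, ((-1) ^ i * bin l i) *
        sgT M₁ M₂ z (n + i) 0 v (sgT M₁ M₂ z (m + l - i) 0 u lam) (w₁ ⊗ₜ w₂) =
      ∑ i ∈ Finset.range I, ((-1) ^ i * bin l i) *
        lam (M₁.tau (u ⊗ₜ pw z m (l - i)) (M₁.tau (v ⊗ₜ pw z n i) w₁) ⊗ₜ w₂) +
      ∑ i ∈ Finset.range I, ((-1) ^ i * bin l i) *
        lam (w₁ ⊗ₜ M₂.Y u (m + l - i) (M₂.Y v (n + i) w₂)) +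
      ∑ i ∈ Finset.range I, ((-1) ^ i * bin l i) *
        lam (M₁.tau (u ⊗ₜ pw z (m + l - i) 0) w₁ ⊗ₜ M₂.Y v (n + i) w₂) +
      ∑ i ∈ Finset.range I, ((-1) ^ l * (-1) ^ i * bin l i) *
        lam (M₁.tau (v ⊗ₜ pw z (n + l - i) 0) w₁ ⊗ₜ M₂.Y u (m + i) w₂) := by
  have hexp : ∀ q : ℤ, M₁.tau (v ⊗ₜ pw z q 0) w₁ =
      ∑ j ∈ Finset.range I, (bin q j * z ^ (q - j)) • M₁.Y v j w₁ := by
    intro q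
    rw [tau_pw M₁ hz q 0 (P := I) fun j hj => hv j (by omega)]
    simp only [zero_add]
  -- the part in which `v` acts on `w₂`
  have h2 : ∀ i : ℕ, sgT M₁ M₂ z (n + i) 0 v (sgT M₁ M₂ z (m + l - i) 0 u lam) (w₁ ⊗ₜ w₂) =
      ∑ j ∈ Finset.range I, (bin (n + i) j * z ^ (n + i - j)) *
        sgT M₁ M₂ z (m + l - i) 0 u lam (M₁.Y v j w₁ ⊗ₜ w₂) +
      (lam (w₁ ⊗ₜ M₂.Y u (m + l - i) (M₂.Y v (n + i) w₂)) +
        lam (M₁.tau (u ⊗ₜ pw z (m + l - i) 0) w₁ ⊗ₜ M₂.Y v (n + i) w₂)) := by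
    intro i
    rw [sgT_apply, sg_zero_tmul, map_add, hexp, TensorProduct.sum_tmul, map_sum, sgT_apply,
      sg_zero_tmul, map_add, add_comm (lam (w₁ ⊗ₜ _))]
    congr 1
    refine Finset.sum_congr rfl fun j _ => ?_
    rw [← TensorProduct.smul_tmul', map_smul, smul_eq_mul]
  -- the part in which `v` acts on `w₁`
  have h1 : ∑ i ∈ Finset.range I, ((-1) ^ i * bin l i) *
      ∑ j ∈ Finset.range I, (bin (n + i) j * z ^ (n + i - j)) *
        sgT M₁ M₂ z (m + l - i) 0 u lam (M₁.Y v j w₁ ⊗ₜ w₂) =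
      ∑ j ∈ Finset.range I, ∑ r ∈ antidiagonal j,
        (bin n r.1 * z ^ (n - r.1) * ((-1) ^ r.2 * bin l r.2)) *
        (lam (M₁.tau (u ⊗ₜ pw z m (l - r.2)) (M₁.Y v j w₁) ⊗ₜ w₂) +
          lam (M₁.Y v j w₁ ⊗ₜ M₂.tau (u ⊗ₜ pw (-z) (l - r.2) m) w₂)) := by
    simp only [Finset.mul_sum]
    rw [Finset.sum_comm]
    refine Finset.sum_congr rfl fun j hj => ?_
    -- Compatibility enters here: the sum at infinity becomes the action of `t ^ m (t - z) ^ (l -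
    -- r.2)`, which splits into its action on `W₁` and on `W₂`.
    have h := LinearMap.congr_fun (sum_sgT_expansion_infty hz hN l m n hI (Finset.mem_range.mp hj))
      (M₁.Y v j w₁ ⊗ₜ w₂)
    simp only [LinearMap.sum_apply, LinearMap.smul_apply, smul_eq_mul] at h
    simp only [← mul_assoc] at h ⊢
    rw [h]
    refine Finset.sum_congr rfl fun r _ => ?_
    rw [sgT_apply, sg_tmul, map_add]
  -- Both on `W₁`: `t - y` is the difference of the two local variables at `z`, so the Taylor terms
  -- reassemble into the first product of the Jacobi identity of `W₁`.
  have h11 : ∑ j ∈ Finset.range I, ∑ r ∈ antidiagonal j,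
        (bin n r.1 * z ^ (n - r.1) * ((-1) ^ r.2 * bin l r.2)) *
        lam (M₁.tau (u ⊗ₜ pw z m (l - r.2)) (M₁.Y v j w₁) ⊗ₜ w₂) =
      ∑ i ∈ Finset.range I, ((-1) ^ i * bin l i) *
        lam (M₁.tau (u ⊗ₜ pw z m (l - i)) (M₁.tau (v ⊗ₜ pw z n i) w₁) ⊗ₜ w₂) := by
    have e := sum_range_sum_range_eq_sum_antidiagonal (fun p i : ℕ =>
      (bin n p * z ^ (n - p) * ((-1) ^ i * bin l i)) *
        lam (M₁.tau (u ⊗ₜ pw z m (l - i)) (M₁.Y v (i + p) w₁) ⊗ₜ w₂)) I fun p i hpi => by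
      rw [hv _ (by omega), map_zero, TensorProduct.zero_tmul, map_zero, mul_zero]
    refine Eq.trans ?_ (e.symm.trans ?_)
    · refine Finset.sum_congr rfl fun j _ => Finset.sum_congr rfl fun r hr => ?_
      have hr' : r.1 + r.2 = j := mem_antidiagonal.mp hr
      rw [show (j : ℤ) = r.2 + r.1 by omega]
    · refine Finset.sum_congr rfl fun i _ => ?_
      rw [tau_pw M₁ hz n i (P := I) fun j hj => hv j (by omega), map_sum, TensorProduct.sum_tmul,
        map_sum, Finset.mul_sum]
      refine Finset.sum_congr rfl fun p _ => ?_
      rw [map_smul, ← TensorProduct.smul_tmul', map_smul, smul_eq_mul]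
      ring
  -- Here `u` acts on `W₂`, so the kernel is expanded at `t = 0`. This yields the expansion
  -- belonging to the opposite order of the two operators, hence the factor `(-1) ^ l`.
  have h12 : ∑ j ∈ Finset.range I, ∑ r ∈ antidiagonal j,
        (bin n r.1 * z ^ (n - r.1) * ((-1) ^ r.2 * bin l r.2)) *
        lam (M₁.Y v j w₁ ⊗ₜ M₂.tau (u ⊗ₜ pw (-z) (l - r.2) m) w₂) =
      ∑ i ∈ Finset.range I, ((-1) ^ l * (-1) ^ i * bin l i) *
        lam (M₁.tau (v ⊗ₜ pw z (n + l - i) 0) w₁ ⊗ₜ M₂.Y u (m + i) w₂) := by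
    have e1 : ∀ i ∈ Finset.range I, ((-1) ^ l * (-1) ^ i * bin l i) *
        lam (M₁.tau (v ⊗ₜ pw z (n + l - i) 0) w₁ ⊗ₜ M₂.Y u (m + i) w₂) =
        ∑ j ∈ Finset.range I, ((-1) ^ l * (-1) ^ i * bin l i *
          (bin (n + l - i) j * z ^ (n + l - i - j))) *
            lam (M₁.Y v j w₁ ⊗ₜ M₂.Y u (m + i) w₂) := by
      intro i _
      rw [hexp, TensorProduct.sum_tmul, map_sum, Finset.mul_sum]
      refine Finset.sum_congr rfl fun j _ => ?_
      rw [← TensorProduct.smul_tmul', map_smul, smul_eq_mul]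
      ring
    rw [Finset.sum_congr rfl e1, Finset.sum_comm]
    refine Finset.sum_congr rfl fun j _ => ?_
    have e2 : ∀ r ∈ antidiagonal j,
        (bin n r.1 * z ^ (n - r.1) * ((-1) ^ r.2 * bin l r.2)) *
          lam (M₁.Y v j w₁ ⊗ₜ M₂.tau (u ⊗ₜ pw (-z) (l - r.2) m) w₂) =
        ∑ i ∈ Finset.range I, (bin n r.1 * z ^ (n - r.1) * ((-1) ^ r.2 * bin l r.2) *
          (bin (l - r.2) i * (-z) ^ (l - r.2 - i))) *
            lam (M₁.Y v j w₁ ⊗ₜ M₂.Y u (m + i) w₂) := by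
      intro r _
      rw [tau_pw M₂ (neg_ne_zero.mpr hz) (l - r.2) m hu, TensorProduct.tmul_sum, map_sum,
        Finset.mul_sum]
      refine Finset.sum_congr rfl fun i _ => ?_
      rw [TensorProduct.tmul_smul, map_smul, smul_eq_mul, ← mul_assoc]
    rw [Finset.sum_congr rfl e2, Finset.sum_comm]
    refine Finset.sum_congr rfl fun i _ => ?_
    rw [← Finset.sum_mul, sum_bin_expansion_zero hz]
  simp only [h2, mul_add, Finset.sum_add_distrib] at h1 ⊢
  rw [h1, h11, h12]
  ring

/-- The Jacobi identity for the opposite action on compatible functionals. -/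
theorem sgT_jacobi (hz : z ≠ 0) {lam : Module.Dual ℂ (W₁ ⊗[ℂ] W₂)}
    (hlam : lam ∈ compatible M₁ M₂ z) (u v : V) (l m n : ℤ) :
    (∑ᶠ i : ℕ, ((-1 : ℂ) ^ i * bin l i) •
        sgT M₁ M₂ z (n + i) 0 v (sgT M₁ M₂ z (m + l - i) 0 u lam))
      - (∑ᶠ i : ℕ, ((-1 : ℂ) ^ l * (-1 : ℂ) ^ i * bin l i) •
        sgT M₁ M₂ z (m + i) 0 u (sgT M₁ M₂ z (n + l - i) 0 v lam))
      = ∑ᶠ i : ℕ, bin m i • sgT M₁ M₂ z (m + n - i) 0 (𝒱.va.base.Y u (l + i) v) lam := by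
  obtain ⟨Nu, hNu, hu⟩ := mem_compatible.mp hlam u
  obtain ⟨Nv, hNv, hv⟩ := mem_compatible.mp hlam v
  simp only [sgFamily_apply] at hNu hu hNv hv
  obtain ⟨N, hN⟩ := 𝒱.va.base.lowerTruncated u v
  refine TensorProduct.ext' fun w₁ w₂ => ?_
  obtain ⟨a, ha⟩ := M₁.isModule.lowerTruncated u w₁
  obtain ⟨b, hb⟩ := M₁.isModule.lowerTruncated v w₁
  obtain ⟨c, hc⟩ := M₂.isModule.lowerTruncated u w₂
  obtain ⟨d, hd⟩ := M₂.isModule.lowerTruncated v w₂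
  -- One cutoff for all the sums: on `λ` at infinity, on `w₁`, on `w₂`, and for the modes of `u` on
  -- `v`.
  obtain ⟨I, h1, h2, h3, h4, h5, h6, h7⟩ : ∃ I : ℕ, m + l - I ≤ Nu ∧ n + l - I ≤ Nv ∧ N ≤ l + I ∧
      a ≤ I ∧ b ≤ I ∧ c ≤ m + I ∧ d ≤ n + I :=
    ⟨(m + l - Nu).toNat + (n + l - Nv).toNat + (N - l).toNat + a.toNat + b.toNat +
      (c - m).toNat + (d - n).toNat, by omega, by omega, by omega, by omega, by omega, by omega,
      by omega⟩
  have hI : ∀ i : ℕ, I ≤ i → 𝒱.va.base.Y u (l + i) v = 0 := fun i hi => hN _ (by omega)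
  rw [finsum_eq_sum_range _ I fun i hi => by rw [hNu _ (by omega), map_zero, smul_zero],
    finsum_eq_sum_range _ I fun i hi => by rw [hNv _ (by omega), map_zero, smul_zero],
    finsum_eq_sum_range _ I fun i hi => by
      rw [hI i hi, map_zero, LinearMap.zero_apply, smul_zero]]
  have e1 := sum_sgT_sgT hz (v := v) (w₁ := w₁) (w₂ := w₂) (n := n) hu h1
    (fun j hj => hb j (by omega)) (fun j hj => hc j (by omega))
  have e2 := sum_sgT_sgT hz (v := u) (w₁ := w₁) (w₂ := w₂) (n := m) hv h2
    (fun j hj => ha j (by omega)) (fun j hj => hd j (by omega))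
  have hsq : (-1 : ℂ) ^ l * (-1) ^ l = 1 := by rw [← mul_zpow]; simp
  -- After interchanging `u` and `v`, this factor gives the second product its sign; as its square
  -- is `1`, the mixed terms acquire the coefficients of those in `e1`.
  have e2' := congrArg ((-1 : ℂ) ^ l * ·) e2
  simp only [mul_add, Finset.mul_sum, ← mul_assoc, hsq, one_mul] at e2'
  have j1 := jacobiDefect_eq_zero M₁.isModule.lowerTruncated M₁.isModule.jacobi (l := l) (u := u)
    (v := v) (w := w₁) (I := I) (pw_coeff_of_lt hz m 0) (pw_coeff_of_lt hz n 0)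
    (fun j hj => ha j (by omega)) (fun j hj => hb j (by omega)) hI
  have j2 := jacobiDefect_eq_zero M₂.isModule.lowerTruncated M₂.isModule.jacobi (l := l) (u := u)
    (v := v) (w := w₂) (I := I) (pw_coeff_of_lt (neg_ne_zero.mpr hz) 0 m)
    (pw_coeff_of_lt (neg_ne_zero.mpr hz) 0 n)
    (fun j hj => hc j (by omega)) (fun j hj => hd j (by omega)) hI
  have k1 := congrArg (fun x => lam (x ⊗ₜ[ℂ] w₂)) j1
  have k2 := congrArg (fun x => lam (w₁ ⊗ₜ[ℂ] x)) j2
  have d1 : ∀ i : ℕ, LaurentSeries.hasseDeriv ℂ i (pw z m 0) * pw z n 0 =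
      bin m i • pw z (m + n - i) 0 := by
    intro i
    rw [hasseDeriv_pw hz, Finset.sum_eq_single_of_mem (i, 0) (mem_antidiagonal.mpr (add_zero i))]
    · rw [bin_zero_right, mul_one, laurent_smul_mul, pw_mul_pw, Nat.cast_zero, sub_zero, add_zero,
        show m - (i : ℤ) + n = m + n - i by ring]
    · rintro ⟨p, q⟩ hr hne
      obtain ⟨q, rfl⟩ : ∃ q', q = q' + 1 := by
        refine Nat.exists_eq_succ_of_ne_zero fun hb => hne ?_
        have : p + q = i := mem_antidiagonal.mp hr
        simp [hb] at this
        simp [this, hb]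
      rw [bin_zero_succ, mul_zero]
      exact zero_smul ℂ (pw z (m - p) (0 - (q + 1 : ℕ)))
  have d2 : ∀ i : ℕ, LaurentSeries.hasseDeriv ℂ i (HahnSeries.single m (1 : ℂ)) *
      HahnSeries.single n 1 = bin m i • HahnSeries.single (m + n - i) 1 := by
    intro i
    rw [LaurentSeries.hasseDeriv_single, HahnSeries.single_mul_single,
      show m - (i : ℤ) + n = m + n - i by ring, mul_one]
    ext j
    simp [bin, HahnSeries.coeff_single]
  have t1 : ∀ ξ, tauW M₁.Y M₁.isModule.lowerTruncated ξ = M₁.tau ξ := fun _ => rfl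
  have t2 : ∀ ξ, tauW M₂.Y M₂.isModule.lowerTruncated ξ = M₂.tau ξ := fun _ => rfl
  simp only [jacobiDefect, t1, t2, pw_zero_left, HahnSeries.single_mul_single, mul_one,
    single_mul_pw, add_zero, d1, d2, TensorProduct.tmul_smul, map_smul, tau_single,
    TensorProduct.sub_tmul, TensorProduct.tmul_sub, TensorProduct.sum_tmul,
    TensorProduct.tmul_sum, ← TensorProduct.smul_tmul', map_sub, map_sum, LinearMap.smul_apply,
    smul_eq_mul, TensorProduct.zero_tmul, TensorProduct.tmul_zero, map_zero] at k1 k2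
  simp only [show ∀ i : ℕ, l - (i : ℤ) + m = m + l - i from fun i => by ring,
    show ∀ i : ℕ, l - (i : ℤ) + n = n + l - i from fun i => by ring,
    show ∀ i : ℕ, (i : ℤ) + m = m + i from fun i => by ring,
    show ∀ i : ℕ, (i : ℤ) + n = n + i from fun i => by ring] at k2
  have r : ∀ i : ℕ, sgT M₁ M₂ z (m + n - i) 0 (𝒱.va.base.Y u (l + i) v) lam (w₁ ⊗ₜ w₂) =
      lam (M₁.tau (𝒱.va.base.Y u (l + i) v ⊗ₜ pw z (m + n - i) 0) w₁ ⊗ₜ w₂) +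
      lam (w₁ ⊗ₜ M₂.Y (𝒱.va.base.Y u (l + i) v) (m + n - i) w₂) := by
    intro i
    rw [sgT_apply, sg_zero_tmul, map_add]
  simp only [LinearMap.sub_apply, LinearMap.sum_apply, LinearMap.smul_apply, smul_eq_mul, r,
    mul_add, Finset.sum_add_distrib]
  rw [e1, e2']
  -- The mixed terms cancel in the difference, leaving the Jacobi identities of `W₁` and `W₂` paired
  -- with `λ`.
  linear_combination k1 + k2

end Jacobi

/-! ### From the opposite action to `Y'_{P(z)}` -/

theorem exists_uniform_bound {P : ℕ → ℕ → Prop} (K : ℕ) (h : ∀ a < K, ∃ N, ∀ i, N ≤ i → P a i) :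
    ∃ N, ∀ a < K, ∀ i, N ≤ i → P a i := by
  have h' : ∀ᶠ N in Filter.atTop, ∀ a ∈ Finset.range K, ∀ i, N ≤ i → P a i := by
    refine (Filter.eventually_all_finset _).mpr fun a ha => ?_
    obtain ⟨N, hN⟩ := h a (Finset.mem_range.mp ha)
    filter_upwards [Filter.eventually_ge_atTop N] with M hM i hi
    exact hN i (hM.trans hi)
  obtain ⟨N, hN⟩ := h'.exists
  exact ⟨N, fun a ha => hN a (Finset.mem_range.mpr ha)⟩

theorem sum_triple_antidiagonal {M : Type*} [AddCommMonoid M] (f : ℕ → ℕ → ℕ → M) (T : ℕ)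
    (hf : ∀ a s b, T ≤ a + s + b → f a s b = 0) :
    ∑ k ∈ Finset.range T, ∑ p ∈ antidiagonal k, ∑ r ∈ antidiagonal p.1, f r.1 r.2 p.2 =
      ∑ a ∈ Finset.range T, ∑ b ∈ Finset.range T, ∑ s ∈ Finset.range T, f a s b := by
  rw [← sum_range_sum_range_eq_sum_antidiagonal
    (fun j b => ∑ r ∈ antidiagonal j, f r.1 r.2 b) T fun j b hjb => ?_]
  · rw [Finset.sum_comm (s := Finset.range T) (f := fun a b => ∑ s ∈ Finset.range T, f a s b)]
    refine Finset.sum_congr rfl fun b _ => ?_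
    rw [← sum_range_sum_range_eq_sum_antidiagonal (fun a s => f a s b) T fun a s has =>
      hf a s b (by omega), Finset.sum_comm]
  · refine Finset.sum_eq_zero fun r hr => hf _ _ _ ?_
    have := mem_antidiagonal.mp hr
    omega

section JacobiYPz

variable {B : Type*} [AddCommGroup B] {A : AddSubgroup B}
  {V : Type*} [AddCommGroup V] [Module ℂ V] {𝒱 : StronglyGradedVertexAlgebra A V}
  {W₁ : Type*} [AddCommGroup W₁] [Module ℂ W₁] {W₂ : Type*} [AddCommGroup W₂] [Module ℂ W₂]
  {M₁ : GeneralizedModule 𝒱 W₁} {M₂ : GeneralizedModule 𝒱 W₂} {z : ℂ}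

/-- The Jacobi identity for the vectors `u`, `v`, applied to `w`. -/
def JacobiAt {V W : Type*} [AddCommGroup V] [Module ℂ V] [AddCommGroup W] [Module ℂ W]
    (YV : VOMap V V) (Y : VOMap V W) (u v : V) (w : W) : Prop :=
  ∀ l m n : ℤ,
    (∑ᶠ i : ℕ, ((-1 : ℂ) ^ i * bin l i) • Y u (m + l - i) (Y v (n + i) w))
      - (∑ᶠ i : ℕ, ((-1 : ℂ) ^ l * (-1 : ℂ) ^ i * bin l i) • Y v (n + l - i) (Y u (m + i) w))
      = ∑ᶠ i : ℕ, bin m i • Y (YV u (l + i) v) (m + n - i) w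

/-- Only finitely many divided powers of `L(1)` act nontrivially on `v`, so the bound can be chosen
independently of `b`. -/
theorem exists_sgT_bound {lam : Module.Dual ℂ (W₁ ⊗[ℂ] W₂)} (hlam : lam ∈ compatible M₁ M₂ z)
    (h n : ℤ) (v : V) : ∃ T : ℕ, ∀ b i : ℕ, T ≤ i →
      sgT M₁ M₂ z (2 * h - 2 - b - (n + i)) 0 (𝒱.va.Lpd b v) lam = 0 := by
  obtain ⟨K, hK⟩ := exists_Lpd_eq_zero 𝒱 v
  obtain ⟨T, hT⟩ := exists_uniform_bound (P := fun b i : ℕ =>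
      sgT M₁ M₂ z (2 * h - 2 - b - (n + i)) 0 (𝒱.va.Lpd b v) lam = 0) K fun b _ => by
    obtain ⟨N, hN⟩ := sgT_truncated hlam (𝒱.va.Lpd b v)
    exact ⟨(2 * h - 2 - b - n - N).toNat, fun i hi => hN _ (by omega)⟩
  refine ⟨T, fun b i hi => ?_⟩
  rcases lt_or_ge b K with hb | hb
  · exact hT b hb i hi
  · rw [hK b hb, map_zero, LinearMap.zero_apply]

theorem exists_mode_bound (𝒱 : StronglyGradedVertexAlgebra A V) (l : ℤ) (u v : V) :
    ∃ T : ℕ, ∀ a b i : ℕ, T ≤ i →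
      𝒱.va.base.Y (𝒱.va.Lpd a u) (l + i) (𝒱.va.Lpd b v) = 0 := by
  obtain ⟨K, hK⟩ := exists_Lpd_eq_zero 𝒱 u
  obtain ⟨K', hK'⟩ := exists_Lpd_eq_zero 𝒱 v
  obtain ⟨T, hT⟩ := exists_uniform_bound (P := fun a i : ℕ => ∀ b < K',
      𝒱.va.base.Y (𝒱.va.Lpd a u) (l + i) (𝒱.va.Lpd b v) = 0) K fun a _ => by
    obtain ⟨T, hT⟩ := exists_uniform_bound (P := fun b i : ℕ =>
      𝒱.va.base.Y (𝒱.va.Lpd a u) (l + i) (𝒱.va.Lpd b v) = 0) K' fun b _ => by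
      obtain ⟨N, hN⟩ := 𝒱.va.base.lowerTruncated (𝒱.va.Lpd a u) (𝒱.va.Lpd b v)
      exact ⟨(N - l).toNat, fun i hi => hN _ (by omega)⟩
    exact ⟨T, fun i hi b hb => hT b hb i hi⟩
  refine ⟨T, fun a b i hi => ?_⟩
  rcases lt_or_ge a K with ha | ha
  · rcases lt_or_ge b K' with hb | hb
    · exact hT a ha i hi b hb
    · rw [hK' b hb, map_zero]
  · rw [hK a ha, map_zero, Pi.zero_apply, LinearMap.zero_apply]

theorem neg_one_zpow_weight (h h' l : ℤ) (i : ℕ) :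
    (-1 : ℂ) ^ (h + h' - l - i - 1) =
      -((-1 : ℂ) ^ h * (-1) ^ h' * (-1) ^ l * (-1) ^ i) := by
  have hne : (-1 : ℂ) ≠ 0 := by norm_num
  have hinv : ∀ k : ℤ, (-1 : ℂ) ^ (-k) = (-1) ^ k := fun k => by rw [zpow_neg, ← inv_zpow]; norm_num
  rw [show h + h' - l - i - 1 = h + h' + -l + -(i : ℤ) + -1 by ring, zpow_add₀ hne, zpow_add₀ hne,
    zpow_add₀ hne, zpow_add₀ hne, hinv, hinv, hinv, zpow_natCast, zpow_one]
  ring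

/-- Each side is a double sum over the divided powers `a` on `u` and `b` on `v`. For fixed `a`, `b`
it is `-(-1) ^ (h + h' + l)` times an instance of `sgT_jacobi`; `Lpd_mode` is what writes `(u_{l+i}
v)ᵒ` in the same terms. -/
theorem YPz_jacobi_of_mem_wt (hz : z ≠ 0) {lam : Module.Dual ℂ (W₁ ⊗[ℂ] W₂)}
    (hlam : lam ∈ compatible M₁ M₂ z) {h h' : ℤ} {u v : V} (hu : u ∈ 𝒱.va.base.wt h)
    (hv : v ∈ 𝒱.va.base.wt h') : JacobiAt 𝒱.va.base.Y (YPz M₁ M₂ z) u v lam := by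
  intro l m n
  obtain ⟨T₁, hT₁⟩ := exists_Lpd_eq_zero 𝒱 u
  obtain ⟨T₂, hT₂⟩ := exists_Lpd_eq_zero 𝒱 v
  obtain ⟨T₃, hT₃⟩ := exists_sgT_bound hlam h m u
  obtain ⟨T₄, hT₄⟩ := exists_sgT_bound hlam h' n v
  obtain ⟨T₅, hT₅⟩ := exists_mode_bound 𝒱 l u v
  obtain ⟨T, hT⟩ : ∃ T, T = T₁ + T₂ + T₃ + T₄ + T₅ := ⟨_, rfl⟩
  have hU : ∀ k, T ≤ k → 𝒱.va.Lpd k u = 0 := fun k hk => hT₁ k (by omega)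
  have hV : ∀ k, T ≤ k → 𝒱.va.Lpd k v = 0 := fun k hk => hT₂ k (by omega)
  have hYu : ∀ k : ℤ, YPz M₁ M₂ z u k = ∑ a ∈ Finset.range T, (-1 : ℂ) ^ h •
      sgT M₁ M₂ z (2 * h - 2 - a - k) 0 (𝒱.va.Lpd a u) := YPz_eq_sum M₁ M₂ z hu hU
  have hYv : ∀ k : ℤ, YPz M₁ M₂ z v k = ∑ b ∈ Finset.range T, (-1 : ℂ) ^ h' •
      sgT M₁ M₂ z (2 * h' - 2 - b - k) 0 (𝒱.va.Lpd b v) := YPz_eq_sum M₁ M₂ z hv hV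
  -- the components of `L(1)ᵏ / k!` applied to `u_{l+i} v`
  have hmode : ∀ i k : ℕ, 𝒱.va.Lpd k (𝒱.va.base.Y u (l + i) v) =
      ∑ p ∈ antidiagonal k, ∑ r ∈ antidiagonal p.1, bin (2 * h - 2 - (l + i) - r.1) r.2 •
        𝒱.va.base.Y (𝒱.va.Lpd r.1 u) (l + (i + r.2 : ℕ)) (𝒱.va.Lpd p.2 v) := by
    intro i k
    rw [MobiusOrConformal.Lpd_mode hu]
    refine Finset.sum_congr rfl fun p _ => ?_
    rw [MobiusOrConformal.conjMode, LinearMap.sum_apply]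
    refine Finset.sum_congr rfl fun r _ => ?_
    rw [LinearMap.smul_apply]
    push_cast
    rw [add_assoc]
  have hvan : ∀ a s b i : ℕ, T ≤ a + s + b →
      𝒱.va.base.Y (𝒱.va.Lpd a u) (l + (i + s : ℕ)) (𝒱.va.Lpd b v) = 0 := by
    intro a s b i hasb
    rcases le_or_gt T₁ a with ha | ha
    · rw [hT₁ a ha, map_zero, Pi.zero_apply, LinearMap.zero_apply]
    rcases le_or_gt T₂ b with hb | hb
    · rw [hT₂ b hb, map_zero]
    · exact hT₅ a b _ (by omega)
  have hx : ∀ i k : ℕ, T ≤ k → 𝒱.va.Lpd k (𝒱.va.base.Y u (l + i) v) = 0 := by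
    intro i k hk
    rw [hmode]
    refine Finset.sum_eq_zero fun p hp => Finset.sum_eq_zero fun r hr => ?_
    have hp' := mem_antidiagonal.mp hp
    have hr' := mem_antidiagonal.mp hr
    rw [hvan _ _ _ _ (by omega), smul_zero]
  have hx0 : ∀ i : ℕ, T ≤ i → 𝒱.va.base.Y u (l + i) v = 0 := by
    intro i hi
    have := hT₅ 0 0 i (by omega)
    simpa using this
  let H : ℕ → ℕ → ℕ → Module.Dual ℂ (W₁ ⊗[ℂ] W₂) := fun a b j =>
    sgT M₁ M₂ z ((2 * h - 2 - a - m - l) + (2 * h' - 2 - b - n - l) - j) 0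
      (𝒱.va.base.Y (𝒱.va.Lpd a u) (l + j) (𝒱.va.Lpd b v)) lam
  -- the Jacobi identity for the opposite action
  have hjac : ∀ a b : ℕ,
      ∑ i ∈ Finset.range T, ((-1 : ℂ) ^ i * bin l i) •
        sgT M₁ M₂ z (2 * h' - 2 - b - (n + l - i)) 0 (𝒱.va.Lpd b v)
          (sgT M₁ M₂ z (2 * h - 2 - a - (m + i)) 0 (𝒱.va.Lpd a u) lam) -
      ∑ i ∈ Finset.range T, ((-1 : ℂ) ^ l * (-1 : ℂ) ^ i * bin l i) •
        sgT M₁ M₂ z (2 * h - 2 - a - (m + l - i)) 0 (𝒱.va.Lpd a u)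
          (sgT M₁ M₂ z (2 * h' - 2 - b - (n + i)) 0 (𝒱.va.Lpd b v) lam) =
      ∑ j ∈ Finset.range T, bin (2 * h - 2 - a - m - l) j • H a b j := by
    intro a b
    -- The extra `-l` in both indices makes the first product here correspond to the second product
    -- of the target and conversely; this explains the factor `-(-1) ^ l`.
    have := sgT_jacobi hz hlam (𝒱.va.Lpd a u) (𝒱.va.Lpd b v) l (2 * h - 2 - a - m - l)
      (2 * h' - 2 - b - n - l)
    have i1 : ∀ i : ℕ, 2 * h' - 2 - b - n - l + (i : ℤ) = 2 * h' - 2 - b - (n + l - i) :=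
      fun i => by ring
    have i2 : ∀ i : ℕ, 2 * h - 2 - a - m - l + l - (i : ℤ) = 2 * h - 2 - a - (m + i) :=
      fun i => by ring
    have i3 : ∀ i : ℕ, 2 * h - 2 - a - m - l + (i : ℤ) = 2 * h - 2 - a - (m + l - i) :=
      fun i => by ring
    have i4 : ∀ i : ℕ, 2 * h' - 2 - b - n - l + l - (i : ℤ) = 2 * h' - 2 - b - (n + i) :=
      fun i => by ring
    simp only [i1, i2, i3, i4] at this
    rw [finsum_eq_sum_range _ T fun i hi => by rw [hT₃ a i (by omega), map_zero, smul_zero],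
      finsum_eq_sum_range _ T fun i hi => by rw [hT₄ b i (by omega), map_zero, smul_zero],
      finsum_eq_sum_range _ T fun i hi => by
        rw [hT₅ a b i (by omega), map_zero, LinearMap.zero_apply, smul_zero]] at this
    exact this
  have hYvT : ∀ i : ℕ, T ≤ i → YPz M₁ M₂ z v (n + i) lam = 0 := by
    intro i hi
    rw [hYv, LinearMap.sum_apply]
    exact Finset.sum_eq_zero fun b _ => by
      rw [LinearMap.smul_apply, hT₄ b i (by omega), smul_zero]
  have hYuT : ∀ i : ℕ, T ≤ i → YPz M₁ M₂ z u (m + i) lam = 0 := by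
    intro i hi
    rw [hYu, LinearMap.sum_apply]
    exact Finset.sum_eq_zero fun b _ => by
      rw [LinearMap.smul_apply, hT₃ b i (by omega), smul_zero]
  rw [finsum_eq_sum_range _ T fun i hi => by rw [hYvT i hi, map_zero, smul_zero],
    finsum_eq_sum_range _ T fun i hi => by rw [hYuT i hi, map_zero, smul_zero],
    finsum_eq_sum_range _ T fun i hi => by
      rw [hx0 i hi, map_zero, Pi.zero_apply, LinearMap.zero_apply, smul_zero]]
  have hsq : (-1 : ℂ) ^ l * (-1) ^ l = 1 := by rw [← mul_zpow]; simp
  -- the right-hand side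
  have hR : ∑ i ∈ Finset.range T, bin m i •
      YPz M₁ M₂ z (𝒱.va.base.Y u (l + i) v) (m + n - i) lam =
      ∑ a ∈ Finset.range T, ∑ b ∈ Finset.range T, -((-1 : ℂ) ^ h * (-1) ^ h' * (-1) ^ l) •
        ∑ j ∈ Finset.range T, bin (2 * h - 2 - a - m - l) j • H a b j := by
    have e1 : ∀ i : ℕ, YPz M₁ M₂ z (𝒱.va.base.Y u (l + i) v) (m + n - i) lam =
        ∑ a ∈ Finset.range T, ∑ b ∈ Finset.range T, ∑ s ∈ Finset.range T,
          (-((-1 : ℂ) ^ h * (-1) ^ h' * (-1) ^ l * (-1) ^ i) * bin (2 * h - 2 - (l + i) - a) s) •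
            H a b (i + s) := by
      intro i
      rw [← sum_triple_antidiagonal (fun a s b =>
        (-((-1 : ℂ) ^ h * (-1) ^ h' * (-1) ^ l * (-1) ^ i) * bin (2 * h - 2 - (l + i) - a) s) •
            H a b (i + s)) T fun a s b hasb => by
          simp only [H]
          rw [hvan a s b i hasb, map_zero, LinearMap.zero_apply, smul_zero],
        YPz_eq_sum M₁ M₂ z (MobiusOrConformal.mode_mem_wt hu hv (l + i)) (hx i),
        LinearMap.sum_apply]
      refine Finset.sum_congr rfl fun k _ => ?_
      rw [hmode, LinearMap.smul_apply, map_sum, LinearMap.sum_apply, Finset.smul_sum]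
      refine Finset.sum_congr rfl fun p hp => ?_
      rw [map_sum, LinearMap.sum_apply, Finset.smul_sum]
      refine Finset.sum_congr rfl fun r hr => ?_
      have hp' : p.1 + p.2 = k := mem_antidiagonal.mp hp
      have hr' : r.1 + r.2 = p.1 := mem_antidiagonal.mp hr
      rw [map_smul, LinearMap.smul_apply, smul_smul, ← sub_sub, neg_one_zpow_weight]
      simp only [H]
      congr 4
      push_cast
      omega
    -- The sign `(-1) ^ i` comes from the weight `h + h' - l - i - 1` of `u_{l+i} v`. The summand
    -- `H` depends only on `i + s`, so the sum over each antidiagonal collapses by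
    -- `bin_sub_alternating`.
    have e2 : ∀ a b : ℕ, ∑ i ∈ Finset.range T, ∑ s ∈ Finset.range T,
        (bin m i * (-((-1 : ℂ) ^ h * (-1) ^ h' * (-1) ^ l * (-1) ^ i) *
          bin (2 * h - 2 - (l + i) - a) s)) • H a b (i + s) =
        -((-1 : ℂ) ^ h * (-1) ^ h' * (-1) ^ l) •
        ∑ j ∈ Finset.range T, bin (2 * h - 2 - a - m - l) j • H a b j := by
      intro a b
      rw [Finset.sum_comm, sum_range_sum_range_eq_sum_antidiagonal (fun i s : ℕ =>
        (bin m i * (-((-1 : ℂ) ^ h * (-1) ^ h' * (-1) ^ l * (-1) ^ i) *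
          bin (2 * h - 2 - (l + i) - a) s)) • H a b (i + s)) T fun i s his => by
          simp only [H]
          rw [hT₅ a b (i + s) (by omega), map_zero, LinearMap.zero_apply, smul_zero],
        Finset.smul_sum]
      refine Finset.sum_congr rfl fun j _ => ?_
      rw [show 2 * h - 2 - a - m - l = 2 * h - 2 - a - l - m by ring, bin_sub_alternating, smul_smul,
        Finset.mul_sum, Finset.sum_smul]
      refine Finset.sum_congr rfl fun r hr => ?_
      have hr' : r.1 + r.2 = j := mem_antidiagonal.mp hr
      rw [hr', show 2 * h - 2 - (l + (r.1 : ℤ)) - a = 2 * h - 2 - a - l - r.1 by ring]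
      congr 1
      ring
    simp only [e1, Finset.smul_sum, smul_smul]
    rw [Finset.sum_comm]
    refine Finset.sum_congr rfl fun a _ => ?_
    rw [Finset.sum_comm]
    refine Finset.sum_congr rfl fun b _ => ?_
    rw [e2, Finset.smul_sum]
    simp only [smul_smul]
  rw [hR]
  -- the left-hand side
  have hL1 : ∀ i : ℕ, YPz M₁ M₂ z u (m + l - i) (YPz M₁ M₂ z v (n + i) lam) =
      ∑ a ∈ Finset.range T, ∑ b ∈ Finset.range T, ((-1 : ℂ) ^ h * (-1) ^ h') •
        sgT M₁ M₂ z (2 * h - 2 - a - (m + l - i)) 0 (𝒱.va.Lpd a u)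
          (sgT M₁ M₂ z (2 * h' - 2 - b - (n + i)) 0 (𝒱.va.Lpd b v) lam) := by
    intro i
    simp only [hYu, hYv, LinearMap.sum_apply, LinearMap.smul_apply, map_sum, map_smul,
      Finset.smul_sum, smul_smul]
    rw [Finset.sum_comm]
    simp only [mul_comm ((-1 : ℂ) ^ h')]
  have hL2 : ∀ i : ℕ, YPz M₁ M₂ z v (n + l - i) (YPz M₁ M₂ z u (m + i) lam) =
      ∑ a ∈ Finset.range T, ∑ b ∈ Finset.range T, ((-1 : ℂ) ^ h * (-1) ^ h') •
        sgT M₁ M₂ z (2 * h' - 2 - b - (n + l - i)) 0 (𝒱.va.Lpd b v)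
          (sgT M₁ M₂ z (2 * h - 2 - a - (m + i)) 0 (𝒱.va.Lpd a u) lam) := by
    intro i
    simp only [hYu, hYv, LinearMap.sum_apply, LinearMap.smul_apply, map_sum, map_smul,
      Finset.smul_sum, smul_smul]
  simp only [hL1, hL2, Finset.smul_sum, ← hjac]
  have rot : ∀ f : ℕ → ℕ → ℕ → Module.Dual ℂ (W₁ ⊗[ℂ] W₂),
      ∑ i ∈ Finset.range T, ∑ a ∈ Finset.range T, ∑ b ∈ Finset.range T, f i a b =
      ∑ a ∈ Finset.range T, ∑ b ∈ Finset.range T, ∑ i ∈ Finset.range T, f i a b := by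
    intro f
    rw [Finset.sum_comm]
    exact Finset.sum_congr rfl fun a _ => Finset.sum_comm
  refine (congrArg₂ (· - ·) (rot _) (rot _)).trans ?_
  simp only [← Finset.sum_sub_distrib]
  refine Finset.sum_congr rfl fun a _ => Finset.sum_congr rfl fun b _ => ?_
  rw [Finset.smul_sum]
  refine Finset.sum_congr rfl fun i _ => ?_
  rw [smul_sub]
  simp only [smul_smul]
  have s1 : -((-1 : ℂ) ^ h * (-1) ^ h' * (-1) ^ l) * ((-1) ^ l * (-1) ^ i * bin l i) =
      -((-1) ^ i * bin l i * ((-1 : ℂ) ^ h * (-1) ^ h')) := by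
    generalize (-1 : ℂ) ^ l = x at hsq ⊢
    linear_combination (-((-1 : ℂ) ^ h * (-1) ^ h' * (-1) ^ i * bin l i)) * hsq
  rw [s1]
  module

theorem finite_support_smul_of_truncated {M : Type*} [AddCommGroup M] [Module ℂ M] (c : ℕ → ℂ)
    (f : ℕ → M) (hf : ∃ N : ℤ, ∀ i : ℕ, N ≤ i → f i = 0) :
    (Function.support fun i => c i • f i).Finite := by
  obtain ⟨N, hN⟩ := hf
  refine (Set.finite_Iio N.toNat).subset fun i hi => ?_
  by_contra h
  exact hi (by
    simp only [Set.mem_Iio, not_lt] at h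
    simp only [hN i (by omega), smul_zero])

/-- The Jacobi identity for `YPz` on the compatible functionals. -/
theorem YPz_jacobi (hz : z ≠ 0) {lam : Module.Dual ℂ (W₁ ⊗[ℂ] W₂)}
    (hlam : lam ∈ compatible M₁ M₂ z) (u v : V) :
    JacobiAt 𝒱.va.base.Y (YPz M₁ M₂ z) u v lam := by
  have s1 : ∀ (u v : V) (c : ℕ → ℂ) (k n : ℤ), (Function.support fun i : ℕ =>
      c i • YPz M₁ M₂ z u (k - i) (YPz M₁ M₂ z v (n + i) lam)).Finite := by
    intro u v c k n
    obtain ⟨N, hN⟩ := YPz_truncated hlam v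
    exact finite_support_smul_of_truncated c _ ⟨N - n, fun i hi => by rw [hN _ (by omega), map_zero]⟩
  have s2 : ∀ (u v : V) (c : ℕ → ℂ) (l k : ℤ), (Function.support fun i : ℕ =>
      c i • YPz M₁ M₂ z (𝒱.va.base.Y u (l + i) v) (k - i) lam).Finite := by
    intro u v c l k
    obtain ⟨N, hN⟩ := 𝒱.va.base.lowerTruncated u v
    exact finite_support_smul_of_truncated c _ ⟨N - l, fun i hi => by
      rw [hN _ (by omega), map_zero, Pi.zero_apply, LinearMap.zero_apply]⟩
  have zero_left : ∀ v, JacobiAt 𝒱.va.base.Y (YPz M₁ M₂ z) 0 v lam := by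
    intro v l m n
    simp only [map_zero, Pi.zero_apply, LinearMap.zero_apply, smul_zero, finsum_zero, sub_zero]
  have zero_right : ∀ u, JacobiAt 𝒱.va.base.Y (YPz M₁ M₂ z) u 0 lam := by
    intro v l m n
    simp only [map_zero, Pi.zero_apply, LinearMap.zero_apply, smul_zero, finsum_zero, sub_zero]
  have add_left : ∀ u u' v, JacobiAt 𝒱.va.base.Y (YPz M₁ M₂ z) u v lam →
      JacobiAt 𝒱.va.base.Y (YPz M₁ M₂ z) u' v lam →
      JacobiAt 𝒱.va.base.Y (YPz M₁ M₂ z) (u + u') v lam := by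
    intro u u' v h h' l m n
    simp only [map_add, Pi.add_apply, LinearMap.add_apply, smul_add]
    rw [finsum_add_distrib (s1 _ _ _ _ _) (s1 _ _ _ _ _),
      finsum_add_distrib (s1 _ _ _ _ _) (s1 _ _ _ _ _),
      finsum_add_distrib (s2 _ _ _ _ _) (s2 _ _ _ _ _), ← h l m n, ← h' l m n]
    abel
  have add_right : ∀ u v v', JacobiAt 𝒱.va.base.Y (YPz M₁ M₂ z) u v lam →
      JacobiAt 𝒱.va.base.Y (YPz M₁ M₂ z) u v' lam →
      JacobiAt 𝒱.va.base.Y (YPz M₁ M₂ z) u (v + v') lam := by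
    intro u v v' h h' l m n
    simp only [map_add, Pi.add_apply, LinearMap.add_apply, smul_add]
    rw [finsum_add_distrib (s1 _ _ _ _ _) (s1 _ _ _ _ _),
      finsum_add_distrib (s1 _ _ _ _ _) (s1 _ _ _ _ _),
      finsum_add_distrib (s2 _ _ _ _ _) (s2 _ _ _ _ _), ← h l m n, ← h' l m n]
    abel
  have hspan : ∀ w : V, w ∈ ⨆ n, 𝒱.va.base.wt n := fun w => by
    rw [𝒱.va.base.wt_grading.2]; trivial
  refine Submodule.iSup_induction _ (motive := fun u => JacobiAt 𝒱.va.base.Y (YPz M₁ M₂ z) u v lam)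
    (hspan u) (fun h u hu => ?_) (zero_left v) (fun u u' => add_left u u' v)
  exact Submodule.iSup_induction _
    (motive := fun v => JacobiAt 𝒱.va.base.Y (YPz M₁ M₂ z) u v lam)
    (hspan v) (fun h' v hv => YPz_jacobi_of_mem_wt hz hlam hu hv) (zero_right u)
    (fun v v' => add_right u v v')

end JacobiYPz

/-! ### Commutators with `L(-1)`, `L(0)`, `L(1)` on `W₁ ⊗ W₂` -/

section ModuleSymmetry

variable {V W : Type*} [AddCommGroup V] [Module ℂ V] [AddCommGroup W] [Module ℂ W]
  {U : MobiusOrConformal V} {Y : VOMap V W} {L : Sl2Ops W}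

theorem MobiusOrConformal.ModuleSymmetry.sl2Commutators (sym : U.ModuleSymmetry Y L)
    (jac : JacobiIdentity U.base.Y Y) : Sl2Commutators U.L Y L := by
  cases U with
  | mobius M => exact sym.2
  | conformal C =>
    obtain ⟨rfl, -⟩ := sym
    exact JacobiIdentity.sl2Commutators jac C.ω

theorem VirasoroRelations.isSl2Rep {c : ℂ} {ω : V}
    (vir : VirasoroRelations c fun n => Y ω (n + 1)) : IsSl2Rep (conformalOps ω Y) := by
  have h1 := vir 0 (-1)
  have h2 := vir 0 1
  have h3 := vir (-1) 1
  norm_num at h1 h2 h3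
  exact ⟨h1, h2, h3.trans (neg_smul _ _).symm⟩

theorem MobiusOrConformal.ModuleSymmetry.isSl2Rep (sym : U.ModuleSymmetry Y L) : IsSl2Rep L := by
  cases U with
  | mobius M => exact sym.1
  | conformal C =>
    obtain ⟨rfl, vir⟩ := sym
    exact vir.isSl2Rep

end ModuleSymmetry

section TauCommutator

variable {V W : Type*} [AddCommGroup V] [Module ℂ V] [AddCommGroup W] [Module ℂ W]
  {Y : VOMap V W} {hY : LowerTruncated Y}

theorem tauW_single_mul (v : V) (j : ℤ) (g : LaurentSeries ℂ) (w : W) :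
    tauW Y hY (v ⊗ₜ (HahnSeries.single j 1 * g)) w = ∑ᶠ n : ℤ, g.coeff n • Y v (n + j) w := by
  rw [tauW_tmul, ← finsum_comp_equiv (Equiv.addRight j)]
  refine finsum_congr fun n => ?_
  rw [Equiv.coe_addRight, HahnSeries.coeff_single_mul_add, one_mul]

theorem tauW_single_mul_support (hY : LowerTruncated Y) (v : V) (j : ℤ) (g : LaurentSeries ℂ) (w : W) :
    (Function.support fun n : ℤ => g.coeff n • Y v (n + j) w).Finite := by
  refine Set.Finite.of_finite_image (f := Equiv.addRight j) ?_ (Equiv.injective _).injOn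
  refine (tauW_support Y hY v (HahnSeries.single j 1 * g) w).subset ?_
  rintro _ ⟨n, hn, rfl⟩
  simpa [Equiv.coe_addRight, HahnSeries.coeff_single_mul_add] using hn

/-- A shift of the mode index by `j` is multiplication of the Laurent series by `t ^ j`; truncation
makes all sums finite, so they can be rearranged. -/
theorem tauW_lie {T : Module.End ℂ W} {v v₀ v₁ v₂ : V}
    (hT : ∀ n, ⁅T, Y v n⁆ = Y v₀ n + Y v₁ (n + 1) + Y v₂ (n + 2)) (g : LaurentSeries ℂ) :
    ⁅T, tauW Y hY (v ⊗ₜ g)⁆ = tauW Y hY (v₀ ⊗ₜ g) +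
      tauW Y hY (v₁ ⊗ₜ (HahnSeries.single 1 1 * g)) +
      tauW Y hY (v₂ ⊗ₜ (HahnSeries.single 2 1 * g)) := by
  ext w
  have h0 := tauW_support Y hY v₀ g w
  have h1 := tauW_single_mul_support hY v₁ 1 g w
  have h2 := tauW_single_mul_support hY v₂ 2 g w
  have hT' : ∀ n, g.coeff n • Y v₀ n w + g.coeff n • Y v₁ (n + 1) w +
      g.coeff n • Y v₂ (n + 2) w + g.coeff n • Y v n (T w) = T (g.coeff n • Y v n w) := by
    intro n
    have := LinearMap.congr_fun (hT n) w
    rw [Ring.lie_def, LinearMap.sub_apply, sub_eq_iff_eq_add] at this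
    rw [map_smul, ← Module.End.mul_apply T, this]
    simp only [LinearMap.add_apply, smul_add, Module.End.mul_apply]
  rw [Ring.lie_def, LinearMap.sub_apply, sub_eq_iff_eq_add, Module.End.mul_apply,
    Module.End.mul_apply, LinearMap.add_apply, LinearMap.add_apply, tauW_single_mul,
    tauW_single_mul, tauW_tmul, tauW_tmul, tauW_tmul, ← finsum_add_distrib h0 h1,
    ← finsum_add_distrib ((h0.union h1).subset (Function.support_add _ _)) h2,
    ← finsum_add_distrib ((((h0.union h1).subset (Function.support_add _ _)).union h2).subset
      (Function.support_add _ _)) (tauW_support Y hY v g (T w)), finsum_congr hT']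
  exact AddMonoidHom.map_finsum T.toAddMonoidHom (tauW_support Y hY v g w)

/-- Integration by parts: `L(-1)v ⊗ g` acts as `-v ⊗ g'`. The coefficients of `g'` are read off from
the first Hasse derivative. -/
theorem tauW_deriv_pw {Lneg : Module.End ℂ V} (hder : DerivativeProperty Lneg Y) {c : ℂ}
    (hc : c ≠ 0) (q : ℤ) (v : V) :
    tauW Y hY (Lneg v ⊗ₜ pw c q 0) = (-q : ℂ) • tauW Y hY (v ⊗ₜ pw c (q - 1) 0) := by
  ext w
  rw [LinearMap.smul_apply, tauW_tmul, tauW_tmul,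
    smul_finsum' _ (tauW_support Y hY v (pw c (q - 1) 0) w), ← finsum_comp_equiv (Equiv.addRight 1)]
  refine finsum_congr fun n => ?_
  have hcoef : (pw c q 0).coeff (n + 1) * (n + 1) = q * (pw c (q - 1) 0).coeff n := by
    have h := congrArg (fun x : LaurentSeries ℂ => x.coeff n) (hasseDeriv_pw hc q 0 1)
    simp only [LaurentSeries.hasseDeriv_coeff, Finset.Nat.antidiagonal_succ,
      Finset.Nat.antidiagonal_zero] at h
    simp [bin_zero_succ 0] at h
    linear_combination h
  rw [Equiv.coe_addRight, hder, LinearMap.smul_apply, smul_smul, smul_smul, add_sub_cancel_right]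
  congr 1
  push_cast
  linear_combination -hcoef

end TauCommutator

section EndCommutator

variable {W : Type*} [AddCommGroup W] [Module ℂ W] (a b c : Module.End ℂ W) (r : ℂ)

theorem end_add_lie : ⁅a + b, c⁆ = ⁅a, c⁆ + ⁅b, c⁆ := by
  simp only [Ring.lie_def, add_mul, mul_add]
  abel

theorem end_lie_add : ⁅a, b + c⁆ = ⁅a, b⁆ + ⁅a, c⁆ := by
  simp only [Ring.lie_def, add_mul, mul_add]
  abel

theorem end_smul_lie : ⁅r • a, b⁆ = r • ⁅a, b⁆ := by
  simp only [Ring.lie_def, smul_mul_assoc, mul_smul_comm, smul_sub]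

theorem end_lie_smul : ⁅a, r • b⁆ = r • ⁅a, b⁆ := by
  simp only [Ring.lie_def, smul_mul_assoc, mul_smul_comm, smul_sub]

theorem end_lie_self : ⁅a, a⁆ = 0 := sub_self _

theorem end_lie_neg_swap : ⁅a, b⁆ = -⁅b, a⁆ := (neg_sub _ _).symm

end EndCommutator

section TensorSl2

variable {B : Type*} [AddCommGroup B] {A : AddSubgroup B}
  {V : Type*} [AddCommGroup V] [Module ℂ V] {𝒱 : StronglyGradedVertexAlgebra A V}
  {W₁ : Type*} [AddCommGroup W₁] [Module ℂ W₁] {W₂ : Type*} [AddCommGroup W₂] [Module ℂ W₂]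
  (M₁ : GeneralizedModule 𝒱 W₁) (M₂ : GeneralizedModule 𝒱 W₂) (z : ℂ)

theorem GeneralizedModule.sl2Commutators {W : Type*} [AddCommGroup W] [Module ℂ W]
    (M : GeneralizedModule 𝒱 W) : Sl2Commutators 𝒱.va.L M.Y M.L :=
  M.isModule.symmetry.sl2Commutators M.isModule.jacobi

theorem GeneralizedModule.isSl2Rep {W : Type*} [AddCommGroup W] [Module ℂ W]
    (M : GeneralizedModule 𝒱 W) : IsSl2Rep M.L :=
  M.isModule.symmetry.isSl2Rep

theorem GeneralizedModule.tau_lie {W : Type*} [AddCommGroup W] [Module ℂ W]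
    (M : GeneralizedModule 𝒱 W) (v : V) (c : ℂ) (q k : ℤ) :
    ⁅M.L.Lneg, M.tau (v ⊗ₜ pw c q k)⁆ = M.tau (𝒱.va.L.Lneg v ⊗ₜ pw c q k) ∧
    ⁅M.L.Lzero, M.tau (v ⊗ₜ pw c q k)⁆ = M.tau (𝒱.va.L.Lzero v ⊗ₜ pw c q k) +
      M.tau (𝒱.va.L.Lneg v ⊗ₜ pw c q (k + 1)) ∧
    ⁅M.L.Lpos, M.tau (v ⊗ₜ pw c q k)⁆ = M.tau (𝒱.va.L.Lpos v ⊗ₜ pw c q k) +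
      (2 : ℂ) • M.tau (𝒱.va.L.Lzero v ⊗ₜ pw c q (k + 1)) +
      M.tau (𝒱.va.L.Lneg v ⊗ₜ pw c q (k + 2)) := by
  have h := M.sl2Commutators v
  refine ⟨?_, ?_, ?_⟩
  · refine (tauW_lie (v₀ := 𝒱.va.L.Lneg v) (v₁ := 0) (v₂ := 0) (fun n => ?_) _).trans ?_
    · simp [(h n).1]
    · simp only [TensorProduct.zero_tmul, map_zero, add_zero]
      rfl
  · refine (tauW_lie (v₀ := 𝒱.va.L.Lzero v) (v₁ := 𝒱.va.L.Lneg v) (v₂ := 0)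
      (fun n => ?_) _).trans ?_
    · simp [(h n).2.1]
    · simp only [TensorProduct.zero_tmul, map_zero, add_zero, single_mul_pw, add_comm (1 : ℤ)]
      rfl
  · refine (tauW_lie (v₀ := 𝒱.va.L.Lpos v) (v₁ := (2 : ℂ) • 𝒱.va.L.Lzero v)
      (v₂ := 𝒱.va.L.Lneg v) (fun n => ?_) _).trans ?_
    · simp [(h n).2.2]
    · simp only [single_mul_pw, add_comm (1 : ℤ), add_comm (2 : ℤ), ← TensorProduct.smul_tmul',
        map_smul]
      rfl

/-- The action of `𝔰𝔩(2)` on `W₁ ⊗ W₂` whose contragredient is `LPz`. -/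
def tensorSl2 : Sl2Ops (W₁ ⊗[ℂ] W₂) where
  Lneg := LinearMap.lTensor W₁ M₂.L.Lneg + LinearMap.rTensor W₂ M₁.L.Lneg
  Lzero := LinearMap.lTensor W₁ M₂.L.Lzero +
    LinearMap.rTensor W₂ (M₁.L.Lzero + z • M₁.L.Lneg)
  Lpos := LinearMap.lTensor W₁ M₂.L.Lpos +
    LinearMap.rTensor W₂ (M₁.L.Lpos + (2 * z) • M₁.L.Lzero + z ^ 2 • M₁.L.Lneg)

theorem lie_lTensor_add_rTensor (S S' : Module.End ℂ W₁) (T T' : Module.End ℂ W₂) :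
    ⁅LinearMap.lTensor W₁ T + LinearMap.rTensor W₂ S,
      LinearMap.lTensor W₁ T' + LinearMap.rTensor W₂ S'⁆ =
      LinearMap.lTensor W₁ ⁅T, T'⁆ + LinearMap.rTensor W₂ ⁅S, S'⁆ := by
  ext w₁ w₂
  simp only [Ring.lie_def, TensorProduct.AlgebraTensorModule.curry_apply,
    LinearMap.restrictScalars_self, TensorProduct.curry_apply, LinearMap.sub_apply,
    Module.End.mul_apply, LinearMap.add_apply, LinearMap.lTensor_tmul, LinearMap.rTensor_tmul,
    map_add, TensorProduct.tmul_sub, TensorProduct.sub_tmul]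
  abel

/-- On `W₁` the operators correspond to the vector fields `(t + z) ^ (j+1) d/dt` in place of `t ^
(j+1) d/dt`, and translation preserves brackets. -/
theorem tensorSl2_isSl2Rep : IsSl2Rep (tensorSl2 M₁ M₂ z) := by
  obtain ⟨a₁, b₁, c₁⟩ := M₁.isSl2Rep
  obtain ⟨a₂, b₂, c₂⟩ := M₂.isSl2Rep
  have a₁' : ⁅M₁.L.Lneg, M₁.L.Lzero⁆ = -M₁.L.Lneg := by rw [end_lie_neg_swap, a₁]
  refine ⟨?_, ?_, ?_⟩
  · refine (lie_lTensor_add_rTensor _ _ _ _).trans ?_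
    simp only [end_add_lie, end_smul_lie, a₁, a₂, end_lie_self, smul_zero, add_zero]
    rfl
  · refine (lie_lTensor_add_rTensor _ _ _ _).trans ?_
    simp only [end_add_lie, end_smul_lie, end_lie_add, end_lie_smul, a₁, b₁, c₁, a₁', b₂, end_lie_self, smul_zero,
      tensorSl2, neg_add_rev, ← LinearMap.lTensor_neg, ← LinearMap.rTensor_neg]
    rw [add_comm (LinearMap.rTensor W₂ _)]
    congr 2
    module
  · refine (lie_lTensor_add_rTensor _ _ _ _).trans ?_
    simp only [end_lie_add, end_lie_smul, c₁, a₁', c₂, end_lie_self, smul_zero, tensorSl2, smul_add,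
      ← LinearMap.lTensor_smul, ← LinearMap.rTensor_smul]
    congr 2
    module

variable {M₁ M₂ z}

/-- The factors combine because multiplication by the global `t` is multiplication by `t + z` on
`W₁` and by `t` on `W₂`; on `W₁` this is `pw_succ`. -/
theorem tensorSl2_lie_sg (v : V) (q k : ℤ) :
    ⁅(tensorSl2 M₁ M₂ z).Lneg, sg M₁ M₂ z q k v⁆ = sg M₁ M₂ z q k (𝒱.va.L.Lneg v) ∧
    ⁅(tensorSl2 M₁ M₂ z).Lzero, sg M₁ M₂ z q k v⁆ = sg M₁ M₂ z q k (𝒱.va.L.Lzero v) +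
      sg M₁ M₂ z (q + 1) k (𝒱.va.L.Lneg v) ∧
    ⁅(tensorSl2 M₁ M₂ z).Lpos, sg M₁ M₂ z q k v⁆ = sg M₁ M₂ z q k (𝒱.va.L.Lpos v) +
      (2 : ℂ) • sg M₁ M₂ z (q + 1) k (𝒱.va.L.Lzero v) +
      sg M₁ M₂ z (q + 2) k (𝒱.va.L.Lneg v) := by
  obtain ⟨a₁, b₁, c₁⟩ := M₁.tau_lie v z q k
  obtain ⟨a₂, b₂, c₂⟩ := M₂.tau_lie v (-z) k q
  have hq : q + 2 = q + 1 + 1 := by ring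
  have hk : k + 2 = k + 1 + 1 := by ring
  simp only [sg_apply, add_comm (LinearMap.rTensor W₂ _) (LinearMap.lTensor W₁ _)]
  refine ⟨?_, ?_, ?_⟩
  · refine (lie_lTensor_add_rTensor _ _ _ _).trans ?_
    rw [a₁, a₂]
  · refine (lie_lTensor_add_rTensor _ _ _ _).trans ?_
    simp only [end_add_lie, end_smul_lie, a₁, b₁, b₂, pw_succ, TensorProduct.tmul_add,
      TensorProduct.tmul_smul, map_add, map_smul, LinearMap.lTensor_add, LinearMap.rTensor_add,
      LinearMap.rTensor_smul]
    abel
  · refine (lie_lTensor_add_rTensor _ _ _ _).trans ?_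
    simp only [end_add_lie, end_smul_lie, a₁, b₁, c₁, c₂, hq, hk, pw_succ, TensorProduct.tmul_add,
      TensorProduct.tmul_smul, map_add, map_smul, LinearMap.lTensor_add, LinearMap.rTensor_add,
      LinearMap.rTensor_smul, LinearMap.lTensor_smul]
    module

theorem sg_Lneg (hz : z ≠ 0) (v : V) (q : ℤ) :
    sg M₁ M₂ z q 0 (𝒱.va.L.Lneg v) = (-q : ℂ) • sg M₁ M₂ z (q - 1) 0 v := by
  have h : M₁.tau (𝒱.va.L.Lneg v ⊗ₜ pw z q 0) = (-q : ℂ) • M₁.tau (v ⊗ₜ pw z (q - 1) 0) :=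
    tauW_deriv_pw M₁.isModule.deriv hz q v
  rw [sg_apply, sg_apply, h, pw_zero_left, pw_zero_left, tau_single, tau_single,
    M₂.isModule.deriv, LinearMap.rTensor_smul, LinearMap.lTensor_smul, smul_add]

/-- On `W₁` the vacuum extracts the residue of `(t + z) ^ q` at `0`, which vanishes since `z ≠ 0`.
-/
theorem sg_vac (hz : z ≠ 0) {q : ℤ} :
    sg M₁ M₂ z q 0 𝒱.va.base.vac =
      LinearMap.lTensor W₁ (M₂.Y 𝒱.va.base.vac q) := by
  have h : M₁.tau (𝒱.va.base.vac ⊗ₜ pw z q 0) = 0 := by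
    ext w
    refine (tauW_tmul _ _ _ _ _).trans (finsum_eq_zero_of_forall_eq_zero fun n => ?_)
    rw [M₁.isModule.vacuum]
    split_ifs with hn
    · rw [pw_coeff_of_lt hz _ _ _ (by omega), zero_smul]
    · rw [LinearMap.zero_apply, smul_zero]
  rw [sg_apply, h, LinearMap.rTensor_zero, zero_add, pw_zero_left, tau_single]

end TensorSl2

/-! ### The Virasoro relations from the Jacobi identity -/

section Virasoro

variable {V W : Type*} [AddCommGroup V] [Module ℂ V] [AddCommGroup W] [Module ℂ W]

/-- Here `ω = L(-2)𝟏`, and both `L(m)` and `L(m - 2)` kill the vacuum for `m ≥ 1`. So only the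
central term of `[L(m), L(-2)]` survives. -/
theorem ConformalVertexAlgebra.mode_omega_omega (C : ConformalVertexAlgebra V) (m : ℤ)
    (hm : 1 ≤ m) :
    C.Y C.ω (m + 1) C.ω = if m = 2 then (C.c / 2) • C.vac else 0 := by
  have h := LinearMap.congr_fun (C.virasoro m (-2)) C.vac
  have hv : ∀ k : ℤ, 0 ≤ k → C.Y C.ω k C.vac = 0 := (C.creation C.ω).1
  have hw : C.Y C.ω (-2 + 1) C.vac = C.ω := (C.creation C.ω).2
  simp only [Ring.lie_def, LinearMap.sub_apply, Module.End.mul_apply, LinearMap.add_apply,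
    LinearMap.smul_apply] at h
  rw [hw, hv (m + 1) (by omega), map_zero, sub_zero, hv (m + -2 + 1) (by omega), smul_zero,
    zero_add] at h
  rw [h]
  by_cases h2 : m = 2
  · subst h2
    norm_num
    congr 1
    ring
  · rw [if_neg (by omega), if_neg h2, LinearMap.zero_apply]

/-- The only possibly nonzero `ω_i ω` with `i ≥ 0` are `L(-1)ω`, `2ω` and `(c/2)𝟏` at `i = 0, 1, 3`.
The cubic central term is `binom(m + 1, 3)`, placed in mode `m + n - 1` of the vacuum. -/
theorem JacobiIdentity.virasoro (C : ConformalVertexAlgebra V) {Y : VOMap V W}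
    (jac : JacobiIdentity C.Y Y) (hvac : VacuumProperty C.vac Y) :
    VirasoroRelations C.c fun n => Y C.ω (n + 1) := by
  intro m n
  ext w
  have hder : DerivativeProperty (C.Y C.ω 0) Y :=
    MobiusOrConformal.derivative_of_jacobi (U := .conformal C) jac hvac
  have h1 : C.Y C.ω (1 : ℕ) C.ω = (2 : ℂ) • C.ω := by
    simpa using C.Lzero_wt 2 C.ω C.ω_mem
  have h2 : C.Y C.ω (2 : ℕ) C.ω = 0 := by simpa using C.mode_omega_omega 1 le_rfl
  have h3 : C.Y C.ω (3 : ℕ) C.ω = (C.c / 2) • C.vac := by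
    simpa using C.mode_omega_omega 2 (by norm_num)
  have h4 : ∀ i : ℕ, 4 ≤ i → C.Y C.ω i C.ω = 0 := fun i hi => by
    have := C.mode_omega_omega (i - 1) (by omega)
    rwa [sub_add_cancel, if_neg (by omega)] at this
  have hb2 := bin_mul_succ (m + 1) 1
  have hb3 := bin_mul_succ (m + 1) 2
  rw [bin_one_right] at hb2
  push_cast at hb2 hb3
  have hb3' : bin (m + 1) 3 = ((m : ℂ) ^ 3 - m) / 6 := by
    linear_combination hb3 / 3 + hb2 * (m - 1) / 6
  rw [jac.commutator, finsum_eq_sum_range _ 4 fun i hi => by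
    rw [h4 i hi, map_zero, Pi.zero_apply, LinearMap.zero_apply, smul_zero]]
  simp only [Finset.sum_range_succ, Finset.sum_range_zero, h1, h2, h3, bin_zero_right,
    bin_one_right, hb3']
  rw [Nat.cast_zero, hder]
  simp only [map_smul, map_zero, Pi.smul_apply, Pi.zero_apply, LinearMap.smul_apply,
    LinearMap.zero_apply, smul_zero, LinearMap.add_apply]
  rw [hvac, show m + 1 + (n + 1) - 0 - 1 = m + n + 1 by ring,
    show m + 1 + (n + 1) - ((1 : ℕ) : ℤ) = m + n + 1 by push_cast; ring]
  by_cases hmn : m + n = 0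
  · rw [if_pos hmn, if_pos (by push_cast; omega)]
    simp only [LinearMap.smul_apply, Module.End.one_apply]
    push_cast
    module
  · rw [if_neg hmn, if_neg (by push_cast; omega)]
    simp only [LinearMap.zero_apply]
    push_cast
    module

theorem MobiusOrConformal.moduleSymmetry (U : MobiusOrConformal V) {Y : VOMap V W} {L : Sl2Ops W}
    (jac : JacobiIdentity U.base.Y Y) (hvac : VacuumProperty U.base.vac Y) (rep : IsSl2Rep L)
    (comm : Sl2Commutators U.L Y L)
    (hconf : ∀ C, U = .conformal C → L = conformalOps C.ω Y) : U.ModuleSymmetry Y L := by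
  cases U with
  | mobius M => exact ⟨rep, comm⟩
  | conformal C => exact ⟨hconf C rfl, JacobiIdentity.virasoro C jac hvac⟩

theorem MobiusOrConformal.Lpd_eq_zero_of_Lpos {U : MobiusOrConformal V} {v : V}
    (hv : U.L.Lpos v = 0) (k : ℕ) (hk : 1 ≤ k) : U.Lpd k v = 0 := by
  obtain ⟨k, rfl⟩ : ∃ j, k = j + 1 := ⟨k - 1, by omega⟩
  have h := U.Lpd_Lpos k v
  rw [hv, map_zero] at h
  exact (smul_eq_zero.mp h.symm).resolve_left (by exact_mod_cast k.succ_ne_zero)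

end Virasoro

/-! ### `L'_{P(z)}(j)` as transposes -/

section Contragredient

variable {B : Type*} [AddCommGroup B] {A : AddSubgroup B}
  {V : Type*} [AddCommGroup V] [Module ℂ V] {𝒱 : StronglyGradedVertexAlgebra A V}
  {W₁ : Type*} [AddCommGroup W₁] [Module ℂ W₁] {W₂ : Type*} [AddCommGroup W₂] [Module ℂ W₂]
  {M₁ : GeneralizedModule 𝒱 W₁} {M₂ : GeneralizedModule 𝒱 W₂} {z : ℂ}

theorem YPz_eq_sgT {h : ℤ} {v : V} (hv : v ∈ 𝒱.va.base.wt h) (hL : 𝒱.va.L.Lpos v = 0) (m : ℤ) :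
    YPz M₁ M₂ z v m = (-1 : ℂ) ^ h • sgT M₁ M₂ z (2 * h - 2 - m) 0 v := by
  rw [YPz_eq_sum M₁ M₂ z hv (MobiusOrConformal.Lpd_eq_zero_of_Lpos hL), Finset.sum_range_one,
    MobiusOrConformal.Lpd_zero]
  simp

theorem YPz_vacuum (hz : z ≠ 0) : VacuumProperty 𝒱.va.base.vac (YPz M₁ M₂ z) := by
  intro n
  rw [YPz_eq_sgT 𝒱.va.base.vac_mem 𝒱.va.Lpos_vac, zpow_zero, one_smul]
  ext lam : 1
  ext w₁ w₂
  simp only [TensorProduct.AlgebraTensorModule.curry_apply, LinearMap.restrictScalars_self,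
    TensorProduct.curry_apply]
  rw [sgT_apply, sg_vac hz, M₂.isModule.vacuum, LinearMap.lTensor_tmul]
  by_cases hn : n = -1
  · rw [if_pos hn, if_pos (by omega)]
    rfl
  · rw [if_neg hn, if_neg (by omega), LinearMap.zero_apply, TensorProduct.tmul_zero, map_zero]
    rfl

theorem LPz_eq_conformalOps (C : ConformalVertexAlgebra V) (h : 𝒱.va = .conformal C) :
    LPz M₁ M₂ z = conformalOps C.ω (YPz M₁ M₂ z) := by
  simp only [LPz, h]

theorem GeneralizedModule.L_eq_conformalOps {W : Type*} [AddCommGroup W] [Module ℂ W]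
    (M : GeneralizedModule 𝒱 W) (C : ConformalVertexAlgebra V) (h : 𝒱.va = .conformal C) :
    M.L = conformalOps C.ω M.Y := by
  have := M.isModule.symmetry
  rw [h] at this
  exact this.1

/-- In the conformal case `ω` has weight `2` and `L(1)ω = 0`, so its mode `m` is the transpose of
the action of `ω ⊗ t ^ (2 - m)`. On `W₁` this expands as `(t + z) ^ (2 - m)`, which is the binomial
formula of the Möbius case. -/
theorem LPz_eq : LPz M₁ M₂ z =
    { Lneg := Module.Dual.transpose (tensorSl2 M₁ M₂ z).Lpos
      Lzero := Module.Dual.transpose (tensorSl2 M₁ M₂ z).Lzero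
      Lpos := Module.Dual.transpose (tensorSl2 M₁ M₂ z).Lneg } := by
  cases h : 𝒱.va with
  | mobius M => simp only [LPz, h, tensorSl2]
  | conformal C =>
    have hω : C.ω ∈ 𝒱.va.base.wt 2 := by rw [h]; exact C.ω_mem
    have hL : 𝒱.va.L.Lpos C.ω = 0 := by
      rw [h]
      exact C.mode_omega_omega 1 le_rfl
    have hY : ∀ m, YPz M₁ M₂ z C.ω m = Module.Dual.transpose (sg M₁ M₂ z (2 - m) 0 C.ω) := by
      intro m
      rw [YPz_eq_sgT hω hL]
      norm_num
      rfl
    have p0 : pw z 0 0 = HahnSeries.single 0 1 := pw_zero_left z 0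
    have p1 : pw z 1 0 = HahnSeries.single 1 1 + z • HahnSeries.single 0 1 := by
      rw [show (1 : ℤ) = 0 + 1 by norm_num, pw_succ, pw_zero_left, pw_zero_left]
    have p2 : pw z 2 0 = HahnSeries.single 2 1 + (2 * z) • HahnSeries.single 1 1 +
        z ^ 2 • HahnSeries.single 0 1 := by
      rw [show (2 : ℤ) = 0 + 1 + 1 by norm_num, pw_succ, pw_succ, pw_succ, pw_zero_left,
        pw_zero_left, pw_zero_left, smul_add, smul_smul]
      norm_num
      module
    rw [LPz_eq_conformalOps C h]
    have hM₁ := M₁.L_eq_conformalOps C h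
    have hM₂ := M₂.L_eq_conformalOps C h
    simp only [conformalOps, tensorSl2, hY, hM₁, hM₂, Sl2Ops.mk.injEq, sg_apply]
    norm_num
    simp only [pw_zero_left, p0, p1, p2, TensorProduct.tmul_add, TensorProduct.tmul_smul, map_add,
      map_smul, tau_single, LinearMap.rTensor_add, LinearMap.rTensor_smul]
    refine ⟨by abel, by abel, by abel⟩

end Contragredient

/-! ### Restriction to stable subspaces and commutators on functionals -/

section Restriction

variable {V M : Type*} [AddCommGroup V] [Module ℂ V] [AddCommGroup M] [Module ℂ M]

/-- The restriction of a vertex operator map to a stable subspace. -/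
def restrictModes (Y : VOMap V M) (U : Submodule ℂ M)
    (hU : ∀ u ∈ U, ∀ (v : V) (n : ℤ), Y v n u ∈ U) : VOMap V U where
  toFun v n := (Y v n).restrict fun u hu => hU u hu v n
  map_add' v v' := by
    ext n u
    simp [LinearMap.restrict_apply]
  map_smul' c v := by
    ext n u
    simp [LinearMap.restrict_apply]

variable {Y : VOMap V M} {U : Submodule ℂ M} (hU : ∀ u ∈ U, ∀ (v : V) (n : ℤ), Y v n u ∈ U)

@[simp] theorem coe_restrictModes (v : V) (n : ℤ) (u : U) :
    (restrictModes Y U hU v n u : M) = Y v n u := rfl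

theorem coe_finsum {ι : Type*} (f : ι → U) : ((∑ᶠ i, f i : U) : M) = ∑ᶠ i, (f i : M) :=
  AddMonoidHom.map_finsum_of_injective U.subtype.toAddMonoidHom U.injective_subtype f

theorem jacobiIdentity_restrictModes {YV : VOMap V V}
    (h : ∀ (u v : V), ∀ w ∈ U, JacobiAt YV Y u v w) : JacobiIdentity YV (restrictModes Y U hU) := by
  intro u v w l m n
  apply Subtype.ext
  rw [Submodule.coe_sub, coe_finsum, coe_finsum, coe_finsum]
  exact h u v w w.2 l m n

theorem vacuumProperty_restrictModes {vac : V} (h : VacuumProperty vac Y) :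
    VacuumProperty vac (restrictModes Y U hU) := by
  intro n
  ext u
  rw [coe_restrictModes, h]
  split_ifs <;> rfl

end Restriction

section Contragredient

variable {B : Type*} [AddCommGroup B] {A : AddSubgroup B}
  {V : Type*} [AddCommGroup V] [Module ℂ V] {𝒱 : StronglyGradedVertexAlgebra A V}
  {W₁ : Type*} [AddCommGroup W₁] [Module ℂ W₁] {W₂ : Type*} [AddCommGroup W₂] [Module ℂ W₂]
  {M₁ : GeneralizedModule 𝒱 W₁} {M₂ : GeneralizedModule 𝒱 W₂} {z : ℂ}

theorem transpose_lie {M : Type*} [AddCommGroup M] [Module ℂ M] (a b : Module.End ℂ M) :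
    ⁅(Module.Dual.transpose a : Module.End ℂ (Module.Dual ℂ M)), Module.Dual.transpose b⁆ =
      -Module.Dual.transpose ⁅a, b⁆ := by
  ext lam w
  simp [Ring.lie_def, Module.Dual.transpose_apply]

/-- Transposition reverses brackets, and the exchange of `L(1)` with `L(-1)` compensates for this.
-/
theorem LPz_isSl2Rep : IsSl2Rep (LPz M₁ M₂ z) := by
  obtain ⟨h₁, h₂, h₃⟩ := tensorSl2_isSl2Rep M₁ M₂ z
  rw [LPz_eq]
  refine ⟨?_, ?_, ?_⟩
  · refine (transpose_lie _ _).trans ?_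
    rw [h₂, map_neg, neg_neg]
  · refine (transpose_lie _ _).trans ?_
    rw [h₁]
  · refine (transpose_lie _ _).trans ?_
    rw [end_lie_neg_swap, h₃, map_neg, neg_neg, map_smul]

theorem transpose_sgT {D : Module.End ℂ (W₁ ⊗[ℂ] W₂)} {v v₀ v₁ v₂ : V} {q k : ℤ}
    (hD : ⁅D, sg M₁ M₂ z q k v⁆ = sg M₁ M₂ z q k v₀ + sg M₁ M₂ z (q + 1) k v₁ +
      sg M₁ M₂ z (q + 2) k v₂) (lam : Module.Dual ℂ (W₁ ⊗[ℂ] W₂)) :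
    sgT M₁ M₂ z q k v (Module.Dual.transpose D lam) =
      Module.Dual.transpose D (sgT M₁ M₂ z q k v lam) +
      (sgT M₁ M₂ z q k v₀ lam + sgT M₁ M₂ z (q + 1) k v₁ lam + sgT M₁ M₂ z (q + 2) k v₂ lam) := by
  refine LinearMap.ext fun w => ?_
  have h := LinearMap.congr_fun hD w
  rw [Ring.lie_def, LinearMap.sub_apply, sub_eq_iff_eq_add] at h
  have h' := congrArg lam h
  simp only [LinearMap.add_apply, map_add, Module.End.mul_apply] at h'
  simp only [LinearMap.add_apply, Module.Dual.transpose_apply, LinearMap.comp_apply, sgT_apply]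
  rw [h']
  ring

/-- Commuting with `D` only shifts the exponent of `t` by amounts independent of `q` and `k`, and
shifts preserve expandability. -/
theorem transpose_mem_compatible {D : Module.End ℂ (W₁ ⊗[ℂ] W₂)}
    (hD : ∀ v, ∃ v₀ v₁ v₂, ∀ q k, ⁅D, sg M₁ M₂ z q k v⁆ = sg M₁ M₂ z q k v₀ +
      sg M₁ M₂ z (q + 1) k v₁ + sg M₁ M₂ z (q + 2) k v₂)
    {lam : Module.Dual ℂ (W₁ ⊗[ℂ] W₂)} (hlam : lam ∈ compatible M₁ M₂ z) :
    Module.Dual.transpose D lam ∈ compatible M₁ M₂ z := by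
  rw [mem_compatible] at hlam ⊢
  intro v
  obtain ⟨v₀, v₁, v₂, h⟩ := hD v
  have key : sgFamily M₁ M₂ z v (Module.Dual.transpose D lam) =
      (fun q k => Module.Dual.transpose D (sgFamily M₁ M₂ z v lam q k)) +
      (sgFamily M₁ M₂ z v₀ lam + (fun q k => sgFamily M₁ M₂ z v₁ lam (q + 1) k) +
        fun q k => sgFamily M₁ M₂ z v₂ lam (q + 2) k) := by
    funext q k
    exact transpose_sgT (h q k) lam
  rw [key]
  exact add_mem (expandable_map (hlam v) _) (add_mem (add_mem (hlam v₀)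
    (expandable_shift (hlam v₁) 1)) (expandable_shift (hlam v₂) 2))

theorem compatible_isPzStable (hz : z ≠ 0) : IsPzStable M₁ M₂ z (compatible M₁ M₂ z) := by
  intro lam hlam
  refine ⟨YPz_mem_compatible hz hlam, ?_⟩
  rw [LPz_eq]
  refine ⟨transpose_mem_compatible (fun v => ⟨𝒱.va.L.Lpos v,
      (2 : ℂ) • 𝒱.va.L.Lzero v, 𝒱.va.L.Lneg v, fun q k => ?_⟩) hlam,
    transpose_mem_compatible (fun v => ⟨𝒱.va.L.Lzero v, 𝒱.va.L.Lneg v, 0, fun q k => ?_⟩) hlam,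
    transpose_mem_compatible (fun v => ⟨𝒱.va.L.Lneg v, 0, 0, fun q k => ?_⟩) hlam⟩
  · rw [map_smul]
    exact (tensorSl2_lie_sg v q k).2.2
  · rw [map_zero, add_zero]
    exact (tensorSl2_lie_sg v q k).2.1
  · rw [map_zero, map_zero, add_zero, add_zero]
    exact (tensorSl2_lie_sg v q k).1

theorem jacobiIdentity_restrict_YPz (hz : z ≠ 0) {U : Submodule ℂ (Module.Dual ℂ (W₁ ⊗[ℂ] W₂))}
    (hU : ∀ u ∈ U, ∀ (v : V) (n : ℤ), YPz M₁ M₂ z v n u ∈ U) (hle : U ≤ compatible M₁ M₂ z) :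
    JacobiIdentity 𝒱.va.base.Y (restrictModes (YPz M₁ M₂ z) U hU) :=
  jacobiIdentity_restrictModes hU fun u v _ hw => YPz_jacobi hz (hle hw) u v

theorem derivative_restrict_YPz (hz : z ≠ 0) {U : Submodule ℂ (Module.Dual ℂ (W₁ ⊗[ℂ] W₂))}
    (hU : ∀ u ∈ U, ∀ (v : V) (n : ℤ), YPz M₁ M₂ z v n u ∈ U) (hle : U ≤ compatible M₁ M₂ z) :
    DerivativeProperty 𝒱.va.L.Lneg (restrictModes (YPz M₁ M₂ z) U hU) :=
  𝒱.va.derivative_of_jacobi (jacobiIdentity_restrict_YPz hz hU hle)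
    (vacuumProperty_restrictModes hU (YPz_vacuum hz))

/-- The formal derivation is applied to the space of all compatible functionals, which is stable
under the modes. -/
theorem YPz_Lneg (hz : z ≠ 0) {lam : Module.Dual ℂ (W₁ ⊗[ℂ] W₂)}
    (hlam : lam ∈ compatible M₁ M₂ z) (v : V) (n : ℤ) :
    YPz M₁ M₂ z (𝒱.va.L.Lneg v) n lam = (-n : ℂ) • YPz M₁ M₂ z v (n - 1) lam := by
  have h := derivative_restrict_YPz hz (fun u hu => (compatible_isPzStable hz u hu).1)
    (le_refl (compatible M₁ M₂ z)) v n
  exact congrArg Subtype.val (LinearMap.congr_fun h ⟨lam, hlam⟩)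

theorem sum_range_succ_smul_shift {N : Type*} [AddCommGroup N] [Module ℂ N] (g : ℕ → N) {K : ℕ}
    (hK : g K = 0) :
    ∑ k ∈ Finset.range K, (k + 1 : ℂ) • g (k + 1) = ∑ k ∈ Finset.range K, (k : ℂ) • g k := by
  have h := Finset.sum_range_succ' (fun k : ℕ => (k : ℂ) • g k) K
  rw [Finset.sum_range_succ, hK, smul_zero, add_zero] at h
  rw [h]
  simp

theorem transpose_tensorSl2_sgT (lam : Module.Dual ℂ (W₁ ⊗[ℂ] W₂)) (v : V) (q k : ℤ) :
    sgT M₁ M₂ z q k v (Module.Dual.transpose (tensorSl2 M₁ M₂ z).Lneg lam) =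
      Module.Dual.transpose (tensorSl2 M₁ M₂ z).Lneg (sgT M₁ M₂ z q k v lam) +
        sgT M₁ M₂ z q k (𝒱.va.L.Lneg v) lam ∧
    sgT M₁ M₂ z q k v (Module.Dual.transpose (tensorSl2 M₁ M₂ z).Lzero lam) =
      Module.Dual.transpose (tensorSl2 M₁ M₂ z).Lzero (sgT M₁ M₂ z q k v lam) +
        (sgT M₁ M₂ z q k (𝒱.va.L.Lzero v) lam + sgT M₁ M₂ z (q + 1) k (𝒱.va.L.Lneg v) lam) ∧
    sgT M₁ M₂ z q k v (Module.Dual.transpose (tensorSl2 M₁ M₂ z).Lpos lam) =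
      Module.Dual.transpose (tensorSl2 M₁ M₂ z).Lpos (sgT M₁ M₂ z q k v lam) +
        (sgT M₁ M₂ z q k (𝒱.va.L.Lpos v) lam +
          (2 : ℂ) • sgT M₁ M₂ z (q + 1) k (𝒱.va.L.Lzero v) lam +
          sgT M₁ M₂ z (q + 2) k (𝒱.va.L.Lneg v) lam) := by
  obtain ⟨a, b, c⟩ := tensorSl2_lie_sg (M₁ := M₁) (M₂ := M₂) (z := z) v q k
  refine ⟨?_, ?_, ?_⟩
  · have h := transpose_sgT (v := v) (q := q) (k := k) (v₀ := 𝒱.va.L.Lneg v) (v₁ := 0) (v₂ := 0)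
      (a.trans (by rw [map_zero, map_zero, add_zero, add_zero])) lam
    rwa [map_zero, map_zero, LinearMap.zero_apply, add_zero, add_zero] at h
  · have h := transpose_sgT (v := v) (q := q) (k := k) (v₀ := 𝒱.va.L.Lzero v)
      (v₁ := 𝒱.va.L.Lneg v) (v₂ := 0) (b.trans (by rw [map_zero, add_zero])) lam
    rwa [map_zero, LinearMap.zero_apply, add_zero] at h
  · have h := transpose_sgT (v := v) (q := q) (k := k) (v₀ := 𝒱.va.L.Lpos v)
      (v₁ := (2 : ℂ) • 𝒱.va.L.Lzero v) (v₂ := 𝒱.va.L.Lneg v) (c.trans (by rw [map_smul])) lam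
    rwa [map_smul, LinearMap.smul_apply] at h

section OnHomogeneous

variable {h : ℤ} {v : V} {K : ℕ}

/-- The summands of `YPz v m lam`, for `v` of weight `h`. -/
def oppSummand (M₁ : GeneralizedModule 𝒱 W₁) (M₂ : GeneralizedModule 𝒱 W₂) (z : ℂ) (h : ℤ) (v : V)
    (lam : Module.Dual ℂ (W₁ ⊗[ℂ] W₂)) (m : ℤ) (k : ℕ) : Module.Dual ℂ (W₁ ⊗[ℂ] W₂) :=
  sgT M₁ M₂ z (2 * h - 2 - k - m) 0 (𝒱.va.Lpd k v) lam

variable (lam : Module.Dual ℂ (W₁ ⊗[ℂ] W₂)) (m : ℤ)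

theorem YPz_eq_sum_oppSummand (hv : v ∈ 𝒱.va.base.wt h) (hK : ∀ k, K ≤ k → 𝒱.va.Lpd k v = 0) :
    YPz M₁ M₂ z v m lam =
      (-1 : ℂ) ^ h • ∑ k ∈ Finset.range K, oppSummand M₁ M₂ z h v lam m k := by
  rw [YPz_eq_sum M₁ M₂ z hv hK, LinearMap.sum_apply, Finset.smul_sum]
  rfl

theorem YPz_Lpos_eq_sum (hv : v ∈ 𝒱.va.base.wt h) (hK : ∀ k, K ≤ k → 𝒱.va.Lpd k v = 0) :
    YPz M₁ M₂ z (𝒱.va.L.Lpos v) m lam =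
      (-1 : ℂ) ^ h • ∑ k ∈ Finset.range K, (-k : ℂ) • oppSummand M₁ M₂ z h v lam (m + 1) k := by
  have hS : oppSummand M₁ M₂ z h v lam (m + 1) K = 0 := by
    rw [oppSummand, hK K le_rfl, map_zero, LinearMap.zero_apply]
  rw [YPz_eq_sum_oppSummand (K := K) lam m (MobiusOrConformal.Lpos_mem_wt hv) fun k hk => by
    rw [MobiusOrConformal.Lpd_Lpos, hK _ (by omega), smul_zero]]
  simp only [neg_smul, Finset.sum_neg_distrib]
  rw [← sum_range_succ_smul_shift _ hS, zpow_sub_one₀ (by norm_num : (-1 : ℂ) ≠ 0), smul_neg,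
    inv_neg_one, mul_neg_one, neg_smul]
  congr 2
  refine Finset.sum_congr rfl fun k _ => ?_
  rw [oppSummand, oppSummand, MobiusOrConformal.Lpd_Lpos, map_smul, LinearMap.smul_apply,
    show 2 * h - 2 - ((k + 1 : ℕ) : ℤ) - (m + 1) = 2 * (h - 1) - 2 - k - m by push_cast; ring]

theorem oppSummand_transpose (hz : z ≠ 0) (hv : v ∈ 𝒱.va.base.wt h) (k : ℕ) :
    oppSummand M₁ M₂ z h v (Module.Dual.transpose (tensorSl2 M₁ M₂ z).Lneg lam) m k =
      Module.Dual.transpose (tensorSl2 M₁ M₂ z).Lneg (oppSummand M₁ M₂ z h v lam m k) +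
        (k + m + 2 - 2 * h : ℂ) • oppSummand M₁ M₂ z h v lam (m + 1) k ∧
    oppSummand M₁ M₂ z h v (Module.Dual.transpose (tensorSl2 M₁ M₂ z).Lzero lam) m k =
      Module.Dual.transpose (tensorSl2 M₁ M₂ z).Lzero (oppSummand M₁ M₂ z h v lam m k) +
        (m + 1 - h : ℂ) • oppSummand M₁ M₂ z h v lam m k ∧
    oppSummand M₁ M₂ z h v (Module.Dual.transpose (tensorSl2 M₁ M₂ z).Lpos lam) m k =
      Module.Dual.transpose (tensorSl2 M₁ M₂ z).Lpos (oppSummand M₁ M₂ z h v lam m k) +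
        ((k + 1 : ℂ) • oppSummand M₁ M₂ z h v lam (m - 1) (k + 1) +
          (m - k : ℂ) • oppSummand M₁ M₂ z h v lam (m - 1) k) := by
  have hwt : 𝒱.va.L.Lzero (𝒱.va.Lpd k v) = (h - k : ℂ) • 𝒱.va.Lpd k v := by
    rw [𝒱.va.Lzero_wt _ _ (MobiusOrConformal.Lpd_mem_wt hv k)]
    push_cast
    rfl
  have hneg : ∀ q : ℤ, sgT M₁ M₂ z q 0 (𝒱.va.L.Lneg (𝒱.va.Lpd k v)) lam =
      (-q : ℂ) • sgT M₁ M₂ z (q - 1) 0 (𝒱.va.Lpd k v) lam := fun q => by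
    simp only [sgT, LinearMap.comp_apply, sg_Lneg hz, map_smul, LinearMap.smul_apply]
  have e1 : 2 * h - 2 - (k : ℤ) - m + 2 - 1 = 2 * h - 2 - k - (m - 1) := by ring
  have e2 : 2 * h - 2 - (k : ℤ) - m + 1 = 2 * h - 2 - k - (m - 1) := by ring
  have e3 : 2 * h - 2 - ((k + 1 : ℕ) : ℤ) - (m - 1) = 2 * h - 2 - k - m := by push_cast; ring
  have e4 : 2 * h - 2 - (k : ℤ) - m - 1 = 2 * h - 2 - k - (m + 1) := by ring
  obtain ⟨a, b, c⟩ := transpose_tensorSl2_sgT (M₁ := M₁) (M₂ := M₂) (z := z) lam (𝒱.va.Lpd k v)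
    (2 * h - 2 - k - m) 0
  simp only [oppSummand]
  refine ⟨?_, ?_, ?_⟩
  · rw [a, hneg, e4]
    push_cast
    module
  · rw [b, hwt, hneg, map_smul, LinearMap.smul_apply, add_sub_cancel_right]
    push_cast
    module
  · rw [c, MobiusOrConformal.Lpos_Lpd, hwt, hneg, map_smul, map_smul, LinearMap.smul_apply,
      LinearMap.smul_apply, e1, e2, e3]
    push_cast
    module

/-- Compatibility is avoided by eliminating `L(-1)v` in favour of modes of `v`, so the weight shift
is available for every functional. Terms depending on the summation index cancel for `L'(-1)` after
a shift of index, and assemble into the `L(1)v` term for `L'(1)`. -/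
theorem LPz_lie_YPz_of_mem_wt (hz : z ≠ 0) (hv : v ∈ 𝒱.va.base.wt h) :
    (LPz M₁ M₂ z).Lneg (YPz M₁ M₂ z v m lam) =
      YPz M₁ M₂ z v m ((LPz M₁ M₂ z).Lneg lam) - (m : ℂ) • YPz M₁ M₂ z v (m - 1) lam ∧
    (LPz M₁ M₂ z).Lzero (YPz M₁ M₂ z v m lam) =
      YPz M₁ M₂ z v m ((LPz M₁ M₂ z).Lzero lam) + (h - m - 1 : ℂ) • YPz M₁ M₂ z v m lam ∧
    (LPz M₁ M₂ z).Lpos (YPz M₁ M₂ z v m lam) =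
      YPz M₁ M₂ z v m ((LPz M₁ M₂ z).Lpos lam) + YPz M₁ M₂ z (𝒱.va.L.Lpos v) m lam +
        (2 * h - m - 2 : ℂ) • YPz M₁ M₂ z v (m + 1) lam := by
  obtain ⟨K, hK⟩ := exists_Lpd_eq_zero 𝒱 v
  have hS : ∀ m, oppSummand M₁ M₂ z h v lam m K = 0 := fun m => by
    rw [oppSummand, hK K le_rfl, map_zero, LinearMap.zero_apply]
  have hc := fun k => oppSummand_transpose (M₁ := M₁) (M₂ := M₂) lam m hz hv k
  rw [LPz_eq]
  dsimp only
  rw [YPz_Lpos_eq_sum lam m hv hK]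
  simp only [YPz_eq_sum_oppSummand _ _ hv hK]
  refine ⟨?_, ?_, ?_⟩
  · simp only [fun k => (hc k).2.2, Finset.sum_add_distrib]
    rw [sum_range_succ_smul_shift _ (hS _), map_smul, map_sum]
    simp only [sub_smul, Finset.sum_sub_distrib, ← Finset.smul_sum (r := (m : ℂ))]
    module
  · simp only [fun k => (hc k).2.1, Finset.sum_add_distrib, ← Finset.smul_sum, map_smul, map_sum]
    module
  · simp only [fun k => (hc k).1, Finset.sum_add_distrib, map_smul, map_sum, sub_smul, add_smul,
      neg_smul, Finset.sum_sub_distrib, Finset.sum_neg_distrib, ← Finset.smul_sum (r := (m : ℂ)),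
      ← Finset.smul_sum (r := (2 : ℂ)), ← Finset.smul_sum (r := (2 * h : ℂ))]
    module

end OnHomogeneous

theorem LPz_lie_YPz (hz : z ≠ 0) {lam : Module.Dual ℂ (W₁ ⊗[ℂ] W₂)}
    (hlam : lam ∈ compatible M₁ M₂ z) (v : V) (n : ℤ) :
    (LPz M₁ M₂ z).Lneg (YPz M₁ M₂ z v n lam) =
      YPz M₁ M₂ z v n ((LPz M₁ M₂ z).Lneg lam) + YPz M₁ M₂ z (𝒱.va.L.Lneg v) n lam ∧
    (LPz M₁ M₂ z).Lzero (YPz M₁ M₂ z v n lam) =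
      YPz M₁ M₂ z v n ((LPz M₁ M₂ z).Lzero lam) + (YPz M₁ M₂ z (𝒱.va.L.Lzero v) n lam +
        YPz M₁ M₂ z (𝒱.va.L.Lneg v) (n + 1) lam) ∧
    (LPz M₁ M₂ z).Lpos (YPz M₁ M₂ z v n lam) =
      YPz M₁ M₂ z v n ((LPz M₁ M₂ z).Lpos lam) + (YPz M₁ M₂ z (𝒱.va.L.Lpos v) n lam +
        (2 : ℂ) • YPz M₁ M₂ z (𝒱.va.L.Lzero v) (n + 1) lam +
        YPz M₁ M₂ z (𝒱.va.L.Lneg v) (n + 2) lam) := by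
  have hmem : v ∈ ⨆ n, 𝒱.va.base.wt n := by rw [𝒱.va.base.wt_grading.2]; trivial
  induction hmem using Submodule.iSup_induction' with
  | mem h v hv =>
    obtain ⟨a, b, c⟩ := LPz_lie_YPz_of_mem_wt (M₁ := M₁) (M₂ := M₂) lam n hz hv
    rw [a, b, c, 𝒱.va.Lzero_wt h v hv]
    simp only [YPz_Lneg hz hlam, map_smul, Pi.smul_apply, LinearMap.smul_apply]
    rw [add_sub_cancel_right, show n + 2 - 1 = n + 1 by ring]
    push_cast
    refine ⟨by module, by module, by module⟩
  | zero => simp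
  | add v v' _ _ h h' =>
    obtain ⟨a, b, c⟩ := h
    obtain ⟨a', b', c'⟩ := h'
    simp only [map_add, Pi.add_apply, LinearMap.add_apply, smul_add, a, b, c, a', b', c']
    refine ⟨by abel, by abel, by abel⟩

end Contragredient

/-! ### Subspaces containing homogeneous components -/

section Homogeneous

variable {ι κ M N : Type*} [AddCommGroup M] [Module ℂ M] [AddCommGroup N] [Module ℂ N]

/-- Whenever a finite sum of vectors `x i ∈ E i` lies in `p`, so do the `x i`. -/
def ContainsComponents (E : ι → Submodule ℂ M) (p : Submodule ℂ M) : Prop :=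
  ∀ (s : Finset ι) (x : ι → M), (∀ i ∈ s, x i ∈ E i) → ∑ i ∈ s, x i ∈ p → ∀ i ∈ s, x i ∈ p

variable {E F : ι → Submodule ℂ M} {p q : Submodule ℂ M}

theorem containsComponents_bot : ContainsComponents E ⊥ ↔ iSupIndep E := by
  rw [iSupIndep_iff_finsetSum_eq_zero_imp_eq_zero]
  simp only [ContainsComponents, Submodule.mem_bot]

theorem ContainsComponents.mono (h : ContainsComponents F p) (hEF : ∀ i, E i ≤ F i) :
    ContainsComponents E p :=
  fun s x hx => h s x fun i hi => hEF i (hx i hi)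

theorem ContainsComponents.sInf {S : Set (Submodule ℂ M)} (h : ∀ p ∈ S, ContainsComponents E p) :
    ContainsComponents E (sInf S) := by
  intro s x hx hsum i hi
  rw [Submodule.mem_sInf] at hsum ⊢
  exact fun p hp => h p hp s x hx (hsum p hp) i hi

theorem ContainsComponents.inf (hp : ContainsComponents E p) (hq : ContainsComponents E q) :
    ContainsComponents E (p ⊓ q) :=
  fun s x hx hsum i hi => ⟨hp s x hx hsum.1 i hi, hq s x hx hsum.2 i hi⟩

theorem containsComponents_iSup : ContainsComponents E (⨆ i, E i) :=
  fun _ _ hx _ i hi => Submodule.mem_iSup_of_mem i (hx i hi)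

theorem ContainsComponents.eq_iSup (h : ContainsComponents E p) (hle : p ≤ ⨆ i, E i) :
    p = ⨆ i, p ⊓ E i := by
  refine le_antisymm (fun x hx => ?_) (iSup_le fun i => inf_le_left)
  obtain ⟨f, hf, rfl⟩ := (Submodule.mem_iSup_iff_exists_finsupp _ _).mp (hle hx)
  exact Submodule.sum_mem _ fun i hi => Submodule.mem_iSup_of_mem i
    ⟨h f.support f (fun i _ => hf i) hx i hi, hf i⟩

theorem containsComponents_of_iSupIndep (hE : iSupIndep E) (hp : p = ⨆ i, p ⊓ E i) :
    ContainsComponents E p := by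
  classical
  intro s x hx hsum i hi
  rw [hp] at hsum
  obtain ⟨f, hf, hfx⟩ := (Submodule.mem_iSup_iff_exists_finsupp _ _).mp hsum
  have h := (iSupIndep_iff_finsetSum_eq_imp_eq E).mp hE (s ∪ f.support)
    (fun j => if j ∈ s then x j else 0) f (fun j _ => ⟨?_, (hf j).2⟩) ?_ i
    (Finset.mem_union_left _ hi)
  · rw [if_pos hi] at h
    rw [h]
    exact (hf i).1
  · split_ifs with hj
    · exact hx j hj
    · exact zero_mem _
  · rw [← Finset.sum_filter, Finset.filter_mem_eq_inter,
      Finset.inter_eq_right.mpr Finset.subset_union_left, ← hfx]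
    exact Finset.sum_subset Finset.subset_union_right fun j _ hj => Finsupp.notMem_support_iff.mp hj

/-- Grouping by the first index gives partial sums that the first family puts in `p`; within each
group the second family separates the summands. -/
theorem ContainsComponents.prod {G : κ → Submodule ℂ M} (hE : ContainsComponents E p)
    (hG : ContainsComponents G p) :
    ContainsComponents (fun i : ι × κ => E i.1 ⊓ G i.2) p := by
  classical
  intro s x hx hsum a ha
  have hfib : ∀ i ∈ s.image Prod.fst, ∑ b ∈ s with b.1 = i, x b ∈ p := by
    refine hE _ (fun i => ∑ b ∈ s with b.1 = i, x b) (fun i _ => ?_) ?_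
    · refine Submodule.sum_mem _ fun b hb => ?_
      obtain ⟨hb, hbi⟩ := Finset.mem_filter.mp hb
      exact hbi ▸ (hx b hb).1
    · convert hsum using 1
      exact Finset.sum_fiberwise_of_maps_to (fun b hb => Finset.mem_image_of_mem Prod.fst hb) x
  have h := hG ((s.filter fun b => b.1 = a.1).image Prod.snd) (fun j => x (a.1, j))
    (fun j hj => ?_) ?_ a.2
    (Finset.mem_image_of_mem _ (Finset.mem_filter.mpr ⟨ha, rfl⟩))
  · exact h
  · obtain ⟨b, hb, rfl⟩ := Finset.mem_image.mp hj
    obtain ⟨hb, hba⟩ := Finset.mem_filter.mp hb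
    rw [← hba]
    exact (hx b hb).2
  · rw [Finset.sum_image fun b hb c hc hbc => Prod.ext
      ((Finset.mem_filter.mp hb).2.trans (Finset.mem_filter.mp hc).2.symm) hbc]
    refine (congrArg (· ∈ p) (Finset.sum_congr rfl fun b hb => ?_)).mpr
      (hfib a.1 (Finset.mem_image_of_mem _ ha))
    rw [← (Finset.mem_filter.mp hb).2]

/-- A linear map that respects two families annihilates the components of the vectors that it
annihilates, if the family in the target is independent. -/
theorem map_component_eq_zero {E' : ι → Submodule ℂ N} (hE' : iSupIndep E')
    (T : M →ₗ[ℂ] N) (hT : ∀ i, ∀ x ∈ E i, T x ∈ E' i) (s : Finset ι) (x : ι → M)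
    (hx : ∀ i ∈ s, x i ∈ E i) (h : T (∑ i ∈ s, x i) = 0) : ∀ i ∈ s, T (x i) = 0 := by
  rw [map_sum] at h
  exact (iSupIndep_iff_finsetSum_eq_zero_imp_eq_zero E').mp hE' s (fun i => T (x i))
    (fun i hi => hT i _ (hx i hi)) h

/-- The hypothesis makes `T` intertwine `f - μ` with `g - (μ + c)`, hence their powers. -/
theorem map_mem_genEigenspace {f : Module.End ℂ M} {g : Module.End ℂ N} {T : M →ₗ[ℂ] N} {c : ℂ}
    (h : ∀ x, g (T x) = T (f x) + c • T x) {μ : ℂ} {k : ℕ∞} {x : M}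
    (hx : x ∈ f.genEigenspace μ k) : T x ∈ g.genEigenspace (μ + c) k := by
  rw [Module.End.mem_genEigenspace] at hx ⊢
  obtain ⟨l, hl, hx⟩ := hx
  refine ⟨l, hl, ?_⟩
  have key : ∀ (l : ℕ) (x : M), ((g - (μ + c) • 1) ^ l) (T x) = T (((f - μ • 1) ^ l) x) := by
    intro l
    induction l with
    | zero => intro x; rfl
    | succ l ih =>
      intro x
      rw [pow_succ, pow_succ, Module.End.mul_apply, Module.End.mul_apply, ← ih]
      congr 1
      simp only [LinearMap.sub_apply, LinearMap.smul_apply, Module.End.one_apply, h, map_sub,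
        map_smul]
      module
  rw [LinearMap.mem_ker] at hx ⊢
  rw [key, hx, map_zero]

/-- Pass to the quotient by `p`: the images of the summands lie in generalized eigenspaces of the
induced map, which are independent. This does not require `p` to be spanned by eigenvectors. -/
theorem containsComponents_genEigenspace (f : Module.End ℂ M) (k : ℕ∞)
    (hp : ∀ x ∈ p, f x ∈ p) : ContainsComponents (fun μ => f.genEigenspace μ k) p := by
  intro s x hx hsum i hi
  have h := map_component_eq_zero
    (Module.End.independent_genEigenspace (p.mapQ p f hp) k) p.mkQ
    (fun μ y hy => by
      have := map_mem_genEigenspace (g := p.mapQ p f hp) (T := p.mkQ) (c := 0)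
        (fun x => by simp) hy
      rwa [add_zero] at this) s x hx
    ((Submodule.Quotient.mk_eq_zero p).mpr hsum) i hi
  simpa using h

theorem iSup_comap_subtype_eq_top (h : p = ⨆ i, p ⊓ E i) :
    ⨆ i, (E i).comap p.subtype = ⊤ := by
  apply Submodule.map_injective_of_injective p.injective_subtype
  simp only [Submodule.map_iSup, Submodule.map_comap_subtype, Submodule.map_top,
    Submodule.range_subtype]
  exact h.symm

theorem iSupIndep_comap_subtype (hE : iSupIndep E) (p : Submodule ℂ M) :
    iSupIndep fun i => (E i).comap p.subtype := by
  rw [iSupIndep_iff_finsetSum_eq_zero_imp_eq_zero] at hE ⊢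
  intro s x hx hsum i hi
  have h := hE s (fun i => (x i : M)) hx (by
    rw [← Submodule.coe_sum, hsum, Submodule.coe_zero]) i hi
  exact Subtype.ext h

end Homogeneous

/-! ### The grading of functionals by `B` -/

section DualGrading

variable {B : Type*} [AddCommGroup B] {A : AddSubgroup B}
  {V : Type*} [AddCommGroup V] [Module ℂ V] {𝒱 : StronglyGradedVertexAlgebra A V}
  {W₁ : Type*} [AddCommGroup W₁] [Module ℂ W₁] {W₂ : Type*} [AddCommGroup W₂] [Module ℂ W₂]
  {M₁ : GeneralizedModule 𝒱 W₁} {M₂ : GeneralizedModule 𝒱 W₂} {z : ℂ}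

theorem tmul_mem_tensorGr {β₁ β₂ : B} {w₁ : W₁} {w₂ : W₂} (h₁ : w₁ ∈ M₁.gr β₁)
    (h₂ : w₂ ∈ M₂.gr β₂) : w₁ ⊗ₜ w₂ ∈ tensorGr M₁ M₂ (β₁ + β₂) :=
  Submodule.mem_iSup_of_mem β₁ (Submodule.mem_iSup_of_mem β₂ (Submodule.mem_iSup_of_mem rfl
    (Submodule.apply_mem_map₂ _ h₁ h₂)))

theorem tensorGr_le {γ : B} {p : Submodule ℂ (W₁ ⊗[ℂ] W₂)}
    (h : ∀ β₁ β₂, β₁ + β₂ = γ → ∀ w₁ ∈ M₁.gr β₁, ∀ w₂ ∈ M₂.gr β₂, w₁ ⊗ₜ w₂ ∈ p) :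
    tensorGr M₁ M₂ γ ≤ p :=
  iSup_le fun β₁ => iSup_le fun β₂ => iSup_le fun hγ => Submodule.map₂_le.mpr (h β₁ β₂ hγ)

theorem iSup_tensorGr : ⨆ γ, tensorGr M₁ M₂ γ = ⊤ := by
  rw [eq_top_iff, ← TensorProduct.span_tmul_eq_top, Submodule.span_le]
  rintro _ ⟨w₁, w₂, rfl⟩
  have h₁ : w₁ ∈ ⨆ β, M₁.gr β := by rw [M₁.isModule.gr_grading.2]; trivial
  have h₂ : w₂ ∈ ⨆ β, M₂.gr β := by rw [M₂.isModule.gr_grading.2]; trivial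
  refine Submodule.iSup_induction _
    (motive := fun w₁ => w₁ ⊗ₜ[ℂ] w₂ ∈ ⨆ γ, tensorGr M₁ M₂ γ) h₁ (fun β₁ w₁ hw₁ => ?_) ?_ ?_
  · refine Submodule.iSup_induction _
      (motive := fun w₂ => w₁ ⊗ₜ[ℂ] w₂ ∈ ⨆ γ, tensorGr M₁ M₂ γ) h₂ (fun β₂ w₂ hw₂ => ?_) ?_ ?_
    · exact Submodule.mem_iSup_of_mem _ (tmul_mem_tensorGr hw₁ hw₂)
    · rw [TensorProduct.tmul_zero]
      exact zero_mem _
    · intro x y hx hy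
      rw [TensorProduct.tmul_add]
      exact add_mem hx hy
  · rw [TensorProduct.zero_tmul]
    exact zero_mem _
  · intro x y hx hy
    rw [TensorProduct.add_tmul]
    exact add_mem hx hy

theorem mem_dualGr {β : B} {lam : Module.Dual ℂ (W₁ ⊗[ℂ] W₂)} :
    lam ∈ dualGr M₁ M₂ β ↔ ∀ γ, γ ≠ -β → ∀ w ∈ tensorGr M₁ M₂ γ, lam w = 0 := by
  simp only [dualGr, Submodule.mem_iInf, Submodule.mem_dualAnnihilator]

/-- On the part of degree `γ` only the summand with `β = -γ` can be nonzero. Hence it is enough that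
the spaces `tensorGr` span. -/
theorem dualGr_iSupIndep : iSupIndep (dualGr M₁ M₂) := by
  rw [iSupIndep_iff_finsetSum_eq_zero_imp_eq_zero]
  intro s x hx hsum β hβ
  rw [← LinearMap.ker_eq_top, eq_top_iff, ← iSup_tensorGr (M₁ := M₁) (M₂ := M₂)]
  refine iSup_le fun γ w hw => ?_
  rw [LinearMap.mem_ker]
  by_cases hγ : γ = -β
  · have h := LinearMap.congr_fun hsum w
    rwa [LinearMap.sum_apply, Finset.sum_eq_single β (fun β' hβ' hne =>
      mem_dualGr.mp (hx β' hβ') γ (fun h => hne (neg_injective (h.symm.trans hγ))) w hw)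
      (fun h => absurd hβ h)] at h
  · exact mem_dualGr.mp (hx β hβ) γ hγ w hw

/-- The transpose shifts by `α` and not by `-α`: contravariance and the sign in the dual grading
cancel. -/
theorem transpose_mem_dualGr {D : Module.End ℂ (W₁ ⊗[ℂ] W₂)} {α : B}
    (hD : ∀ γ, ∀ w ∈ tensorGr M₁ M₂ γ, D w ∈ tensorGr M₁ M₂ (α + γ)) {β : B}
    {lam : Module.Dual ℂ (W₁ ⊗[ℂ] W₂)} (hlam : lam ∈ dualGr M₁ M₂ β) :
    Module.Dual.transpose D lam ∈ dualGr M₁ M₂ (α + β) := by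
  rw [mem_dualGr] at hlam ⊢
  intro γ hγ w hw
  refine hlam (α + γ) (fun h => hγ ?_) _ (hD γ w hw)
  rw [eq_neg_iff_add_eq_zero] at h ⊢
  rw [← h]
  abel

theorem GeneralizedModule.tau_mem_gr {W : Type*} [AddCommGroup W] [Module ℂ W]
    (M : GeneralizedModule 𝒱 W) {α : A} {v : V} (hv : v ∈ 𝒱.gr α) (g : LaurentSeries ℂ) {β : B}
    {w : W} (hw : w ∈ M.gr β) : M.tau (v ⊗ₜ g) w ∈ M.gr (α + β) :=
  finsum_induction (· ∈ M.gr (α + β)) (zero_mem _) (fun _ _ => add_mem) fun n =>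
    Submodule.smul_mem _ _ (M.isModule.Y_gr α β n v hv w hw)

theorem sg_mem_tensorGr {α : A} {v : V} (hv : v ∈ 𝒱.gr α) (q k : ℤ) {γ : B}
    {w : W₁ ⊗[ℂ] W₂} (hw : w ∈ tensorGr M₁ M₂ γ) :
    sg M₁ M₂ z q k v w ∈ tensorGr M₁ M₂ (α + γ) := by
  refine tensorGr_le (p := (tensorGr M₁ M₂ (α + γ)).comap (sg M₁ M₂ z q k v)) ?_ hw
  rintro β₁ β₂ rfl w₁ h₁ w₂ h₂
  rw [Submodule.mem_comap, sg_tmul]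
  refine add_mem ?_ ?_
  · rw [← add_assoc]
    exact tmul_mem_tensorGr (M₁.tau_mem_gr hv _ h₁) h₂
  · rw [add_left_comm]
    exact tmul_mem_tensorGr h₁ (M₂.tau_mem_gr hv _ h₂)

theorem tensorSl2_mem_tensorGr {γ : B} {w : W₁ ⊗[ℂ] W₂} (hw : w ∈ tensorGr M₁ M₂ γ) :
    (tensorSl2 M₁ M₂ z).Lneg w ∈ tensorGr M₁ M₂ γ ∧
    (tensorSl2 M₁ M₂ z).Lzero w ∈ tensorGr M₁ M₂ γ ∧
    (tensorSl2 M₁ M₂ z).Lpos w ∈ tensorGr M₁ M₂ γ := by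
  have key : ∀ (S : Module.End ℂ W₁) (T : Module.End ℂ W₂),
      (∀ β, ∀ w ∈ M₁.gr β, S w ∈ M₁.gr β) → (∀ β, ∀ w ∈ M₂.gr β, T w ∈ M₂.gr β) →
      (LinearMap.lTensor W₁ T + LinearMap.rTensor W₂ S) w ∈ tensorGr M₁ M₂ γ := by
    intro S T hS hT
    refine tensorGr_le (p := (tensorGr M₁ M₂ γ).comap
      (LinearMap.lTensor W₁ T + LinearMap.rTensor W₂ S)) ?_ hw
    rintro β₁ β₂ rfl w₁ h₁ w₂ h₂
    rw [Submodule.mem_comap, LinearMap.add_apply, LinearMap.lTensor_tmul, LinearMap.rTensor_tmul]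
    exact add_mem (tmul_mem_tensorGr h₁ (hT _ _ h₂)) (tmul_mem_tensorGr (hS _ _ h₁) h₂)
  have g₁ := M₁.isModule.L_gr
  have g₂ := M₂.isModule.L_gr
  refine ⟨key _ _ (fun β w hw => (g₁ β w hw).1) (fun β w hw => (g₂ β w hw).1),
    key _ _ (fun β w hw => ?_) (fun β w hw => (g₂ β w hw).2.1),
    key _ _ (fun β w hw => ?_) (fun β w hw => (g₂ β w hw).2.2)⟩
  · exact add_mem (g₁ β w hw).2.1 (Submodule.smul_mem _ _ (g₁ β w hw).1)
  · exact add_mem (add_mem (g₁ β w hw).2.2 (Submodule.smul_mem _ _ (g₁ β w hw).2.1))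
      (Submodule.smul_mem _ _ (g₁ β w hw).1)

theorem sgT_mem_dualGr {α : A} {v : V} (hv : v ∈ 𝒱.gr α) (q k : ℤ) {β : B}
    {lam : Module.Dual ℂ (W₁ ⊗[ℂ] W₂)} (hlam : lam ∈ dualGr M₁ M₂ β) :
    sgT M₁ M₂ z q k v lam ∈ dualGr M₁ M₂ (α + β) :=
  transpose_mem_dualGr (fun _ _ hw => sg_mem_tensorGr hv q k hw) hlam

theorem Lpd_mem_gr {α : A} {v : V} (hv : v ∈ 𝒱.gr α) (k : ℕ) : 𝒱.va.Lpd k v ∈ 𝒱.gr α := by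
  rw [MobiusOrConformal.Lpd, LinearMap.smul_apply]
  refine Submodule.smul_mem _ _ ?_
  induction k with
  | zero => exact hv
  | succ k ih =>
    rw [pow_succ', Module.End.mul_apply]
    exact (𝒱.L_gr α _ ih).2.2

theorem YPz_mem_dualGr {α : A} {v : V} (hv : v ∈ 𝒱.gr α) (m : ℤ) {β : B}
    {lam : Module.Dual ℂ (W₁ ⊗[ℂ] W₂)} (hlam : lam ∈ dualGr M₁ M₂ β) :
    YPz M₁ M₂ z v m lam ∈ dualGr M₁ M₂ (α + β) := by
  rw [𝒱.gr_compat α] at hv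
  refine Submodule.iSup_induction _
    (motive := fun v => YPz M₁ M₂ z v m lam ∈ dualGr M₁ M₂ (α + β)) hv (fun h v hv => ?_) ?_ ?_
  · obtain ⟨K, hK⟩ := exists_Lpd_eq_zero 𝒱 v
    rw [YPz_eq_sum M₁ M₂ z hv.1 hK, LinearMap.sum_apply]
    exact Submodule.sum_mem _ fun k _ =>
      Submodule.smul_mem _ _ (sgT_mem_dualGr (Lpd_mem_gr hv.2 k) _ _ hlam)
  · rw [map_zero]
    exact zero_mem _
  · intro x y hx hy
    rw [map_add]
    exact add_mem hx hy

theorem LPz_mem_dualGr {β : B} {lam : Module.Dual ℂ (W₁ ⊗[ℂ] W₂)} (hlam : lam ∈ dualGr M₁ M₂ β) :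
    (LPz M₁ M₂ z).Lneg lam ∈ dualGr M₁ M₂ β ∧ (LPz M₁ M₂ z).Lzero lam ∈ dualGr M₁ M₂ β ∧
      (LPz M₁ M₂ z).Lpos lam ∈ dualGr M₁ M₂ β := by
  rw [LPz_eq, ← zero_add β]
  refine ⟨transpose_mem_dualGr (fun γ w hw => ?_) hlam, transpose_mem_dualGr (fun γ w hw => ?_) hlam,
    transpose_mem_dualGr (fun γ w hw => ?_) hlam⟩ <;> rw [zero_add]
  · exact (tensorSl2_mem_tensorGr hw).2.2
  · exact (tensorSl2_mem_tensorGr hw).2.1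
  · exact (tensorSl2_mem_tensorGr hw).1

/-- For `v` of degree `α`, every operator in the compatibility equations shifts the degree by `α`.
So the equations separate into components, with one bound `N` for all of them. -/
theorem compatible_containsComponents_dualGr :
    ContainsComponents (dualGr M₁ M₂) (compatible M₁ M₂ z) := by
  intro s x hx hsum β hβ
  refine sgFamily_mem_expandable_of_iSup_eq_top 𝒱.gr_grading.2 fun α v hv => ?_
  obtain ⟨N, hN, hF⟩ := mem_compatible.mp hsum v
  have hind : iSupIndep fun β : B => dualGr M₁ M₂ (α + β) :=
    dualGr_iSupIndep.comp (add_right_injective (α : B))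
  refine ⟨N, fun q hq => ?_, fun q k I hI => ?_⟩
  · exact map_component_eq_zero hind (sgT M₁ M₂ z q 0 v)
      (fun β y hy => sgT_mem_dualGr hv q 0 hy) s x hx (hN q hq) β hβ
  · have h := map_component_eq_zero hind (sgT M₁ M₂ z q k v -
        ∑ i ∈ Finset.range I, (bin k i * (-z) ^ i) • sgT M₁ M₂ z (q + k - i) 0 v)
      (fun β y hy => by
        rw [LinearMap.sub_apply, LinearMap.sum_apply]
        exact sub_mem (sgT_mem_dualGr hv q k hy) (Submodule.sum_mem _ fun i _ =>
          Submodule.smul_mem _ _ (sgT_mem_dualGr hv _ 0 hy))) s x hx (by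
        rw [LinearMap.sub_apply, LinearMap.sum_apply]
        exact sub_eq_zero.mpr (hF q k I hI)) β hβ
    rw [LinearMap.sub_apply, LinearMap.sum_apply] at h
    exact sub_eq_zero.mp h

end DualGrading

/-! ### The subspace generated by `λ` -/

section Generated

variable {B : Type*} [AddCommGroup B] {A : AddSubgroup B}
  {V : Type*} [AddCommGroup V] [Module ℂ V] {𝒱 : StronglyGradedVertexAlgebra A V}
  {W₁ : Type*} [AddCommGroup W₁] [Module ℂ W₁] {W₂ : Type*} [AddCommGroup W₂] [Module ℂ W₂]
  (M₁ : GeneralizedModule 𝒱 W₁) (M₂ : GeneralizedModule 𝒱 W₂) (z : ℂ)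

/-- The common generalization of `dualGen` (`k = ⊤`) and `dualOrd` (`k = 1`). -/
def dualWt (k : ℕ∞) (i : ℂ × B) : Submodule ℂ (Module.Dual ℂ (W₁ ⊗[ℂ] W₂)) :=
  (LPz M₁ M₂ z).Lzero.genEigenspace i.1 k ⊓ dualGr M₁ M₂ i.2

variable {M₁ M₂ z}

theorem dualWt_le_dualGen (k : ℕ∞) (i : ℂ × B) :
    dualWt M₁ M₂ z k i ≤ dualGen M₁ M₂ z i.1 i.2 :=
  inf_le_inf_right _ (((LPz M₁ M₂ z).Lzero.genEigenspace i.1).monotone le_top)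

theorem containsComponents_dualWt {p : Submodule ℂ (Module.Dual ℂ (W₁ ⊗[ℂ] W₂))} {k : ℕ∞}
    (hp : ∀ x ∈ p, (LPz M₁ M₂ z).Lzero x ∈ p) (hG : ContainsComponents (dualGr M₁ M₂) p) :
    ContainsComponents (dualWt M₁ M₂ z k) p :=
  (containsComponents_genEigenspace _ k hp).prod hG

theorem dualWt_iSupIndep (k : ℕ∞) : iSupIndep (dualWt M₁ M₂ z k) :=
  containsComponents_bot.mp (containsComponents_dualWt (fun x hx => by
    rw [(Submodule.mem_bot ℂ).mp hx, map_zero]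
    exact zero_mem _) (containsComponents_bot.mpr dualGr_iSupIndep))

theorem iSup_wt_inf_gr (𝒱 : StronglyGradedVertexAlgebra A V) :
    ⨆ i : A × ℤ, 𝒱.va.base.wt i.2 ⊓ 𝒱.gr i.1 = ⊤ := by
  rw [iSup_prod, ← 𝒱.gr_grading.2]
  exact iSup_congr fun α => (𝒱.gr_compat α).symm

theorem YPz_mem_dualWt (hz : z ≠ 0) {α : A} {h : ℤ} {v : V} (hv : v ∈ 𝒱.va.base.wt h)
    (hv' : v ∈ 𝒱.gr α) (m : ℤ) {k : ℕ∞} {n : ℂ} {β : B} {lam : Module.Dual ℂ (W₁ ⊗[ℂ] W₂)}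
    (hlam : lam ∈ dualWt M₁ M₂ z k (n, β)) :
    YPz M₁ M₂ z v m lam ∈ dualWt M₁ M₂ z k (n + (h - m - 1), α + β) :=
  ⟨map_mem_genEigenspace (fun lam => (LPz_lie_YPz_of_mem_wt lam m hz hv).2.1) hlam.1,
    YPz_mem_dualGr hv' m hlam.2⟩

theorem LPz_mem_dualWt {k : ℕ∞} {n : ℂ} {β : B} {lam : Module.Dual ℂ (W₁ ⊗[ℂ] W₂)}
    (hlam : lam ∈ dualWt M₁ M₂ z k (n, β)) :
    (LPz M₁ M₂ z).Lneg lam ∈ dualWt M₁ M₂ z k (n + 1, β) ∧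
    (LPz M₁ M₂ z).Lzero lam ∈ dualWt M₁ M₂ z k (n + 0, β) ∧
    (LPz M₁ M₂ z).Lpos lam ∈ dualWt M₁ M₂ z k (n + -1, β) := by
  obtain ⟨a, b, -⟩ := LPz_isSl2Rep (M₁ := M₁) (M₂ := M₂) (z := z)
  obtain ⟨g₁, g₂, g₃⟩ := LPz_mem_dualGr (z := z) hlam.2
  refine ⟨⟨map_mem_genEigenspace (fun x => ?_) hlam.1, g₁⟩,
    ⟨map_mem_genEigenspace (fun x => ?_) hlam.1, g₂⟩,
    ⟨map_mem_genEigenspace (fun x => ?_) hlam.1, g₃⟩⟩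
  · have h := LinearMap.congr_fun a x
    rw [Ring.lie_def, LinearMap.sub_apply, sub_eq_iff_eq_add'] at h
    rw [one_smul]
    exact h
  · rw [zero_smul, add_zero]
  · have h := LinearMap.congr_fun b x
    rw [Ring.lie_def, LinearMap.sub_apply, sub_eq_iff_eq_add'] at h
    rw [neg_one_smul]
    exact h

theorem iSup_dualWt_isPzStable (hz : z ≠ 0) (k : ℕ∞) :
    IsPzStable M₁ M₂ z (⨆ i, dualWt M₁ M₂ z k i) := by
  have key : ∀ T : Module.End ℂ (Module.Dual ℂ (W₁ ⊗[ℂ] W₂)),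
      (∀ n β, ∀ x ∈ dualWt M₁ M₂ z k (n, β), T x ∈ ⨆ i, dualWt M₁ M₂ z k i) →
      ∀ x ∈ ⨆ i, dualWt M₁ M₂ z k i, T x ∈ ⨆ i, dualWt M₁ M₂ z k i := fun T hT x hx =>
    iSup_le (a := Submodule.comap T (⨆ i, dualWt M₁ M₂ z k i)) (fun i y hy => hT i.1 i.2 y hy) hx
  refine fun u hu => ⟨fun v m => ?_, key _ (fun n β x hx => ?_) u hu,
    key _ (fun n β x hx => ?_) u hu, key _ (fun n β x hx => ?_) u hu⟩
  · have hv : v ∈ ⨆ i : A × ℤ, 𝒱.va.base.wt i.2 ⊓ 𝒱.gr i.1 := by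
      rw [iSup_wt_inf_gr]
      trivial
    refine Submodule.iSup_induction _
      (motive := fun v => YPz M₁ M₂ z v m u ∈ ⨆ i, dualWt M₁ M₂ z k i) hv (fun i v hv => ?_) ?_ ?_
    · exact key _ (fun n β x hx => Submodule.mem_iSup_of_mem _
        (YPz_mem_dualWt hz hv.1 hv.2 m hx)) u hu
    · rw [map_zero]
      exact zero_mem _
    · intro x y hx hy
      rw [map_add]
      exact add_mem hx hy
  · exact Submodule.mem_iSup_of_mem _ (LPz_mem_dualWt hx).1
  · exact Submodule.mem_iSup_of_mem _ (LPz_mem_dualWt hx).2.1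
  · exact Submodule.mem_iSup_of_mem _ (LPz_mem_dualWt hx).2.2

theorem IsPzStable.inf {U U' : Submodule ℂ (Module.Dual ℂ (W₁ ⊗[ℂ] W₂))}
    (hU : IsPzStable M₁ M₂ z U) (hU' : IsPzStable M₁ M₂ z U') : IsPzStable M₁ M₂ z (U ⊓ U') :=
  fun u hu => ⟨fun v n => ⟨(hU u hu.1).1 v n, (hU' u hu.2).1 v n⟩,
    ⟨(hU u hu.1).2.1, (hU' u hu.2).2.1⟩, ⟨(hU u hu.1).2.2.1, (hU' u hu.2).2.2.1⟩,
    ⟨(hU u hu.1).2.2.2, (hU' u hu.2).2.2.2⟩⟩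

theorem eq_iSup_inf_dualGen_iff {U : Submodule ℂ (Module.Dual ℂ (W₁ ⊗[ℂ] W₂))} :
    U = ⨆ (n : ℂ) (β : B), U ⊓ dualGen M₁ M₂ z n β ↔ U = ⨆ i, U ⊓ dualWt M₁ M₂ z ⊤ i := by
  rw [iSup_prod]
  rfl

/-- This subspace competes in the definition of `W_λ`. For `k = 1` it consists of sums of ordinary
eigenvectors, so minimality forces `L'_{P(z)}(0)` to be semisimple on `W_λ`, although `W_λ` is
defined through generalized eigenspaces. -/
theorem compatible_inf_iSup_dualWt_mem_gradedStable (hz : z ≠ 0) (k : ℕ∞)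
    {lam : Module.Dual ℂ (W₁ ⊗[ℂ] W₂)} (hlam : lam ∈ compatible M₁ M₂ z)
    (hlam' : lam ∈ ⨆ i, dualWt M₁ M₂ z k i) :
    compatible M₁ M₂ z ⊓ ⨆ i, dualWt M₁ M₂ z k i ∈ gradedStable M₁ M₂ z lam := by
  have hst := compatible_isPzStable (M₁ := M₁) (M₂ := M₂) hz
  refine ⟨eq_iSup_inf_dualGen_iff.mpr (le_antisymm ?_ (iSup_le fun i => inf_le_left)),
    ⟨hlam, hlam'⟩, hst.inf (iSup_dualWt_isPzStable hz k)⟩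
  have h := ContainsComponents.eq_iSup (((containsComponents_dualWt (k := k)
    (fun x hx => (hst x hx).2.2.1) compatible_containsComponents_dualGr).inf
      containsComponents_iSup)) inf_le_right
  refine h.le.trans (iSup_mono fun i => inf_le_inf_left _ (dualWt_le_dualGen k i))

variable {lam : Module.Dual ℂ (W₁ ⊗[ℂ] W₂)}

theorem Wgen_containsComponents_dualWt (k : ℕ∞) :
    ContainsComponents (dualWt M₁ M₂ z k) (Wgen M₁ M₂ z lam) :=
  (ContainsComponents.sInf fun _ hU => containsComponents_of_iSupIndep (dualWt_iSupIndep ⊤)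
    (eq_iSup_inf_dualGen_iff.mp hU.1)).mono fun i => dualWt_le_dualGen k i

theorem Wgen_le (hz : z ≠ 0) (k : ℕ∞) (hlam : lam ∈ compatible M₁ M₂ z)
    (hlam' : lam ∈ ⨆ i, dualWt M₁ M₂ z k i) :
    Wgen M₁ M₂ z lam ≤ compatible M₁ M₂ z ⊓ ⨆ i, dualWt M₁ M₂ z k i :=
  sInf_le (compatible_inf_iSup_dualWt_mem_gradedStable hz k hlam hlam')

/-- The point is that the intersection is still graded: containing components passes to
intersections, and `Wgen_le` shows that `W_λ` lies in the sum of the homogeneous spaces. -/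
theorem Wgen_isLeast (hz : z ≠ 0) (k : ℕ∞) (hlam : lam ∈ compatible M₁ M₂ z)
    (hlam' : lam ∈ ⨆ i, dualWt M₁ M₂ z k i) :
    IsLeast (gradedStable M₁ M₂ z lam) (Wgen M₁ M₂ z lam) := by
  refine ⟨⟨eq_iSup_inf_dualGen_iff.mpr ?_, ?_, Wgen_stable M₁ M₂ z lam⟩, fun U hU => sInf_le hU⟩
  · refine (Wgen_containsComponents_dualWt ⊤).eq_iSup ?_
    exact (Wgen_le hz k hlam hlam').trans (inf_le_right.trans
      (iSup_mono fun i => dualWt_le_dualGen k i))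
  · exact Submodule.mem_sInf.mpr fun U hU => hU.2.1

theorem WgenData_isStronglyGradedWith (hz : z ≠ 0) (k : ℕ∞) (hlam : lam ∈ compatible M₁ M₂ z)
    (hlam' : lam ∈ ⨆ i, dualWt M₁ M₂ z k i)
    (hfin : ∀ i, FiniteDimensional ℂ ↥(Wgen M₁ M₂ z lam ⊓ dualWt M₁ M₂ z k i))
    (htrunc : ∀ (n : ℂ) (β : B), ∃ K : ℤ, ∀ j : ℤ, j ≤ K →
      Wgen M₁ M₂ z lam ⊓ dualWt M₁ M₂ z k (n + j, β) = ⊥) :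
    IsStronglyGradedWith 𝒱 (WgenData M₁ M₂ z lam)
      fun n => (WgenData M₁ M₂ z lam).L.Lzero.genEigenspace n k := by
  have hle := Wgen_le hz k hlam hlam'
  have hC : Wgen M₁ M₂ z lam ≤ compatible M₁ M₂ z := hle.trans inf_le_left
  have hD : Wgen M₁ M₂ z lam ≤ ⨆ i, dualWt M₁ M₂ z k i := hle.trans inf_le_right
  have hst := Wgen_stable M₁ M₂ z lam
  have hW : Wgen M₁ M₂ z lam = ⨆ i, Wgen M₁ M₂ z lam ⊓ dualWt M₁ M₂ z k i :=
    (Wgen_containsComponents_dualWt k).eq_iSup hD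
  -- The eigenspaces of the restricted operator are traces of the ambient ones, so all grading
  -- axioms can be checked in the dual space.
  have hE : (fun n => (WgenData M₁ M₂ z lam).L.Lzero.genEigenspace n k) = fun n =>
      ((LPz M₁ M₂ z).Lzero.genEigenspace n k).comap (Wgen M₁ M₂ z lam).subtype :=
    funext fun n => Module.End.genEigenspace_restrict _ _ k n fun x hx => (hst x hx).2.2.1
  have hDE : ⨆ i, dualWt M₁ M₂ z k i ≤ ⨆ n, (LPz M₁ M₂ z).Lzero.genEigenspace n k :=
    iSup_le fun i => inf_le_left.trans (le_iSup (fun n => (LPz M₁ M₂ z).Lzero.genEigenspace n k) i.1)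
  have hinf : ∀ (n : ℂ) (β : B),
      ((LPz M₁ M₂ z).Lzero.genEigenspace n k).comap (Wgen M₁ M₂ z lam).subtype ⊓
        (WgenData M₁ M₂ z lam).gr β =
      (dualWt M₁ M₂ z k (n, β)).comap (Wgen M₁ M₂ z lam).subtype := fun n β => rfl
  have jac := jacobiIdentity_restrict_YPz hz (fun u hu => (hst u hu).1) hC
  have vac := vacuumProperty_restrictModes (fun u hu => (hst u hu).1) (YPz_vacuum hz)
  obtain ⟨r₁, r₂, r₃⟩ := LPz_isSl2Rep (M₁ := M₁) (M₂ := M₂) (z := z)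
  rw [hE]
  refine
    { lowerTruncated := fun v w => ?_
      vacuum := vac
      jacobi := jac
      symmetry := 𝒱.va.moduleSymmetry jac vac ⟨?_, ?_, ?_⟩ (fun v n => ⟨?_, ?_, ?_⟩) fun C h => ?_
      deriv := derivative_restrict_YPz hz (fun u hu => (hst u hu).1) hC
      wt_grading := ⟨iSupIndep_comap_subtype (Module.End.independent_genEigenspace _ k) _, ?_⟩
      gr_grading := ⟨iSupIndep_comap_subtype dualGr_iSupIndep _, ?_⟩
      gr_compat := fun β => ?_
      gr_trunc := fun n β => ?_
      gr_finite := fun n β => ?_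
      Y_gr := fun α β l v hv w hw => YPz_mem_dualGr hv l hw
      L_gr := fun β w hw => LPz_mem_dualGr hw }
  · obtain ⟨N, hN⟩ := YPz_truncated (hC w.2) v
    exact ⟨N, fun n hn => Subtype.ext (hN n hn)⟩
  · exact LinearMap.ext fun w => Subtype.ext (LinearMap.congr_fun r₁ w.1)
  · exact LinearMap.ext fun w => Subtype.ext (LinearMap.congr_fun r₂ w.1)
  · exact LinearMap.ext fun w => Subtype.ext (LinearMap.congr_fun r₃ w.1)
  · ext w : 1
    exact Subtype.ext (sub_eq_of_eq_add' (LPz_lie_YPz hz (hC w.2) v n).1)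
  · ext w : 1
    exact Subtype.ext (sub_eq_of_eq_add' (LPz_lie_YPz hz (hC w.2) v n).2.1)
  · ext w : 1
    exact Subtype.ext (sub_eq_of_eq_add' (LPz_lie_YPz hz (hC w.2) v n).2.2)
  · have hL := LPz_eq_conformalOps (M₁ := M₁) (M₂ := M₂) (z := z) C h
    simp only [WgenData, hL]
    rfl
  · exact iSup_comap_subtype_eq_top ((containsComponents_genEigenspace _ k
      fun x hx => (hst x hx).2.2.1).eq_iSup (hD.trans hDE))
  · refine iSup_comap_subtype_eq_top (le_antisymm (hW.le.trans (iSup_le fun i => ?_))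
      (iSup_le fun β => inf_le_left))
    exact le_iSup_of_le i.2 (inf_le_inf_left _ inf_le_right)
  -- The degree-`β` part is stable under `L'_{P(z)}(0)`, hence splits into its own eigenspaces.
  · have h := (containsComponents_genEigenspace (p := Wgen M₁ M₂ z lam ⊓ dualGr M₁ M₂ β)
      (LPz M₁ M₂ z).Lzero k fun x hx =>
        ⟨(hst x hx.1).2.2.1, (LPz_mem_dualGr hx.2).2.1⟩).eq_iSup
      (inf_le_left.trans (hD.trans hDE))
    apply Submodule.map_injective_of_injective (Wgen M₁ M₂ z lam).injective_subtype
    simp only [hinf, Submodule.map_iSup, Submodule.map_comap_subtype]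
    refine (Submodule.map_comap_subtype _ _).trans (h.trans (iSup_congr fun n => ?_))
    rw [inf_assoc, inf_comm (dualGr M₁ M₂ β)]
    rfl
  · obtain ⟨K, hK⟩ := htrunc n β
    refine ⟨K, fun j hj => ?_⟩
    apply Submodule.map_injective_of_injective (Wgen M₁ M₂ z lam).injective_subtype
    simp only [hinf, Submodule.map_comap_subtype, hK j hj, Submodule.map_bot]
  · have := hfin (n, β)
    rw [← Submodule.map_comap_subtype] at this
    have e := Submodule.equivMapOfInjective _ (Wgen M₁ M₂ z lam).injective_subtype
      ((dualWt M₁ M₂ z k (n, β)).comap (Wgen M₁ M₂ z lam).subtype)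
    exact Module.Finite.equiv e.symm

end Generated

end LogTensor

end

/-! ### The theorem: generalized (`k = ⊤`) and ordinary (`k = 1`) eigenspaces -/

open LogTensor in
theorem mainTheorem4 {B : Type*} [AddCommGroup B] {A : AddSubgroup B}
    {V : Type*} [AddCommGroup V] [Module ℂ V] (𝒱 : StronglyGradedVertexAlgebra A V)
    {W₁ : Type*} [AddCommGroup W₁] [Module ℂ W₁] (M₁ : GeneralizedModule 𝒱 W₁)
    {W₂ : Type*} [AddCommGroup W₂] [Module ℂ W₂] (M₂ : GeneralizedModule 𝒱 W₂)
    (z : ℂ) (hz : z ≠ 0) (lam : Module.Dual ℂ (W₁ ⊗[ℂ] W₂)) :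
    (lam ∈ COMP M₁ M₂ z ∩ LGRgen M₁ M₂ z →
      IsLeast (gradedStable M₁ M₂ z lam) (Wgen M₁ M₂ z lam) ∧
      IsStronglyGradedGeneralizedModule 𝒱 (WgenData M₁ M₂ z lam)) ∧
    (lam ∈ COMP M₁ M₂ z ∩ LGRord M₁ M₂ z →
      IsLeast (gradedStable M₁ M₂ z lam) (Wgen M₁ M₂ z lam) ∧
      Wgen M₁ M₂ z lam ≤ ⨆ (n : ℂ) (β : B), dualOrd M₁ M₂ z n β ∧
      IsStronglyGradedModule 𝒱 (WgenData M₁ M₂ z lam)) := by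
  have hgen : ⨆ (n : ℂ) (β : B), dualGen M₁ M₂ z n β = ⨆ i, dualWt M₁ M₂ z ⊤ i := by
    rw [iSup_prod]
    rfl
  have hord : ⨆ (n : ℂ) (β : B), dualOrd M₁ M₂ z n β = ⨆ i, dualWt M₁ M₂ z 1 i := by
    rw [iSup_prod]
    rfl
  constructor
  · rintro ⟨hcomp, hmem, hlgr⟩
    rw [hgen] at hmem
    have hC := COMP_subset_compatible hcomp
    exact ⟨Wgen_isLeast hz ⊤ hC hmem, WgenData_isStronglyGradedWith hz ⊤ hC hmem
      (fun i => (hlgr i.1 i.2).1) fun n β => (hlgr n β).2⟩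
  · rintro ⟨hcomp, hmem, hlgr⟩
    rw [hord] at hmem ⊢
    have hC := COMP_subset_compatible hcomp
    exact ⟨Wgen_isLeast hz 1 hC hmem, (Wgen_le hz 1 hC hmem).trans inf_le_right,
      WgenData_isStronglyGradedWith hz 1 hC hmem
        (fun i => (hlgr i.1 i.2).1) fun n β => (hlgr n β).2⟩
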